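/- Let $S\ge 0$ and $d$ be integers, let $p_0,\dots,p_{S+1}\in\mathbb{C}$ be distinct, let $A_0,\dots,A_{S+1}$ be complex $d\times d$ matrices, and put $$A(x)=\sum_{j=0}^{S+1}\frac{1}{x-p_j}A_j,\qquad Q(x)=\prod_{j=0}^{S+1}(x-p_j),\qquad A_\infty=\sum_{j=0}^{S+1}A_j .$$ A $d\times d$ matrix with eigenvalues $\lambda_1,\dots,\lambda_d$ (listed with multiplicity) is called nonlinearly nonresonant if $k+\mathbf{m}\cdot\boldsymbol{\lambda}-\lambda_i\neq 0$ for all $k\in\mathbb{N}=\{0,1,2,\dots\}$, all $\mathbf{m}\in\mathbb{N}^d$ with $|\mathbf{m}|=m_1+\dots+m_d\ge 2$, and all $i=1,\dots,d$. Assume that each of $A_0,\dots,A_{S+1},A_\infty$ is nonlinearly nonresonant. Let $D\subseteq\mathbb{C}$ be a simply connected domain containing $p_0,\dots,p_{S+1}$, and let $\mathbf{f}(x,\mathbf{u})\in\mathbb{C}^d$ be jointly analytic in $(x,\mathbf{u})$ for $x\in D$ and small $\mathbf{u}\in\mathbb{C}^d$ (that is, near each point $(x,0)$ with $x\in D$),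 with a zero of order at least two in $\mathbf{u}$ at $\mathbf{u}=0$: $\mathbf{f}(x,0)=0$ and $d_{\mathbf{u}}\mathbf{f}(x,0)=0$ for all $x\in D$. Then there exists a unique formal series $$\boldsymbol{\phi}(x,\mathbf{u})=\sum_{\mathbf{m}\in\mathbb{N}^d,\ |\mathbf{m}|\ge 2}\boldsymbol{\phi}_{\mathbf{m}}(x)\,\mathbf{u}^{\mathbf{m}},$$ whose coefficients $\boldsymbol{\phi}_{\mathbf{m}}(x)\in\mathbb{C}^d$ are (vector-valued) polynomials in $x$ of degree at most $S$, such that the corrected system $$\frac{d\mathbf{u}}{dx}=A(x)\mathbf{u}+\frac{1}{Q(x)}\bigl[\mathbf{f}(x,\mathbf{u})-\boldsymbol{\phi}(x,\mathbf{u})\bigr]$$ is formally linearizable over $D$, in the following sense: there is a formal series $$\mathbf{h}(x,\mathbf{w})=\sum_{|\mathbf{m}|\ge 2}\mathbf{h}_{\mathbf{m}}(x)\,\mathbf{w}^{\mathbf{m}}$$ with every $\mathbf{h}_{\mathbf{m}}$ analytic on $D$, such that the change of variables $\mathbf{u}=\mathbf{w}+\mathbf{h}(x,\mathbf{w})$ transforms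 the linear system $d\mathbf{w}/dx=A(x)\mathbf{w}$ into the corrected system. That is, with $\mathbf{U}(x,\mathbf{w})=\mathbf{w}+\mathbf{h}(x,\mathbf{w})$ and with $\mathbf{f}$ expanded in its Taylor series in $\mathbf{u}$ at $0$, $$\partial_x\mathbf{U}+(d_{\mathbf{w}}\mathbf{U})\,A(x)\mathbf{w}=A(x)\mathbf{U}+\frac{1}{Q(x)}\bigl[\mathbf{f}(x,\mathbf{U})-\boldsymbol{\phi}(x,\mathbf{U})\bigr]$$ as formal power series in $\mathbf{w}$, for every $x\in D\setminus\{p_0,\dots,p_{S+1}\}$. -/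

import Mathlib

open scoped Polynomial

noncomputable section

namespace Fuchs

/-- A (square, complex) matrix is nonlinearly nonresonant if its eigenvalues `μ 0, …, μ (d-1)`,
listed with algebraic multiplicity, satisfy `k + μ · m - μ i ≠ 0` for all `k ∈ ℕ`, all
multi-indices `m` with `|m| ≥ 2`, and all `i`. -/
def NonlinearlyNonresonant {d : ℕ} (M : Matrix (Fin d) (Fin d) ℂ) : Prop :=
  ∃ μ : Fin d → ℂ, M.charpoly = ∏ i, (Polynomial.X - Polynomial.C (μ i)) ∧
    ∀ (k : ℕ) (m : Fin d →₀ ℕ) (i : Fin d), 2 ≤ m.degree →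
      (k : ℂ) + ∑ l, (m l : ℂ) * μ l - μ i ≠ 0

/-- The Fuchsian matrix `A(x) = ∑ j, (x - p j)⁻¹ A j`. -/
def fuchsianMatrix {d N : ℕ} (p : Fin N → ℂ) (A : Fin N → Matrix (Fin d) (Fin d) ℂ) (x : ℂ) :
    Matrix (Fin d) (Fin d) ℂ :=
  ∑ j, (x - p j)⁻¹ • A j

/-- The polynomial function `Q(x) = ∏ j, (x - p j)`. -/
def Q {N : ℕ} (p : Fin N → ℂ) (x : ℂ) : ℂ := ∏ j, (x - p j)

/-- The partial derivative of `g` in the `k`-th coordinate. -/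
def partialDeriv {d : ℕ} (k : Fin d) (g : (Fin d → ℂ) → ℂ) : (Fin d → ℂ) → ℂ :=
  fun u => fderiv ℂ g u (Pi.single k 1)

/-- The iterated partial derivative `∂₀ ^ (m 0) ∂₁ ^ (m 1) ⋯ g`. -/
def iteratedPartialDeriv {d : ℕ} (m : Fin d →₀ ℕ) (g : (Fin d → ℂ) → ℂ) : (Fin d → ℂ) → ℂ :=
  (List.finRange d).foldr (fun k G => (partialDeriv k)^[m k] G) g

/-- The Taylor series at the origin, as a formal power series: the coefficient of `u ^ m` is
`∂ ^ m g (0) / m!`. -/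
def taylorSeries {d : ℕ} (g : (Fin d → ℂ) → ℂ) : MvPowerSeries (Fin d) ℂ :=
  fun m => iteratedPartialDeriv m g 0 / ∏ k, ((m k).factorial : ℂ)

/-- A tuple of `d` formal power series in `d` variables, depending on `x ∈ ℂ`. It serves both as
the right-hand side of a differential system `du/dx = V(x, u)` and as a formal change of
variables `u = U(x, w)`. -/
abbrev FormalMap (d : ℕ) : Type := ℂ → Fin d → MvPowerSeries (Fin d) ℂ

/-- The derivative in `x`, coefficient by coefficient. -/
def derivX {d : ℕ} (U : FormalMap d) : FormalMap d :=
  fun x i m => deriv (fun t => MvPowerSeries.coeff m (U t i)) x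

/-- The right-hand side `L(x) u` of a linear system. -/
def linearField {d : ℕ} (L : ℂ → Matrix (Fin d) (Fin d) ℂ) : FormalMap d :=
  fun x i => ∑ k, MvPowerSeries.C (L x i k) * MvPowerSeries.X k

/-- The change of variables `u = U(x, w)` transforms the system `dw/dx = W(x, w)` into the system
`du/dx = V(x, u)`, for `x ∈ Ω`: by the chain rule, `∂ₓ U + d_w U · W = V(x, U)`. -/
def Transforms {d : ℕ} (Ω : Set ℂ) (U W V : FormalMap d) : Prop :=
  ∀ x ∈ Ω, ∀ i, derivX U x i + ∑ k, MvPowerSeries.pderiv ℂ k (U x i) * W x k =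
    MvPowerSeries.subst (U x) (V x i)

/-- The change of variables `u = w + h(x, w)`. -/
def nearIdentity {d : ℕ} (h : FormalMap d) : FormalMap d :=
  fun x i => MvPowerSeries.X i + h x i

/-- `h(x, w)` is a series `∑ h_m(x) w ^ m` over `|m| ≥ 2` with every `h_m` analytic on `D`. -/
def IsAnalyticHigherOrder {d : ℕ} (D : Set ℂ) (h : FormalMap d) : Prop :=
  (∀ i m, m.degree < 2 → ∀ x, MvPowerSeries.coeff m (h x i) = 0) ∧
    ∀ i m, AnalyticOnNhd ℂ (fun x => MvPowerSeries.coeff m (h x i)) D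

/-- A formal correction `φ(x, u) = ∑ φ_m(x) u ^ m`, the sum over `|m| ≥ 2`, with coefficients
polynomials in `x` of degree at most `S`. -/
def IsCorrection {d : ℕ} (S : ℕ) (φ : Fin d → MvPowerSeries (Fin d) ℂ[X]) : Prop :=
  (∀ i m, m.degree < 2 → MvPowerSeries.coeff m (φ i) = 0) ∧
    ∀ i m, (MvPowerSeries.coeff m (φ i)).natDegree ≤ S

/-- The right-hand side, expanded in `u`, of the corrected system
`du/dx = A(x) u + Q(x)⁻¹ (f(x, u) - φ(x, u))`. -/
def correctedField {d N : ℕ} (p : Fin N → ℂ) (A : Fin N → Matrix (Fin d) (Fin d) ℂ)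
    (f : ℂ → (Fin d → ℂ) → Fin d → ℂ) (φ : Fin d → MvPowerSeries (Fin d) ℂ[X]) : FormalMap d :=
  fun x i => linearField (fuchsianMatrix p A) x i + MvPowerSeries.C (Q p x)⁻¹ *
    (taylorSeries (fun u => f x u i) - MvPowerSeries.map (Polynomial.evalRingHom x) (φ i))

end Fuchs

end

/-!
Write `U = w + h`. In degree `n ≥ 2` the conjugacy equation for the unknown homogeneous parts
`h_n(x)`, `φ_n(x)` reads `Q h_n' + Q ∑ j, (x - p j)⁻¹ L_j h_n + φ_n = R_n`, where `L_j` is the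
bracket with the linear vector field `w ↦ A_j w` and `R_n` is holomorphic on `D` and depends only on
the lower degrees (`transforms_iff`, `residual_congr`). So everything follows, by induction on the
degree, once this linear problem is uniquely solvable, with `h_n` holomorphic on `D` and `φ_n`
polynomial of degree at most `S`. The operator `∑ j, L_j` is the bracket with `A_∞`, and
nonresonance of `A_∞` makes `k + ∑ j, L_j` injective for every `k ∈ ℕ`
(`NonlinearlyNonresonant.eq_zero_of_homological`): the eigenvalues of the derivation along `w ↦ M w`
on homogeneous polynomials of degree `n` are the sums of `n` eigenvalues of `M`, by induction on `n`
through the gradient.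

*Polynomials.* The operator `fuchsOp` on the left sends `x ^ k v` to a polynomial of degree
`k + S + 1` with top coefficient `(k + ∑ j, L_j) v`. Hence polynomial right-hand sides are solved by
division with remainder, the remainder being `φ_n` (`IsPolyLT.exists_fuchsOp_add`), and the
homogeneous problem has no polynomial solutions (`IsPolyLT.eq_zero_of_fuchsOp`).

*Uniqueness.* A solution of the homogeneous problem on `D` has no monodromy around the whole set of
poles. To see this without paths, a homeomorphism supported in `D` moves all poles into a disc
inside `D`; outside that disc the solution continues along a growing family of discs, and becomes
entire (`exists_entire_solution`). As infinity is a regular singular point, it grows at most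
polynomially and is a polynomial, hence zero (`eq_zero_of_fuchsOp_add_polyMap`). Only connectedness
of `D` is used here.

*Existence.* By Runge's theorem (`exists_polynomial_near`), `R_n` is a locally uniform limit of
polynomials, for which the problem is solved. If the values of these solutions at a base point
and their remainders stay bounded along a subsequence, the solutions converge, by Grönwall's
inequality away from the poles and the maximum principle near them (`exists_limit_solution`);
otherwise the limit of the normalized solutions contradicts uniqueness
(`exists_fuchsOp_add_polyMap`). Runge's theorem comes from the Cauchy-Pompeiu formula with values in
the closure of the polynomials in `C(K, ℂ)`.
-/

namespace Fuchs

open Set Metric Filter Topology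

/-! ### Homeomorphisms gathering points of a plane domain -/

section

theorem isPreconnected_ball_diff_center (x : ℂ) (r : ℝ) : IsPreconnected (ball x r \ {x}) := by
  have h1 : IsPreconnected ({0}ᶜ : Set ℂ) :=
    (isConnected_compl_singleton_of_one_lt_rank (by simp) 0).isPreconnected
  rcases le_or_gt r 0 with hr | hr
  · simp [ball_eq_empty.2 hr, isPreconnected_empty]
  have h2 : ball x r \ {x} = (fun y : ℂ => x + ((r / (1 + ‖y‖) : ℝ) : ℂ) * y) '' {0}ᶜ := by
    ext z
    constructor
    · rintro ⟨hz, hzx⟩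
      have hz' : ‖z - x‖ < r := by simpa [dist_eq_norm] using hz
      have hzx' : z - x ≠ 0 := sub_ne_zero.2 hzx
      have hpos : 0 < r - ‖z - x‖ := by linarith
      have hposC : ((r - ‖z - x‖ : ℝ) : ℂ) ≠ 0 := by exact_mod_cast hpos.ne'
      refine ⟨(z - x) / ((r - ‖z - x‖ : ℝ) : ℂ), div_ne_zero hzx' hposC, ?_⟩
      have : r / (1 + ‖(z - x) / ((r - ‖z - x‖ : ℝ) : ℂ)‖) = r - ‖z - x‖ := by
        rw [norm_div, Complex.norm_real, Real.norm_of_nonneg hpos.le]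
        field_simp
        ring
      simp only [this]
      field_simp
      ring
    · rintro ⟨y, hy, rfl⟩
      have hy' : y ≠ 0 := hy
      have hpos : 0 < 1 + ‖y‖ := by positivity
      have hq : 0 < r / (1 + ‖y‖) := by positivity
      refine ⟨?_, ?_⟩
      · rw [mem_ball, dist_eq_norm, add_sub_cancel_left, norm_mul, Complex.norm_real,
          Real.norm_of_nonneg hq.le, div_mul_eq_mul_div, div_lt_iff₀ hpos]
        nlinarith [norm_nonneg y]
      · simp only [mem_singleton_iff, add_eq_left, mul_eq_zero, hy', or_false]
        exact_mod_cast hq.ne'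
  rw [h2]
  refine h1.image _ (Continuous.continuousOn ?_)
  have : ∀ y : ℂ, 1 + ‖y‖ ≠ 0 := fun y => by positivity
  fun_prop (disch := simpa using this _)

/-- Removing finitely many points does not disconnect an open connected subset of the plane. -/
theorem isPreconnected_diff_finite {D F : Set ℂ} (hD : IsPreconnected D) (hDo : IsOpen D)
    (hF : F.Finite) : IsPreconnected (D \ F) := by
  -- Two points are related if a connected subset of `D \ F` is a punctured neighbourhood of both.
  -- This makes sense for the points of `F` as well, so that connectedness of `D` applies.
  let P : ℂ → ℂ → Prop := fun x y =>
    ∃ C : Set ℂ, IsPreconnected C ∧ C ⊆ D \ F ∧ C ∈ 𝓝[≠] x ∧ C ∈ 𝓝[≠] y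
  have key : ∀ x ∈ D, ∀ y ∈ D, P x y := by
    intro x hx y hy
    refine IsPreconnected.induction₂ hD P ?_ ?_ ?_ hx hy
    · intro z hz
      have h1 : D ∩ (F \ {z})ᶜ ∈ 𝓝 z :=
        inter_mem (hDo.mem_nhds hz) ((hF.subset sdiff_subset).isClosed.isOpen_compl.mem_nhds
          (by simp))
      obtain ⟨r, hr, hb⟩ := Metric.mem_nhds_iff.1 h1
      refine mem_nhdsWithin_of_mem_nhds ?_
      filter_upwards [ball_mem_nhds z hr] with w hw
      refine ⟨ball z r \ {z}, isPreconnected_ball_diff_center z r, ?_, ?_, ?_⟩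
      · rintro u ⟨hu, huz⟩
        have := hb hu
        exact ⟨this.1, fun huF => this.2 ⟨huF, huz⟩⟩
      · exact sdiff_mem_nhdsWithin_compl (ball_mem_nhds z hr) _
      · by_cases hwz : w = z
        · subst hwz
          exact sdiff_mem_nhdsWithin_compl (ball_mem_nhds w hr) _
        · exact mem_nhdsWithin_of_mem_nhds
            ((isOpen_ball.sdiff isClosed_singleton).mem_nhds ⟨hw, hwz⟩)
    · rintro u v w - - - ⟨C, hC, hCD, hCu, hCv⟩ ⟨C', hC', hCD', hCv', hCw'⟩
      obtain ⟨q, hq⟩ := NeBot.nonempty_of_mem (inferInstance : (𝓝[≠] v).NeBot)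
        (inter_mem hCv hCv')
      exact ⟨C ∪ C', hC.union q hq.1 hq.2 hC', union_subset hCD hCD',
        mem_of_superset hCu subset_union_left, mem_of_superset hCw' subset_union_right⟩
    · rintro u v - - ⟨C, hC, hCD, hCu, hCv⟩
      exact ⟨C, hC, hCD, hCv, hCu⟩
  refine isPreconnected_of_forall_pair fun x hx y hy => ?_
  obtain ⟨C, hC, hCD, hCx, hCy⟩ := key x hx.1 y hy.1
  have cl : ∀ z, C ∈ 𝓝[≠] z → z ∈ closure C := fun z hz => by
    rw [mem_closure_iff_frequently]
    have : ∃ᶠ w in 𝓝[≠] z, w ∈ C := Eventually.frequently hz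
    exact this.filter_mono nhdsWithin_le_nhds
  refine ⟨C ∪ {x, y}, ?_, by simp, by simp, ?_⟩
  · exact union_subset hCD (by rintro w (rfl | rfl) <;> assumption)
  · refine hC.subset_closure subset_union_left (union_subset subset_closure ?_)
    rintro w (rfl | rfl)
    exacts [cl _ hCx, cl _ hCy]

/-- A homeomorphism of the plane that is the identity off the ball `ball c r` and moves its centre
`c` to `c + v`: the bump `x ↦ x + max 0 (1 - |x - c| / r) v`. -/
theorem exists_homeomorph_bump (c v : ℂ) {r : ℝ} (hv : ‖v‖ < r) :
    ∃ Φ : ℂ ≃ₜ ℂ, (∀ x ∉ ball c r, Φ x = x) ∧ Φ c = c + v := by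
  have hr : 0 < r := (norm_nonneg v).trans_lt hv
  let g : ℂ → ℂ := fun x => x + ((max 0 (1 - ‖x - c‖ / r) : ℝ) : ℂ) * v
  let K : NNReal := ⟨‖v‖ / r, by positivity⟩
  -- The bump is a Lipschitz perturbation of the identity with constant `‖v‖ / r < 1`.
  have hg : ApproximatesLinearOn g ((ContinuousLinearEquiv.refl ℂ ℂ : ℂ ≃L[ℂ] ℂ) : ℂ →L[ℂ] ℂ)
      univ K := by
    intro x _ y _
    have e : g x - g y - ((ContinuousLinearEquiv.refl ℂ ℂ : ℂ ≃L[ℂ] ℂ) : ℂ →L[ℂ] ℂ) (x - y) =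
        ((max 0 (1 - ‖x - c‖ / r) - max 0 (1 - ‖y - c‖ / r) : ℝ) : ℂ) * v := by
      simp only [g, ContinuousLinearEquiv.coe_refl, ContinuousLinearMap.coe_id', id]
      push_cast
      ring
    rw [e, norm_mul, Complex.norm_real, Real.norm_eq_abs]
    have h1 : |max 0 (1 - ‖x - c‖ / r) - max 0 (1 - ‖y - c‖ / r)| ≤ ‖x - y‖ / r := by
      rw [max_comm 0, max_comm 0]
      refine (abs_max_sub_max_le_abs (1 - ‖x - c‖ / r) (1 - ‖y - c‖ / r) 0).trans ?_
      have : (1 - ‖x - c‖ / r) - (1 - ‖y - c‖ / r) = (‖y - c‖ - ‖x - c‖) / r := by ring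
      rw [this, abs_div, abs_of_pos hr]
      gcongr
      have := abs_norm_sub_norm_le (y - c) (x - c)
      rwa [sub_sub_sub_cancel_right, norm_sub_rev y x] at this
    calc _ ≤ ‖x - y‖ / r * ‖v‖ := by gcongr
      _ = ‖v‖ / r * ‖x - y‖ := by ring
  have hK : K < ‖((ContinuousLinearEquiv.refl ℂ ℂ).symm : ℂ →L[ℂ] ℂ)‖₊⁻¹ := by
    have : ‖((ContinuousLinearEquiv.refl ℂ ℂ).symm : ℂ →L[ℂ] ℂ)‖₊ = 1 := by
      ext
      simp
    rw [this, inv_one]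
    exact (div_lt_one hr).2 hv
  refine ⟨hg.toHomeomorph g (Or.inr hK), fun x hx => ?_, ?_⟩
  · change g x = x
    have : 1 - ‖x - c‖ / r ≤ 0 := by
      rw [mem_ball, dist_eq_norm, not_lt] at hx
      rw [sub_nonpos, one_le_div hr]
      exact hx
    simp [g, max_eq_left this]
  · change g c = c + v
    simp [g]

/-- A point of a connected open set `D` can be moved to any other one by a homeomorphism of the
plane that is the identity off `D`. -/
theorem exists_homeomorph_move {D : Set ℂ} (hD : IsPreconnected D) (hDo : IsOpen D) {a b : ℂ}
    (ha : a ∈ D) (hb : b ∈ D) : ∃ Φ : ℂ ≃ₜ ℂ, (∀ x ∉ D, Φ x = x) ∧ Φ a = b := by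
  refine hD.induction₂ (fun a b => ∃ Φ : ℂ ≃ₜ ℂ, (∀ x ∉ D, Φ x = x) ∧ Φ a = b) ?_ ?_ ?_ ha hb
  · intro x hx
    obtain ⟨r, hr, hb⟩ := Metric.mem_nhds_iff.1 (hDo.mem_nhds hx)
    refine mem_nhdsWithin_of_mem_nhds ?_
    filter_upwards [ball_mem_nhds x hr] with y hy
    obtain ⟨Φ, h1, h2⟩ := exists_homeomorph_bump x (y - x) (r := r)
      (by simpa [dist_eq_norm] using hy)
    exact ⟨Φ, fun z hz => h1 z fun hz' => hz (hb hz'), by rw [h2]; ring⟩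
  · rintro x y z - - - ⟨Φ, h1, h2⟩ ⟨Ψ, h3, h4⟩
    exact ⟨Φ.trans Ψ, fun w hw => by simp [h1 w hw, h3 w hw], by simp [h2, h4]⟩
  · rintro x y - - ⟨Φ, h1, h2⟩
    exact ⟨Φ.symm, fun w hw => by rw [Homeomorph.symm_apply_eq, h1 w hw], by
      rw [Homeomorph.symm_apply_eq, h2]⟩

/-- Finitely many points of a connected open set `D` can be moved into a given open subset `B` by
a homeomorphism of the plane that is the identity off `D`. They are moved one at a time, in the
complement of those already moved. -/
theorem exists_homeomorph_gather {D : Set ℂ} (hD : IsPreconnected D) (hDo : IsOpen D) {N : ℕ}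
    (p : Fin N → ℂ) (hp : Function.Injective p) (hpD : ∀ j, p j ∈ D) {B : Set ℂ} (hBo : IsOpen B)
    (hB : B.Nonempty) (hBD : B ⊆ D) :
    ∃ Φ : ℂ ≃ₜ ℂ, (∀ x ∉ D, Φ x = x) ∧ ∀ j, Φ (p j) ∈ B := by
  suffices h : ∀ s : Finset (Fin N), ∃ Φ : ℂ ≃ₜ ℂ, (∀ x ∉ D, Φ x = x) ∧ ∀ j ∈ s, Φ (p j) ∈ B by
    obtain ⟨Φ, h1, h2⟩ := h Finset.univ
    exact ⟨Φ, h1, fun j => h2 j (Finset.mem_univ j)⟩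
  intro s
  induction s using Finset.induction_on with
  | empty => exact ⟨Homeomorph.refl ℂ, by simp, by simp⟩
  | insert k s hk ih =>
    obtain ⟨Φ, h1, h2⟩ := ih
    have hΦD : ∀ x ∈ D, Φ x ∈ D := fun x hx => by
      by_contra hc
      exact hc ((Φ.injective (h1 _ hc)).symm ▸ hx)
    let F : Set ℂ := (fun j => Φ (p j)) '' s
    have hF : F.Finite := s.finite_toSet.image _
    have hDF := isPreconnected_diff_finite hD hDo hF
    have hDFo : IsOpen (D \ F) := hDo.sdiff hF.isClosed
    have hkF : Φ (p k) ∈ D \ F := by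
      refine ⟨hΦD _ (hpD k), ?_⟩
      rintro ⟨j, hj, hjk⟩
      exact hk (hp (Φ.injective hjk) ▸ hj)
    obtain ⟨b, hbB, hbF⟩ : (B \ F).Nonempty := by
      by_contra hc
      rw [not_nonempty_iff_eq_empty, sdiff_eq_empty] at hc
      exact (infinite_of_mem_nhds hB.some (hBo.mem_nhds hB.some_mem)) (hF.subset hc)
    obtain ⟨Ψ, h3, h4⟩ := exists_homeomorph_move hDF hDFo hkF ⟨hBD hbB, hbF⟩
    refine ⟨Φ.trans Ψ, fun x hx => ?_, fun j hj => ?_⟩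
    · rw [Homeomorph.trans_apply, h1 x hx, h3 x fun hx' => hx hx'.1]
    · rcases Finset.mem_insert.1 hj with rfl | hj
      · rw [Homeomorph.trans_apply, h4]
        exact hbB
      · rw [Homeomorph.trans_apply, h3 _ fun hx' => hx'.2 ⟨j, hj, rfl⟩]
        exact h2 j hj

end

/-! ### Filling holes in simply connected domains, and the Cauchy-Pompeiu formula -/

section

/-- The function `z ↦ z - q` has no continuous logarithm outside a large ball. -/
theorem not_eventually_exp_eq_sub (q : ℂ) {G : ℂ → ℂ} (hG : Continuous G) :
    ¬ ∀ᶠ z in cocompact ℂ, Complex.exp (G z) = z - q := by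
  intro h
  obtain ⟨R, hR⟩ := (hasBasis_cocompact.eventually_iff.1 h)
  obtain ⟨hRc, hR⟩ := hR
  obtain ⟨r, hr, hRr⟩ := hRc.isBounded.subset_closedBall_lt 0 q
  let ρ : ℝ := r + 1
  have hρ : 0 < ρ := by positivity
  let g : ℝ → ℂ := fun θ => G (q + ρ * Complex.exp (θ * Complex.I)) - θ * Complex.I - Real.log ρ
  have hg : Continuous g := by fun_prop
  have hexp : ∀ θ, Complex.exp (g θ) = 1 := by
    intro θ
    have h1 : Complex.exp (G (q + ρ * Complex.exp (θ * Complex.I))) =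
        ρ * Complex.exp (θ * Complex.I) := by
      rw [hR]
      · ring
      · intro hmem
        have := hRr hmem
        rw [mem_closedBall, dist_eq_norm, add_sub_cancel_left, norm_mul, Complex.norm_real,
          Complex.norm_exp_ofReal_mul_I, Real.norm_of_nonneg hρ.le] at this
        simp only [ρ] at this
        linarith
    rw [Complex.exp_sub, Complex.exp_sub, h1, ← Complex.ofReal_exp, Real.exp_log hρ]
    have : (ρ : ℂ) ≠ 0 := by exact_mod_cast hρ.ne'
    field_simp
  -- `g / (2πi)` is continuous with integer values, hence constant.
  have hint : ∀ θ, ∃ n : ℤ, (g θ / (2 * Real.pi * Complex.I)).re = n := by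
    intro θ
    obtain ⟨n, hn⟩ := Complex.exp_eq_one_iff.1 (hexp θ)
    refine ⟨n, ?_⟩
    rw [hn, mul_div_assoc, div_self Complex.two_pi_I_ne_zero]
    simp
  choose n hn using hint
  have hnc : Continuous n := by
    rw [Int.isClosedEmbedding_coe_real.isEmbedding.continuous_iff]
    have : (Int.cast ∘ n : ℝ → ℝ) = fun θ => (g θ / (2 * Real.pi * Complex.I)).re :=
      funext fun θ => (hn θ).symm
    rw [this]
    fun_prop
  have hn0 : n 0 = n (2 * Real.pi) := PreconnectedSpace.constant inferInstance hnc
  have h1 := hn 0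
  rw [hn0, ← hn (2 * Real.pi)] at h1
  have h2 : g (2 * Real.pi) = g 0 - 2 * Real.pi * Complex.I := by
    simp only [g]
    have : Complex.exp (((2 * Real.pi : ℝ) : ℂ) * Complex.I) = 1 := by
      push_cast
      exact Complex.exp_two_pi_mul_I
    rw [this]
    push_cast
    simp
    ring
  rw [h2, sub_div (g 0), div_self Complex.two_pi_I_ne_zero, Complex.sub_re, Complex.one_re] at h1
  linarith

/-- A compact set whose boundary lies in a simply connected open set `D` lies in `D`. For a point
`q ∉ D`, a logarithm of `z - q` on the boundary would otherwise extend over the compact set, and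
`z - q` would have a logarithm near infinity. -/
theorem subset_of_frontier_subset {D : Set ℂ} (hDo : IsOpen D) (hD : IsSimplyConnected D)
    {C : Set ℂ} (hC : IsCompact C) (hfr : frontier C ⊆ D) : C ⊆ D := by
  classical
  intro q hqC
  by_contra hqD
  have h0 : (0 : ℂ) ∉ (fun z => z - q) '' D := by
    rintro ⟨z, hz, hzq⟩
    exact hqD (sub_eq_zero.1 hzq ▸ hz)
  obtain ⟨l, hlc, hl⟩ := Complex.exists_continuousOn_eqOn_exp_comp hD hDo
    (g := fun z => z - q) (by fun_prop) h0
  have hcl : IsClosed (frontier C) := isClosed_frontier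
  obtain ⟨L, hL⟩ := ContinuousMap.exists_restrict_eq hcl
    (⟨(frontier C).domRestrict l, (hlc.mono hfr).domRestrict⟩ : C(frontier C, ℂ))
  have hL' : ∀ z ∈ frontier C, L z = l z := fun z hz => congr($hL ⟨z, hz⟩)
  -- A nowhere vanishing continuous function on the plane that equals `z - q` off `C`.
  let g : ℂ → ℂ := fun z => if z ∈ C then Complex.exp (L z) else z - q
  have hg : Continuous g := by
    refine Continuous.if ?_ (by fun_prop) (by fun_prop)
    intro z hz
    rw [hL' z hz]
    exact hl (hfr hz)
  have hg0 : (0 : ℂ) ∉ g '' univ := by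
    rintro ⟨z, -, hz⟩
    by_cases hzC : z ∈ C
    · simp [g, hzC] at hz
    · simp only [g, hzC, if_false] at hz
      exact hzC (sub_eq_zero.1 hz ▸ hqC)
  have huniv : IsSimplyConnected (univ : Set ℂ) := by
    have := (convex_univ (𝕜 := ℝ) (E := ℂ)).contractibleSpace ⟨0, mem_univ _⟩
    exact SimplyConnectedSpace.ofContractible _
  obtain ⟨G, hGc, hG⟩ := Complex.exists_continuousOn_eqOn_exp_comp huniv isOpen_univ
    hg.continuousOn hg0
  refine not_eventually_exp_eq_sub q (continuousOn_univ.1 hGc) ?_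
  filter_upwards [hC.compl_mem_cocompact] with z hz
  have := hG (mem_univ z)
  simp only [Function.comp_apply, g] at this
  rwa [if_neg hz] at this

/-- Twice the Wirtinger derivative `∂F/∂z̄`. -/
noncomputable def twoDbar (F : ℂ → ℂ) (w : ℂ) : ℂ :=
  fderiv ℝ F w 1 + Complex.I * fderiv ℝ F w Complex.I

open MeasureTheory in
/-- The Cauchy-Pompeiu formula for a compactly supported function, by integration in polar
coordinates around `z`. -/
theorem integral_twoDbar {F : ℂ → ℂ} (hF : ContDiff ℝ 1 F) (hFs : HasCompactSupport F) (z : ℂ) :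
    ∫ w, w⁻¹ * twoDbar F (z + w) = -(2 * Real.pi) * F z := by
  let e : ℝ → ℂ := fun θ => Complex.exp (θ * Complex.I)
  have he : Continuous e := by fun_prop
  let Pr : ℝ × ℝ → ℂ := fun q => fderiv ℝ F (z + q.1 * e q.2) (e q.2)
  let Pt : ℝ × ℝ → ℂ := fun q => fderiv ℝ F (z + q.1 * e q.2) (Complex.I * e q.2)
  have hdF : Continuous (fderiv ℝ F) := hF.continuous_fderiv (by simp)
  have hPr : Continuous Pr := by
    have : Continuous fun q : ℝ × ℝ => fderiv ℝ F (z + q.1 * e q.2) := by fun_prop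
    exact this.clm_apply (by fun_prop)
  have hPt : Continuous Pt := by
    have : Continuous fun q : ℝ × ℝ => fderiv ℝ F (z + q.1 * e q.2) := by fun_prop
    exact this.clm_apply (by fun_prop)
  have hdFs : HasCompactSupport (fderiv ℝ F) := hFs.fderiv (𝕜 := ℝ)
  obtain ⟨R, hR0, hR⟩ := hdFs.isCompact.isBounded.subset_closedBall_lt 0 z
  have hzero : ∀ q : ℝ × ℝ, R < q.1 → fderiv ℝ F (z + q.1 * e q.2) = 0 := by
    intro q hq
    refine image_eq_zero_of_notMem_tsupport fun hmem => ?_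
    have := hR hmem
    rw [mem_closedBall, dist_eq_norm, add_sub_cancel_left, norm_mul, Complex.norm_real,
      Complex.norm_exp_ofReal_mul_I, mul_one] at this
    exact absurd ((le_abs_self _).trans this) (not_le.2 hq)
  have hint : ∀ P : ℝ × ℝ → ℂ, Continuous P → (∀ q : ℝ × ℝ, R < q.1 → P q = 0) →
      IntegrableOn P (Ioi (0 : ℝ) ×ˢ Ioo (-Real.pi) Real.pi) := by
    intro P hP hP0
    have h1 : IntegrableOn P (Icc (0 : ℝ) R ×ˢ Icc (-Real.pi) Real.pi) :=
      hP.continuousOn.integrableOn_compact (isCompact_Icc.prod isCompact_Icc)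
    refine h1.of_forall_sdiff_eq_zero (measurableSet_Ioi.prod measurableSet_Ioo) ?_
    rintro ⟨r, θ⟩ ⟨⟨hr, hθ⟩, hn⟩
    refine hP0 _ (not_le.1 fun hrR => hn ⟨⟨(mem_Ioi.1 hr).le, hrR⟩, Ioo_subset_Icc_self hθ⟩)
  have hPrI := hint Pr hPr fun q hq => by simp [Pr, hzero q hq]
  have hPtI := hint Pt hPt fun q hq => by simp [Pt, hzero q hq]
  have hd : ∀ w, HasFDerivAt F (fderiv ℝ F w) w := fun w =>
    (hF.differentiable (by simp) w).hasFDerivAt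
  -- The radial part integrates along rays to `-F z`.
  have hradial : ∫ q in Ioi (0 : ℝ) ×ˢ Ioo (-Real.pi) Real.pi, Pr q = -(2 * Real.pi) * F z := by
    rw [Measure.volume_eq_prod, ← Measure.prod_restrict, integral_prod_symm]
    swap
    · rwa [Measure.volume_eq_prod, IntegrableOn, ← Measure.prod_restrict] at hPrI
    have hray : ∀ θ : ℝ, ∫ r in Ioi (0 : ℝ), Pr (r, θ) = -F z := by
      intro θ
      let γ : ℝ → ℂ := fun r => z + r * e θ
      have hγ : ∀ r, HasDerivAt γ (e θ) r := fun r => by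
        have := ((Complex.ofRealCLM.hasDerivAt (x := r)).mul_const (e θ)).const_add z
        rwa [Complex.ofRealCLM_apply, Complex.ofReal_one, one_mul] at this
      have hγF : ∀ r, HasDerivAt (F ∘ γ) (Pr (r, θ)) r := fun r =>
        (hd (γ r)).comp_hasDerivAt r (hγ r)
      have hγc : ContDiff ℝ 1 γ := by
        have : γ = fun r => z + Complex.ofRealCLM r * e θ := rfl
        rw [this]
        exact contDiff_const.add (Complex.ofRealCLM.contDiff.mul contDiff_const)
      have hγi : Isometry γ := Isometry.of_dist_eq fun a b => by
        rw [dist_eq_norm, dist_eq_norm, add_sub_add_left_eq_sub, ← sub_mul, ← Complex.ofReal_sub,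
          norm_mul, Complex.norm_real, Complex.norm_exp_ofReal_mul_I, mul_one]
      have := HasCompactSupport.integral_Ioi_deriv_eq (hF.comp hγc)
        (hFs.comp_isClosedEmbedding hγi.isClosedEmbedding) 0
      rw [show deriv (F ∘ γ) = fun r => Pr (r, θ) from funext fun r => (hγF r).deriv] at this
      rw [this]
      simp [γ]
    simp_rw [hray]
    rw [setIntegral_const]
    simp [Measure.real, ← two_mul, Real.pi_pos.le]
  -- The angular part vanishes by periodicity.
  have hangular : ∫ q in Ioi (0 : ℝ) ×ˢ Ioo (-Real.pi) Real.pi, Pt q = 0 := by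
    rw [Measure.volume_eq_prod] at hPtI ⊢
    rw [setIntegral_prod _ hPtI]
    refine setIntegral_eq_zero_of_forall_eq_zero fun r hr => ?_
    have hr0 : (r : ℂ) ≠ 0 := by exact_mod_cast (mem_Ioi.1 hr).ne'
    have hder : ∀ θ ∈ uIcc (-Real.pi) Real.pi,
        HasDerivAt (fun θ : ℝ => (r : ℂ)⁻¹ * F (z + r * e θ)) (Pt (r, θ)) θ := by
      intro θ _
      have h1 : HasDerivAt (fun θ : ℝ => z + r * e θ) (r * (Complex.I * e θ)) θ := by
        have := ((Complex.ofRealCLM.hasDerivAt (x := θ)).mul_const Complex.I).cexp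
        simpa [e, mul_comm] using (this.const_mul (r : ℂ)).const_add z
      have h2 := ((hd (z + r * e θ)).comp_hasDerivAt θ h1).const_mul (r : ℂ)⁻¹
      have h3 : (r : ℂ) * (Complex.I * e θ) = r • (Complex.I * e θ) := (Complex.real_smul).symm
      rw [h3, map_smul, Complex.real_smul, inv_mul_cancel_left₀ hr0] at h2
      exact h2
    rw [← integral_Ioc_eq_integral_Ioo, ← intervalIntegral.integral_of_le
      (by linarith [Real.pi_pos]), intervalIntegral.integral_eq_sub_of_hasDerivAt hder
      ((hPt.comp (by fun_prop)).intervalIntegrable _ _)]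
    have : e Real.pi = e (-Real.pi) := by simp [e, Complex.exp_neg]
    rw [this, sub_self]
  have hpolar := Complex.integral_comp_polarCoord_symm fun w => w⁻¹ * twoDbar F (z + w)
  rw [← hpolar]
  have hcongr : ∀ q ∈ polarCoord.target, q.1 • ((Complex.polarCoord.symm q)⁻¹ *
      twoDbar F (z + Complex.polarCoord.symm q)) = Pr q + Complex.I * Pt q := by
    rintro ⟨r, θ⟩ hq
    have hr : (r : ℂ) ≠ 0 := by exact_mod_cast (mem_Ioi.1 hq.1).ne'
    have h1 : Complex.polarCoord.symm (r, θ) = r * e θ := by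
      simp [e, Complex.exp_mul_I]
    have h2 : e θ = (Real.cos θ : ℂ) + Real.sin θ * Complex.I := by
      simp [e, Complex.exp_mul_I]
    have h3 : e θ ≠ 0 := Complex.exp_ne_zero _
    have h4 : ((Real.cos θ : ℂ) + Real.sin θ * Complex.I) *
        (Real.cos θ - Real.sin θ * Complex.I) = 1 := by
      have := Complex.cos_sq_add_sin_sq θ
      push_cast
      linear_combination this - Complex.sin θ ^ 2 * Complex.I_sq
    have h5 : (e θ)⁻¹ = Real.cos θ - Real.sin θ * Complex.I := by
      rw [h2]
      exact inv_eq_of_mul_eq_one_right h4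
    have lin : ∀ (M : ℂ →L[ℝ] ℂ) (a b : ℝ), M (a + b * Complex.I) =
        a * M 1 + b * M Complex.I := by
      intro M a b
      have : (a + b * Complex.I : ℂ) = a • (1 : ℂ) + b • Complex.I := by simp
      rw [this, map_add, map_smul, map_smul, Complex.real_smul, Complex.real_smul]
    have h6 : Complex.I * e θ = ((-Real.sin θ : ℝ) : ℂ) + (Real.cos θ : ℝ) * Complex.I := by
      rw [h2]
      push_cast
      linear_combination Complex.sin θ * Complex.I_sq
    simp only [Pr, Pt]
    rw [h1, Complex.real_smul, mul_inv, h6, lin, twoDbar, h5]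
    generalize fderiv ℝ F (z + r * e θ) = M
    rw [h2, lin]
    field_simp
    push_cast
    linear_combination (-Complex.sin θ * M Complex.I) * Complex.I_sq
  have hs : polarCoord.target = Ioi (0 : ℝ) ×ˢ Ioo (-Real.pi) Real.pi := rfl
  rw [hs] at hcongr ⊢
  rw [setIntegral_congr_fun (measurableSet_Ioi.prod measurableSet_Ioo) hcongr, integral_add hPrI
    (hPtI.const_mul _), integral_const_mul, hradial, hangular]
  simp

end

/-! ### Runge's theorem -/

section

open MeasureTheory

theorem continuous_twoDbar {F : ℂ → ℂ} (hF : ContDiff ℝ 1 F) : Continuous (twoDbar F) := by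
  have hdF : Continuous (fderiv ℝ F) := hF.continuous_fderiv (by simp)
  unfold twoDbar
  fun_prop

theorem twoDbar_eq_zero {F : ℂ → ℂ} {w : ℂ} (hF : DifferentiableAt ℂ F w) : twoDbar F w = 0 := by
  have h1 : fderiv ℝ F w Complex.I = Complex.I * fderiv ℝ F w 1 := by
    rw [hF.fderiv_restrictScalars ℝ]
    simp
  rw [twoDbar, h1, ← mul_assoc, Complex.I_mul_I]
  ring

theorem support_twoDbar_subset (F : ℂ → ℂ) : Function.support (twoDbar F) ⊆ tsupport F := by
  intro w hw
  by_contra hc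
  refine hw ?_
  have : F =ᶠ[𝓝 w] fun _ => (0 : ℂ) := notMem_tsupport_iff_eventuallyEq.1 hc
  have h2 : DifferentiableAt ℂ F w := (differentiableAt_const 0).congr_of_eventuallyEq this
  exact twoDbar_eq_zero h2

/-- A function holomorphic on an open set `D` agrees, near a compact subset of `D`, with a
compactly supported continuously differentiable function. -/
theorem exists_contDiff_eq_near {D : Set ℂ} (hDo : IsOpen D) {R : ℂ → ℂ}
    (hR : DifferentiableOn ℂ R D) {C : Set ℂ} (hC : IsCompact C) (hCD : C ⊆ D) :
    ∃ F : ℂ → ℂ, ContDiff ℝ 1 F ∧ HasCompactSupport F ∧ ∀ w ∈ C, F =ᶠ[𝓝 w] R := by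
  obtain ⟨t, ht, hCt, htD⟩ := exists_compact_between hC hDo hCD
  obtain ⟨χ, h1, h0, -⟩ := exists_contMDiffMap_one_nhds_of_subset_interior
    (modelWithCornersSelf ℝ ℂ) (n := 1) hC.isClosed hCt
  have hχ : ContDiff ℝ 1 χ := χ.contMDiff.contDiff
  refine ⟨fun w => (χ w : ℂ) * R w, ?_, ?_, ?_⟩
  · refine contDiff_iff_contDiffAt.2 fun w => ?_
    by_cases hw : w ∈ D
    · have hRw : ContDiffAt ℝ 1 R w :=
        ((hR.analyticAt (hDo.mem_nhds hw)).contDiffAt (n := 1)).restrict_scalars ℝ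
      exact (Complex.ofRealCLM.contDiff.contDiffAt.comp w hχ.contDiffAt).mul hRw
    · have hw' : tᶜ ∈ 𝓝 w := ht.isClosed.isOpen_compl.mem_nhds fun h => hw (htD h)
      refine (contDiffAt_const (c := (0 : ℂ))).congr_of_eventuallyEq ?_
      filter_upwards [hw'] with u hu
      simp [h0 u hu]
  · refine HasCompactSupport.intro ht fun w hw => ?_
    simp [h0 w hw]
  · intro w hw
    filter_upwards [eventually_nhdsSet_iff_forall.1 h1 w hw] with u hu
    simp [hu]

/-- **Runge's theorem** for a simply connected domain: a holomorphic function on it is uniformly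
approximated by polynomials on compact subsets. The hull of `K` is the spectrum of the coordinate
function in the closure of the polynomials in `C(K, ℂ)`, and the Cauchy-Pompeiu formula
represents the function as an integral of resolvents off the hull. -/
theorem exists_polynomial_near {D : Set ℂ} (hDo : IsOpen D) (hD : IsSimplyConnected D) {R : ℂ → ℂ}
    (hR : DifferentiableOn ℂ R D) {K : Set ℂ} (hK : IsCompact K) (hKD : K ⊆ D) {ε : ℝ}
    (hε : 0 < ε) : ∃ q : ℂ[X], ∀ z ∈ K, ‖q.eval z - R z‖ < ε := by
  have : CompactSpace K := isCompact_iff_compactSpace.1 hK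
  let A : Subalgebra ℂ C(K, ℂ) := (polynomialFunctions K).topologicalClosure
  have hAc : IsClosed (A : Set C(K, ℂ)) := Subalgebra.isClosed_topologicalClosure _
  have : CompleteSpace A := hAc.completeSpace_coe
  let x : A := ⟨Polynomial.toContinuousMapOn Polynomial.X K,
    Subalgebra.le_topologicalClosure _ ⟨Polynomial.X, by simp⟩⟩
  have hx : ∀ z : K, (x : C(K, ℂ)) z = z := fun z => by simp [x]
  have hσc : IsCompact (spectrum ℂ x) := spectrum.isCompact x
  -- The boundary of the spectrum in the subalgebra belongs to the spectrum in `C(K, ℂ)`, which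
  -- is `K`.
  have hfr : frontier (spectrum ℂ x) ⊆ K := by
    intro w hw
    have h1 := Subalgebra.frontier_spectrum (𝕜 := ℂ) (hS := hAc) A x hw
    rw [ContinuousMap.spectrum_eq_range] at h1
    obtain ⟨z, rfl⟩ := h1
    rw [hx]
    exact z.2
  have hKσ : K ⊆ spectrum ℂ x := by
    intro z hz
    refine spectrum.subset_subalgebra (R := ℂ) x ?_
    rw [ContinuousMap.spectrum_eq_range]
    exact ⟨⟨z, hz⟩, hx _⟩
  have hσD : spectrum ℂ x ⊆ D := subset_of_frontier_subset hDo hD hσc (hfr.trans hKD)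
  obtain ⟨F, hF, hFs, hFR⟩ := exists_contDiff_eq_near hDo hR hσc hσD
  have hg : Continuous (twoDbar F) := continuous_twoDbar hF
  have hgs : HasCompactSupport (twoDbar F) := hFs.mono' (support_twoDbar_subset F)
  have hgσ : ∀ w ∈ tsupport (twoDbar F), w ∉ spectrum ℂ x := by
    intro w hw hwσ
    refine notMem_tsupport_iff_eventuallyEq.2 ?_ hw
    filter_upwards [(hFR w hwσ).eventuallyEq_nhds, hDo.mem_nhds (hσD hwσ)] with u hu huD
    have : DifferentiableAt ℂ F u :=
      ((hR u huD).differentiableAt (hDo.mem_nhds huD)).congr_of_eventuallyEq hu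
    exact twoDbar_eq_zero this
  let k : ℂ → A := fun w => twoDbar F w • resolvent x w
  have hk : Continuous k := by
    refine continuous_of_tsupport fun w hw => ?_
    have hw' : w ∈ tsupport (twoDbar F) :=
      closure_mono (Function.support_smul_subset_left _ _) hw
    have hres : w ∈ resolventSet ℂ x := by
      have := hgσ w hw'
      rwa [spectrum, Set.mem_compl_iff, not_not] at this
    exact hg.continuousAt.smul (spectrum.hasDerivAt_resolvent_const_left hres).continuousAt
  have hks : HasCompactSupport k := hgs.smul_right
  have hki : Integrable k := hk.integrable_of_hasCompactSupport hks
  -- Evaluation at `z` turns the resolvent at `w` into `(w - z)⁻¹`.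
  have heval : ∀ z : K, ((∫ w, k w : A) : C(K, ℂ)) z = -(2 * Real.pi) * R z := by
    intro z
    let ev : A →L[ℂ] ℂ := (ContinuousMap.evalCLM ℂ z).comp A.toSubmodule.subtypeL
    have h1 : ev (∫ w, k w) = ∫ w, ev (k w) := (ev.integral_comp_comm hki).symm
    have h2 : ∀ w, ev (k w) = (w - z)⁻¹ * twoDbar F (z + (w - z)) := by
      intro w
      rw [add_sub_cancel]
      by_cases hw : twoDbar F w = 0
      · simp [k, hw]
      have hres : w ∈ resolventSet ℂ x := by
        have := hgσ w (subset_tsupport _ hw)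
        rwa [spectrum, Set.mem_compl_iff, not_not] at this
      have h3 : (algebraMap ℂ A w - x) * resolvent x w = 1 := Ring.mul_inverse_cancel _ hres
      have h4 : (w - z) * ((resolvent x w : A) : C(K, ℂ)) z = 1 := by
        have := congr(($h3 : C(K, ℂ)) z)
        simpa [hx] using this
      have h5 : ((resolvent x w : A) : C(K, ℂ)) z = (w - z)⁻¹ :=
        eq_inv_of_mul_eq_one_right h4
      change twoDbar F w * ((resolvent x w : A) : C(K, ℂ)) z = _
      rw [h5, mul_comm]
    have h6 := integral_twoDbar hF hFs z
    rw [← integral_sub_right_eq_self (fun w => w⁻¹ * twoDbar F (z + w)) (z : ℂ)] at h6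
    simp_rw [← h2] at h6
    rw [← h1, (hFR z (hKσ z.2)).self_of_nhds] at h6
    exact h6
  -- The restriction of `R` to `K` is the value of the integral up to a constant factor.
  let RK : A := (-(2 * Real.pi : ℂ)⁻¹) • ∫ w, k w
  have hRK : ∀ z : K, (RK : C(K, ℂ)) z = R z := by
    intro z
    change (-(2 * Real.pi : ℂ)⁻¹) * ((∫ w, k w : A) : C(K, ℂ)) z = R z
    rw [heval]
    have : (Real.pi : ℂ) ≠ 0 := by exact_mod_cast Real.pi_ne_zero
    field_simp
  have hcl : (RK : C(K, ℂ)) ∈ closure (polynomialFunctions K : Set C(K, ℂ)) := RK.2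
  obtain ⟨_, ⟨q, -, rfl⟩, hq⟩ := Metric.mem_closure_iff.1 hcl ε hε
  refine ⟨q, fun z hz => ?_⟩
  have := (ContinuousMap.dist_apply_le_dist (⟨z, hz⟩ : K)).trans_lt hq
  rw [hRK, dist_comm, dist_eq_norm] at this
  simpa using this

end

/-! ### The Fuchsian operator on polynomials -/

section

variable {V : Type*} [NormedAddCommGroup V] [NormedSpace ℂ V]

/-- Polynomial functions `ℂ → V` of degree less than `n`. -/
def IsPolyLT (n : ℕ) (g : ℂ → V) : Prop :=
  ∃ c : ℕ → V, ∀ x, g x = ∑ l ∈ Finset.range n, x ^ l • c l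

theorem IsPolyLT.congr {n : ℕ} {f g : ℂ → V} (hf : IsPolyLT n f) (h : ∀ x, f x = g x) :
    IsPolyLT n g :=
  (funext h : f = g) ▸ hf

theorem IsPolyLT.mono {m n : ℕ} (h : m ≤ n) {g : ℂ → V} (hg : IsPolyLT m g) : IsPolyLT n g := by
  obtain ⟨c, hc⟩ := hg
  refine ⟨fun l => if l < m then c l else 0, fun x => ?_⟩
  rw [hc, ← Finset.sum_subset (Finset.range_subset_range.2 h)]
  · exact Finset.sum_congr rfl fun l hl => by simp [Finset.mem_range.1 hl]
  · intro l _ hl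
    have hl' : ¬ l < m := fun h => hl (Finset.mem_range.2 h)
    simp [hl']

theorem IsPolyLT.add {n : ℕ} {f g : ℂ → V} (hf : IsPolyLT n f) (hg : IsPolyLT n g) :
    IsPolyLT n fun x => f x + g x := by
  obtain ⟨c, hc⟩ := hf
  obtain ⟨e, he⟩ := hg
  exact ⟨fun l => c l + e l, fun x => by simp only [hc, he, smul_add, Finset.sum_add_distrib]⟩

theorem IsPolyLT.neg {n : ℕ} {f : ℂ → V} (hf : IsPolyLT n f) : IsPolyLT n fun x => -f x := by
  obtain ⟨c, hc⟩ := hf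
  exact ⟨fun l => -c l, fun x => by simp only [hc, smul_neg, Finset.sum_neg_distrib]⟩

theorem IsPolyLT.zero (n : ℕ) : IsPolyLT n fun _ : ℂ => (0 : V) :=
  ⟨fun _ => 0, fun x => by simp⟩

theorem IsPolyLT.sum {n : ℕ} {ι : Type*} (s : Finset ι) {f : ι → ℂ → V}
    (hf : ∀ i ∈ s, IsPolyLT n (f i)) : IsPolyLT n fun x => ∑ i ∈ s, f i x := by
  classical
  induction s using Finset.induction_on with
  | empty => simpa using IsPolyLT.zero n
  | insert i s hi ih =>
    simp only [Finset.sum_insert hi]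
    exact (hf i (Finset.mem_insert_self i s)).add
      (ih fun j hj => hf j (Finset.mem_insert_of_mem hj))

theorem isPolyLT_eval_smul {n : ℕ} {q : ℂ[X]} (hq : q.degree < n) (v : V) :
    IsPolyLT n fun x => q.eval x • v := by
  refine ⟨fun l => q.coeff l • v, fun x => ?_⟩
  rcases eq_or_ne q 0 with rfl | h0
  · simp
  simp only [Polynomial.eval_eq_sum_range' ((Polynomial.natDegree_lt_iff_degree_lt h0).2 hq),
    Finset.sum_smul]
  exact Finset.sum_congr rfl fun l _ => by rw [smul_smul, mul_comm]

theorem IsPolyLT.differentiable {n : ℕ} {g : ℂ → V} (hg : IsPolyLT n g) : Differentiable ℂ g := by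
  obtain ⟨c, hc⟩ := hg
  rw [funext hc]
  fun_prop

theorem IsPolyLT.eq_zero_of_pow_smul_add {n : ℕ} {v : V} {g : ℂ → V} (hg : IsPolyLT n g)
    (h : ∀ x : ℂ, x ^ n • v + g x = 0) : v = 0 := by
  obtain ⟨c, hc⟩ := hg
  refine (SeparatingDual.eq_zero_iff_forall_dual_eq_zero (R := ℂ) v).2 fun f => ?_
  have h1 : Polynomial.C (f v) * Polynomial.X ^ n +
      ∑ l ∈ Finset.range n, Polynomial.C (f (c l)) * Polynomial.X ^ l = 0 := by
    refine Polynomial.funext fun x => ?_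
    have := congrArg f (h x)
    rw [hc, map_add, map_sum, map_smul, map_zero] at this
    simp only [map_smul, smul_eq_mul] at this
    simp only [Polynomial.eval_add, Polynomial.eval_mul, Polynomial.eval_C, Polynomial.eval_pow,
      Polynomial.eval_X, Polynomial.eval_finsetSum, Polynomial.eval_zero]
    rw [← this, mul_comm]
    congr 1
    exact Finset.sum_congr rfl fun l _ => mul_comm _ _
  have h2 := congrArg (Polynomial.coeff · n) h1
  simp only [Polynomial.coeff_add, Polynomial.coeff_C_mul, Polynomial.coeff_X_pow, if_true,
    Polynomial.finsetSum_coeff, mul_one, Polynomial.coeff_zero] at h2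
  rw [Finset.sum_eq_zero, add_zero] at h2
  · exact h2
  · intro l hl
    rw [if_neg (Finset.mem_range.1 hl).ne', mul_zero]

/-- The vector-valued polynomial `∑ c_l x ^ l` of degree at most `S`. -/
def polyMap {S : ℕ} (c : Fin (S + 1) → V) (x : ℂ) : V := ∑ l : Fin (S + 1), x ^ (l : ℕ) • c l

theorem isPolyLT_polyMap {S : ℕ} (c : Fin (S + 1) → V) : IsPolyLT (S + 1) (polyMap c) := by
  refine ⟨fun l => if h : l < S + 1 then c ⟨l, h⟩ else 0, fun x => ?_⟩
  rw [polyMap, Finset.sum_range]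
  exact Finset.sum_congr rfl fun l _ => by simp only [l.2, dif_pos]

theorem IsPolyLT.exists_polyMap {S : ℕ} {g : ℂ → V} (hg : IsPolyLT (S + 1) g) :
    ∃ c : Fin (S + 1) → V, g = polyMap c := by
  obtain ⟨c, hc⟩ := hg
  exact ⟨fun l => c l, funext fun x => by rw [hc, polyMap, Finset.sum_range]⟩

theorem polyMap_add {S : ℕ} (c e : Fin (S + 1) → V) (x : ℂ) :
    polyMap (c + e) x = polyMap c x + polyMap e x := by
  simp [polyMap, Finset.sum_add_distrib]

theorem polyMap_smul {S : ℕ} (a : ℂ) (c : Fin (S + 1) → V) (x : ℂ) :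
    polyMap (a • c) x = a • polyMap c x := by
  simp only [polyMap, Finset.smul_sum, Pi.smul_apply]
  exact Finset.sum_congr rfl fun l _ => smul_comm _ _ _

theorem polyMap_injective {S : ℕ} {c : Fin (S + 1) → V} (h : ∀ x, polyMap c x = 0) : c = 0 := by
  classical
  by_contra hc
  obtain ⟨l, hl⟩ := Function.ne_iff.1 hc
  let s : Finset (Fin (S + 1)) := Finset.univ.filter fun l => c l ≠ 0
  have hs : s.Nonempty := ⟨l, by simpa [s] using hl⟩
  -- The top nonzero coefficient.
  let k := s.max' hs
  have hk : c k ≠ 0 := by simpa [s] using s.max'_mem hs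
  have hgt : ∀ l, k < l → c l = 0 := fun l hl => by
    by_contra hcl
    exact absurd (s.le_max' l (by simpa [s] using hcl)) (not_le.2 hl)
  refine hk (IsPolyLT.eq_zero_of_pow_smul_add (n := k)
    (g := fun x => ∑ l ∈ Finset.univ.erase k, x ^ (l : ℕ) • c l) ?_ fun x => ?_)
  · refine IsPolyLT.sum _ fun l hl => ?_
    rcases lt_or_gt_of_ne (Finset.ne_of_mem_erase hl) with h1 | h1
    · have := isPolyLT_eval_smul (q := Polynomial.X ^ (l : ℕ)) (n := k)
        (by rw [Polynomial.degree_X_pow]; exact_mod_cast h1) (c l)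
      simpa using this
    · simpa [hgt l h1] using IsPolyLT.zero (V := V) k
  · rw [Finset.add_sum_erase Finset.univ (fun l : Fin (S + 1) => x ^ (l : ℕ) • c l)
      (Finset.mem_univ k)]
    exact h x

variable {S : ℕ}

/-- The Fuchsian operator with its denominators cleared:
`y ↦ Q y' + ∑ j, (∏ i ≠ j, (x - p i)) L_j y`. It is `Q` times `y' + ∑ j, (x - p j)⁻¹ L_j y`, and
has polynomial coefficients. -/
noncomputable def fuchsOp (p : Fin (S + 2) → ℂ) (L : Fin (S + 2) → V →L[ℂ] V) (y : ℂ → V) (x : ℂ) :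
    V :=
  Q p x • deriv y x + ∑ j, (∏ i ∈ Finset.univ.erase j, (x - p i)) • L j (y x)

theorem Q_ne_zero {N : ℕ} {p : Fin N → ℂ} {x : ℂ} (hx : x ∉ range p) : Q p x ≠ 0 :=
  Finset.prod_ne_zero_iff.2 fun j _ => sub_ne_zero.2 fun h => hx ⟨j, h.symm⟩

theorem inv_Q_smul_fuchsOp (p : Fin (S + 2) → ℂ) (L : Fin (S + 2) → V →L[ℂ] V) (y : ℂ → V)
    {x : ℂ} (hx : x ∉ range p) :
    (Q p x)⁻¹ • fuchsOp p L y x = deriv y x + ∑ j, (x - p j)⁻¹ • L j (y x) := by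
  rw [fuchsOp, smul_add, inv_smul_smul₀ (Q_ne_zero hx), Finset.smul_sum]
  congr 1
  refine Finset.sum_congr rfl fun j _ => ?_
  have h1 : (x - p j) ≠ 0 := sub_ne_zero.2 fun h => hx ⟨j, h.symm⟩
  have h2 : Q p x = (x - p j) * ∏ i ∈ Finset.univ.erase j, (x - p i) :=
    (Finset.mul_prod_erase Finset.univ (fun i => x - p i) (Finset.mem_univ j)).symm
  have h3 : ∏ i ∈ Finset.univ.erase j, (x - p i) ≠ 0 := fun h => Q_ne_zero hx (by rw [h2, h, mul_zero])
  rw [smul_smul, h2]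
  congr 1
  field_simp

theorem fuchsOp_add (p : Fin (S + 2) → ℂ) (L : Fin (S + 2) → V →L[ℂ] V) {y z : ℂ → V} {x : ℂ}
    (hy : DifferentiableAt ℂ y x) (hz : DifferentiableAt ℂ z x) :
    fuchsOp p L (fun x => y x + z x) x = fuchsOp p L y x + fuchsOp p L z x := by
  have : deriv (fun x => y x + z x) x = deriv y x + deriv z x := deriv_add hy hz
  simp only [fuchsOp, this, map_add, smul_add, Finset.sum_add_distrib]
  abel

theorem fuchsOp_sum (p : Fin (S + 2) → ℂ) (L : Fin (S + 2) → V →L[ℂ] V) {ι : Type*}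
    (s : Finset ι) {y : ι → ℂ → V} {x : ℂ} (hy : ∀ i ∈ s, DifferentiableAt ℂ (y i) x) :
    fuchsOp p L (fun x => ∑ i ∈ s, y i x) x = ∑ i ∈ s, fuchsOp p L (y i) x := by
  classical
  induction s using Finset.induction_on with
  | empty => simp [fuchsOp]
  | insert i s hi ih =>
    have hs : ∀ j ∈ s, DifferentiableAt ℂ (y j) x := fun j hj =>
      hy j (Finset.mem_insert_of_mem hj)
    simp only [Finset.sum_insert hi]
    rw [fuchsOp_add p L (hy i (Finset.mem_insert_self i s)) (DifferentiableAt.fun_sum hs), ih hs]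

theorem fuchsOp_smul (p : Fin (S + 2) → ℂ) (L : Fin (S + 2) → V →L[ℂ] V) (y : ℂ → V) (a x : ℂ) :
    fuchsOp p L (fun x => a • y x) x = a • fuchsOp p L y x := by
  have : deriv (fun x => a • y x) x = a • deriv y x := deriv_fun_const_smul_field a y
  simp only [fuchsOp, this, map_smul, smul_add, Finset.smul_sum]
  congr 1
  · exact smul_comm _ _ _
  · exact Finset.sum_congr rfl fun j _ => smul_comm _ _ _

theorem fuchsOp_congr (p : Fin (S + 2) → ℂ) (L : Fin (S + 2) → V →L[ℂ] V) {y z : ℂ → V} {x : ℂ}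
    (h : y =ᶠ[𝓝 x] z) : fuchsOp p L y x = fuchsOp p L z x := by
  rw [fuchsOp, fuchsOp, h.deriv_eq, h.self_of_nhds]

theorem differentiableOn_fuchsOp [CompleteSpace V] (p : Fin (S + 2) → ℂ)
    (L : Fin (S + 2) → V →L[ℂ] V) {y : ℂ → V} {D : Set ℂ} (hD : IsOpen D)
    (hy : DifferentiableOn ℂ y D) : DifferentiableOn ℂ (Fuchs.fuchsOp p L y) D := by
  have h1 : DifferentiableOn ℂ (deriv y) D := hy.deriv hD
  have h2 : Differentiable ℂ (Q p) := by
    unfold Q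
    fun_prop
  refine (h2.differentiableOn.smul h1).add (DifferentiableOn.fun_sum fun j _ => ?_)
  have h3 : Differentiable ℂ fun x => ∏ i ∈ Finset.univ.erase j, (x - p i) := by fun_prop
  exact h3.differentiableOn.smul ((L j).differentiable.comp_differentiableOn hy)

/-- On a monomial `x ^ k v`, the top coefficient of the Fuchsian operator is `(k + ∑ L_j) v`. -/
theorem isPolyLT_fuchsOp_pow (p : Fin (S + 2) → ℂ) (L : Fin (S + 2) → V →L[ℂ] V) (k : ℕ) (v : V) :
    IsPolyLT (k + S + 1) fun x => fuchsOp p L (fun x => x ^ k • v) x -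
      x ^ (k + S + 1) • ((k : ℂ) • v + ∑ j, L j v) := by
  let q : ℂ[X] := ∏ j, (Polynomial.X - Polynomial.C (p j))
  let r : Fin (S + 2) → ℂ[X] := fun j =>
    ∏ i ∈ Finset.univ.erase j, (Polynomial.X - Polynomial.C (p i))
  have hq : q.Monic := Polynomial.monic_prod_of_monic _ _ fun j _ => Polynomial.monic_X_sub_C _
  have hqd : q.natDegree = S + 2 := by
    simp [q]
  have hr : ∀ j, (r j).Monic := fun j =>
    Polynomial.monic_prod_of_monic _ _ fun j _ => Polynomial.monic_X_sub_C _
  have hrd : ∀ j, (r j).natDegree = S + 1 := fun j => by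
    simp only [r]
    rw [Polynomial.natDegree_prod_of_monic _ _ fun i _ => Polynomial.monic_X_sub_C _]
    simp [Finset.card_erase_of_mem]
  have lt : ∀ P : ℂ[X], P.Monic → P.natDegree = k + S + 1 →
      (P - Polynomial.X ^ (k + S + 1)).degree < ((k + S + 1 : ℕ) : WithBot ℕ) := by
    intro P hP hPd
    have hd : P.degree = (k + S + 1 : ℕ) := by
      rw [Polynomial.degree_eq_natDegree hP.ne_zero, hPd]
    have := Polynomial.degree_sub_lt_left (p := P) (q := Polynomial.X ^ (k + S + 1))
      (by rw [hd, Polynomial.degree_X_pow]) hP.ne_zero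
      (by rw [hP.leadingCoeff, Polynomial.leadingCoeff_X_pow])
    rwa [hd] at this
  have h1 : IsPolyLT (k + S + 1) fun x =>
      (Q p x * x ^ (k - 1) - x ^ (k + S + 1)) • ((k : ℂ) • v) := by
    rcases Nat.eq_zero_or_pos k with rfl | hk
    · simpa using IsPolyLT.zero (V := V) (0 + S + 1)
    have := isPolyLT_eval_smul (lt (q * Polynomial.X ^ (k - 1)) (hq.mul (Polynomial.monic_X_pow _))
      (by
        rw [hq.natDegree_mul (Polynomial.monic_X_pow _), hqd, Polynomial.natDegree_X_pow]
        lia)) ((k : ℂ) • v)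
    simpa [q, Polynomial.eval_prod, Q] using this
  have h2 : ∀ j, IsPolyLT (k + S + 1) fun x =>
      ((∏ i ∈ Finset.univ.erase j, (x - p i)) * x ^ k - x ^ (k + S + 1)) • L j v := by
    intro j
    have := isPolyLT_eval_smul (lt (r j * Polynomial.X ^ k) ((hr j).mul (Polynomial.monic_X_pow _))
      (by
        rw [(hr j).natDegree_mul (Polynomial.monic_X_pow _), hrd, Polynomial.natDegree_X_pow]
        lia)) (L j v)
    simpa [r, Polynomial.eval_prod] using this
  have h3 := h1.add (IsPolyLT.sum Finset.univ fun j _ => h2 j)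
  refine h3.congr fun x => ?_
  have hder : deriv (fun x : ℂ => x ^ k • v) x = ((k : ℂ) * x ^ (k - 1)) • v :=
    ((hasDerivAt_pow k x).smul_const v).deriv
  simp only [fuchsOp, hder, map_smul, smul_add, Finset.smul_sum, sub_smul, smul_smul,
    Finset.sum_sub_distrib]
  rw [mul_comm (k : ℂ) (x ^ (k - 1)), ← mul_assoc, sub_mul, sub_smul]
  abel

/-- A polynomial solution of `fuchsOp p L y = φ` with `φ` of degree at most `S` vanishes, as its
leading coefficient `v` satisfies `(k + ∑ L_j) v = 0`. -/
theorem IsPolyLT.eq_zero_of_fuchsOp (p : Fin (S + 2) → ℂ) (L : Fin (S + 2) → V →L[ℂ] V)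
    (hL : ∀ (k : ℕ) (v : V), (k : ℂ) • v + ∑ j, L j v = 0 → v = 0) {n : ℕ} {y φ : ℂ → V}
    (hy : IsPolyLT n y) (hφ : IsPolyLT (S + 1) φ) (h : ∀ x, fuchsOp p L y x + φ x = 0) :
    y = 0 := by
  induction n with
  | zero =>
    obtain ⟨c, hc⟩ := hy
    exact funext fun x => by simp [hc]
  | succ k ih =>
    refine ih ?_
    obtain ⟨c, hc⟩ := hy
    let z : ℂ → V := fun x => ∑ l ∈ Finset.range k, x ^ l • c l
    have hz : IsPolyLT k z := ⟨c, fun x => rfl⟩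
    have hyz : y = fun x => x ^ k • c k + z x :=
      funext fun x => by rw [hc, Finset.sum_range_succ, add_comm]
    have hTz : IsPolyLT (k + S + 1) (fuchsOp p L z) := by
      refine IsPolyLT.congr ?_ fun x => (fuchsOp_sum p L _ fun l _ => ?_).symm
      swap
      · fun_prop
      refine IsPolyLT.sum _ fun l hl => ?_
      have hlk := Finset.mem_range.1 hl
      have h1 := (isPolyLT_fuchsOp_pow p L l (c l)).mono (by lia : l + S + 1 ≤ k + S + 1)
      have h2 := isPolyLT_eval_smul (V := V) (q := Polynomial.X ^ (l + S + 1)) (n := k + S + 1)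
        (by rw [Polynomial.degree_X_pow]; exact_mod_cast (by lia)) ((l : ℂ) • c l + ∑ j, L j (c l))
      simpa using h1.add h2
    have h0 : c k = 0 := by
      refine hL k _ (IsPolyLT.eq_zero_of_pow_smul_add (n := k + S + 1)
        (((isPolyLT_fuchsOp_pow p L k (c k)).add hTz).add (hφ.mono (by lia))) fun x => ?_)
      have := h x
      rw [hyz, fuchsOp_add p L (by fun_prop) (hz.differentiable x)] at this
      rw [← this]
      abel
    refine ⟨c, fun x => ?_⟩
    simp only [hyz, h0, smul_zero, zero_add, z]

/-- Every polynomial is `fuchsOp p L y + φ` with `y` a polynomial and `φ` of degree at most `S`: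
division with remainder, as the leading coefficients `k + ∑ L_j` are invertible. -/
theorem IsPolyLT.exists_fuchsOp_add [FiniteDimensional ℂ V] (p : Fin (S + 2) → ℂ)
    (L : Fin (S + 2) → V →L[ℂ] V)
    (hL : ∀ (k : ℕ) (v : V), (k : ℂ) • v + ∑ j, L j v = 0 → v = 0) {n : ℕ} {g : ℂ → V}
    (hg : IsPolyLT n g) : ∃ (y : ℂ → V) (c : Fin (S + 1) → V), Differentiable ℂ y ∧
      ∀ x, fuchsOp p L y x + polyMap c x = g x := by
  induction n generalizing g with
  | zero =>
    obtain ⟨c, rfl⟩ := (hg.mono (Nat.zero_le (S + 1))).exists_polyMap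
    exact ⟨0, c, differentiable_const 0, fun x => by simp [fuchsOp]⟩
  | succ m ih =>
    rcases lt_or_ge m (S + 1) with hm | hm
    · obtain ⟨c, rfl⟩ := (hg.mono (show m + 1 ≤ S + 1 from hm)).exists_polyMap
      exact ⟨0, c, differentiable_const 0, fun x => by simp [fuchsOp]⟩
    obtain ⟨k, rfl⟩ := Nat.exists_eq_add_of_le' hm
    obtain ⟨c, hc⟩ := hg
    let M : V →ₗ[ℂ] V := (k : ℂ) • LinearMap.id + ∑ j, (L j : V →ₗ[ℂ] V)
    have hM : Function.Injective M := by
      refine (injective_iff_map_eq_zero M).2 fun v hv => hL k v ?_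
      simpa [M] using hv
    -- The vector `v` for which `x ^ k v` is mapped to a polynomial with the top term of `g`.
    obtain ⟨v, hv⟩ := LinearMap.surjective_of_injective hM (c (k + (S + 1)))
    have hv' : (k : ℂ) • v + ∑ j, L j v = c (k + (S + 1)) := by simpa [M] using hv
    have h1 : IsPolyLT (k + (S + 1)) fun x => g x - fuchsOp p L (fun x => x ^ k • v) x := by
      have h2 := (isPolyLT_fuchsOp_pow p L k v).neg
      have h3 : IsPolyLT (k + (S + 1)) fun x => ∑ l ∈ Finset.range (k + (S + 1)), x ^ l • c l :=
        ⟨c, fun x => rfl⟩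
      refine (h3.add h2).congr fun x => ?_
      rw [hc, Finset.sum_range_succ, hv', add_assoc k S 1]
      abel
    obtain ⟨y, e, hy, hye⟩ := ih h1
    refine ⟨fun x => y x + x ^ k • v, e, by fun_prop, fun x => ?_⟩
    rw [fuchsOp_add p L (hy x) (by fun_prop), add_right_comm, hye]
    abel

end

/-! ### Linear systems on discs -/

section

variable {V : Type*} [NormedAddCommGroup V] [NormedSpace ℂ V]

/-- Grönwall's inequality along segments of length at most one in a convex set. -/
theorem norm_le_of_norm_deriv_le {U : Set ℂ} (hU : Convex ℝ U) {u u' : ℂ → V}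
    (hu : ∀ x ∈ U, HasDerivAt u (u' x) x) {M ε : ℝ} (hM : 0 < M) (hε : 0 ≤ ε)
    (hb : ∀ x ∈ U, ‖u' x‖ ≤ M * ‖u x‖ + ε) {a b : ℂ} (ha : a ∈ U) (hbU : b ∈ U)
    (hab : ‖b - a‖ ≤ 1) :
    ‖u b‖ ≤ Real.exp M * ‖u a‖ + Real.exp M / M * ε := by
  let : NormedSpace ℝ V := NormedSpace.restrictScalars ℝ ℂ V
  let γ : ℝ → ℂ := fun t => a + t * (b - a)
  have hγ : ∀ t, HasDerivAt γ (b - a) t := fun t => by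
    have := ((Complex.ofRealCLM.hasDerivAt (x := t)).mul_const (b - a)).const_add a
    rwa [Complex.ofRealCLM_apply, Complex.ofReal_one, one_mul] at this
  have hγU : ∀ t ∈ Icc (0 : ℝ) 1, γ t ∈ U := by
    intro t ht
    have := hU.add_smul_sub_mem ha hbU ht
    simpa [γ] using this
  have hd : ∀ t ∈ Icc (0 : ℝ) 1, HasDerivAt (u ∘ γ) ((b - a) • u' (γ t)) t := fun t ht =>
    (hu _ (hγU t ht)).scomp t (hγ t)
  have := norm_le_gronwallBound_of_norm_deriv_right_le (f := u ∘ γ) (δ := ‖u a‖) (K := M) (ε := ε)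
    (a := 0) (b := 1) (fun t ht => (hd t ht).continuousAt.continuousWithinAt)
    (fun t ht => (hd t (Ico_subset_Icc_self ht)).hasDerivWithinAt) (by simp [γ]) (fun t ht => ?_)
    1 (by simp)
  · rw [gronwallBound_of_K_ne_0 hM.ne'] at this
    have e : (u ∘ γ) 1 = u b := by simp [γ]
    simp only [e, sub_zero, mul_one] at this
    refine this.trans ?_
    have h1 : ε / M * (Real.exp M - 1) ≤ Real.exp M / M * ε := by
      rw [div_mul_eq_mul_div, div_mul_eq_mul_div]
      exact div_le_div_of_nonneg_right (by linarith) hM.le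
    linarith [mul_comm ‖u a‖ (Real.exp M)]
  · rw [norm_smul]
    have h1 := hb _ (hγU t (Ico_subset_Icc_self ht))
    calc ‖b - a‖ * ‖u' (γ t)‖ ≤ 1 * ‖u' (γ t)‖ := by gcongr
      _ ≤ _ := by simpa using h1

/-- Uniqueness for a holomorphic linear system on a ball. -/
theorem eqOn_ball_of_linear {c : ℂ} {r : ℝ} (hr : r ≤ 1 / 2) {B : ℂ → V →L[ℂ] V} {g y z : ℂ → V}
    {M : ℝ} (hB : ∀ x ∈ ball c r, ‖B x‖ ≤ M)
    (hy : ∀ x ∈ ball c r, HasDerivAt y (B x (y x) + g x) x)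
    (hz : ∀ x ∈ ball c r, HasDerivAt z (B x (z x) + g x) x) {a : ℂ} (ha : a ∈ ball c r)
    (hyz : y a = z a) : EqOn y z (ball c r) := by
  intro b hb
  have hM : 0 ≤ M := (norm_nonneg _).trans (hB a ha)
  have := norm_le_of_norm_deriv_le (convex_ball c r) (u := fun x => y x - z x)
    (fun x hx => (hy x hx).sub (hz x hx)) (M := M + 1) (ε := 0) (by linarith) le_rfl
    (fun x hx => ?_) ha hb ?_
  · simp only [hyz, sub_self, norm_zero, mul_zero, add_zero] at this
    exact sub_eq_zero.1 (norm_le_zero_iff.1 this)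
  · rw [add_sub_add_right_eq_sub, ← map_sub, add_zero]
    refine ((B x).le_opNorm _).trans ?_
    have := hB x hx
    gcongr
    linarith
  · have h1 := mem_ball.1 ha
    have h2 := mem_ball.1 hb
    rw [← dist_eq_norm]
    have := dist_triangle_right b a c
    linarith

/-- Existence for a holomorphic linear system on a small ball, by Picard iteration. -/
theorem exists_solution_ball [CompleteSpace V] {c : ℂ} {r : ℝ} {B : ℂ → V →L[ℂ] V} {g : ℂ → V}
    {M G : ℝ} (hBd : DifferentiableOn ℂ B (ball c r)) (hgd : DifferentiableOn ℂ g (ball c r))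
    (hB : ∀ x ∈ ball c r, ‖B x‖ ≤ M) (hg : ∀ x ∈ ball c r, ‖g x‖ ≤ G) (hrM : 2 * r * M ≤ 1 / 2)
    {a : ℂ} (ha : a ∈ ball c r) (v : V) :
    ∃ s : ℂ → V, s a = v ∧ ∀ x ∈ ball c r, HasDerivAt s (B x (s x) + g x) x := by
  have hr : 0 < r := dist_nonneg.trans_lt (mem_ball.1 ha)
  have hM : 0 ≤ M := (norm_nonneg _).trans (hB a ha)
  have hG : 0 ≤ G := (norm_nonneg _).trans (hg a ha)
  have hdist : ∀ x ∈ ball c r, ‖x - a‖ ≤ 2 * r := fun x hx => by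
    have h1 := mem_ball.1 ha
    have h2 := mem_ball.1 hx
    rw [← dist_eq_norm]
    have := dist_triangle_right x a c
    linarith
  -- One step of the iteration solves `z' = B y + g` with `z a = v`.
  let Y := {y : ℂ → V // DifferentiableOn ℂ y (ball c r) ∧ y a = v}
  have step : ∀ y : Y, ∃ z : Y, ∀ x ∈ ball c r, HasDerivAt z.1 (B x (y.1 x) + g x) x := by
    intro y
    have h1 : DifferentiableOn ℂ (fun x => B x (y.1 x) + g x) (ball c r) :=
      (hBd.clm_apply y.2.1).add hgd
    obtain ⟨z, hza, hz⟩ := h1.isExactOn_ball.with_val_at a v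
    exact ⟨⟨z, fun x hx => (hz x hx).differentiableAt.differentiableWithinAt, hza⟩, hz⟩
  choose next hnext using step
  let y : ℕ → Y := fun n => next^[n] ⟨fun _ => v, differentiableOn_const v, rfl⟩
  have hy : ∀ n, ∀ x ∈ ball c r, HasDerivAt (y (n + 1)).1 (B x ((y n).1 x) + g x) x := by
    intro n x hx
    simp only [y, Function.iterate_succ_apply']
    exact hnext _ x hx
  let C : ℝ := 2 * ((M * ‖v‖ + G) * (2 * r))
  have hC : ∀ n, ∀ x ∈ ball c r, ‖(y (n + 1)).1 x - (y n).1 x‖ ≤ C / 2 / 2 ^ n := by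
    intro n
    induction n with
    | zero =>
      intro x hx
      have hd : ∀ x ∈ ball c r, HasDerivWithinAt (fun x => (y 1).1 x - v) (B x v + g x)
          (ball c r) x := fun x hx => ((hy 0 x hx).sub_const v).hasDerivWithinAt
      have := (convex_ball c r).norm_image_sub_le_of_norm_hasDerivWithin_le hd
        (C := M * ‖v‖ + G) (fun x hx => ?_) ha hx
      · have e : (y 1).1 a = v := (y 1).2.2
        simp only [e, sub_self, sub_zero] at this
        simp only [zero_add, pow_zero, div_one]
        have h2 : (y 0).1 x = v := rfl
        rw [h2]
        refine this.trans ?_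
        have h3 : C / 2 = (M * ‖v‖ + G) * (2 * r) := by simp only [C]; ring
        rw [h3]
        gcongr
        exact hdist x hx
      · refine (norm_add_le _ _).trans (add_le_add ?_ (hg x hx))
        exact (B x).le_of_opNorm_le (hB x hx) v
    | succ n ih =>
      intro x hx
      have hd : ∀ x ∈ ball c r, HasDerivWithinAt (fun x => (y (n + 1 + 1)).1 x - (y (n + 1)).1 x)
          (B x ((y (n + 1)).1 x) + g x - (B x ((y n).1 x) + g x)) (ball c r) x := fun x hx =>
        ((hy (n + 1) x hx).sub (hy n x hx)).hasDerivWithinAt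
      have := (convex_ball c r).norm_image_sub_le_of_norm_hasDerivWithin_le hd
        (C := M * (C / 2 / 2 ^ n)) (fun x hx => ?_) ha hx
      · have e : ∀ n, (y n).1 a = v := fun n => (y n).2.2
        simp only [e, sub_self, sub_zero] at this
        refine this.trans ?_
        have h1 : 0 ≤ C / 2 / 2 ^ n := (norm_nonneg _).trans (ih a ha)
        calc M * (C / 2 / 2 ^ n) * ‖x - a‖ ≤ M * (C / 2 / 2 ^ n) * (2 * r) := by
              gcongr
              exact hdist x hx
          _ = (2 * r * M) * (C / 2 / 2 ^ n) := by ring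
          _ ≤ 1 / 2 * (C / 2 / 2 ^ n) := by gcongr
          _ = C / 2 / 2 ^ (n + 1) := by rw [pow_succ]; field_simp
      · rw [add_sub_add_right_eq_sub, ← map_sub]
        exact (B x).le_of_opNorm_le_of_le (hB x hx) (ih x hx)
  have hlim : ∀ x, ∃ s : V, x ∈ ball c r → Tendsto (fun n => (y n).1 x) atTop (𝓝 s) := by
    intro x
    by_cases hx : x ∈ ball c r
    · obtain ⟨s, hs⟩ := cauchySeq_tendsto_of_complete (cauchySeq_of_le_geometric_two
        (f := fun n => (y n).1 x) (C := C) fun n => by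
          rw [dist_comm, dist_eq_norm]
          exact hC n x hx)
      exact ⟨s, fun _ => hs⟩
    · exact ⟨0, fun h => absurd h hx⟩
  choose s hs using hlim
  have hunif : TendstoUniformlyOn (fun n => (y n).1) s atTop (ball c r) := by
    rw [Metric.tendstoUniformlyOn_iff]
    intro ε hε
    have h1 : Tendsto (fun n : ℕ => C / 2 ^ n) atTop (𝓝 0) := by
      simpa [div_eq_mul_inv] using
        (tendsto_pow_atTop_nhds_zero_of_lt_one (r := (2 : ℝ)⁻¹) (by norm_num)
          (by norm_num)).const_mul C
    filter_upwards [h1.eventually_lt_const hε] with n hn x hx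
    refine lt_of_le_of_lt ?_ hn
    rw [dist_comm]
    refine dist_le_of_le_geometric_two_of_tendsto (f := fun n => (y n).1 x) (C := C) (fun n => ?_)
      (hs x hx) n
    rw [dist_comm, dist_eq_norm]
    exact hC n x hx
  have hloc := hunif.tendstoLocallyUniformlyOn
  have hsd : DifferentiableOn ℂ s (ball c r) :=
    hloc.differentiableOn (Eventually.of_forall fun n => (y n).2.1) isOpen_ball
  refine ⟨s, ?_, fun x hx => ?_⟩
  · refine tendsto_nhds_unique (hs a ha) ?_
    simp only [(y _).2.2]
    exact tendsto_const_nhds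
  · have h1 : Tendsto (fun n => deriv (y (n + 1)).1 x) atTop (𝓝 (deriv s x)) :=
      ((hloc.deriv (Eventually.of_forall fun n => (y n).2.1) isOpen_ball).tendsto_at hx).comp
        (tendsto_add_atTop_nat 1)
    have h2 : Tendsto (fun n => deriv (y (n + 1)).1 x) atTop (𝓝 (B x (s x) + g x)) := by
      simp only [(hy _ x hx).deriv]
      exact (((B x).continuous.tendsto _).comp (hs x hx)).add_const _
    rw [← tendsto_nhds_unique h1 h2]
    exact (hsd.differentiableAt (isOpen_ball.mem_nhds hx)).hasDerivAt

/-- Continuation across a thickening of a convex set in the coordinate `Φ`: local continuations at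
all its points glue, as two balls that meet have centres whose midpoint lies in both. -/
theorem exists_extend_thickening [CompleteSpace V] (Φ : ℂ ≃ₜ ℂ) {B : Set ℂ} (hB : Convex ℝ B)
    (hBo : IsOpen B) {Y : ℂ → V} (hY : DifferentiableOn ℂ Y (Φ ⁻¹' B)) {δ : ℝ} (hδ : 0 < δ)
    (hloc : ∀ e ∈ B, ∃ s : ℂ → V, DifferentiableOn ℂ s (Φ ⁻¹' ball e δ) ∧
      s =ᶠ[𝓝 (Φ.symm e)] Y) :
    ∃ Z : ℂ → V, DifferentiableOn ℂ Z (Φ ⁻¹' thickening δ B) ∧ EqOn Z Y (Φ ⁻¹' B) := by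
  classical
  choose! s hsd hs using hloc
  have ana : ∀ {U : Set ℂ} {y : ℂ → V}, IsOpen U → DifferentiableOn ℂ y (Φ ⁻¹' U) →
      AnalyticOnNhd ℂ y (Φ ⁻¹' U) := fun hU hy =>
    hy.analyticOnNhd (hU.preimage Φ.continuous)
  have conn : ∀ {U : Set ℂ}, Convex ℝ U → IsPreconnected (Φ ⁻¹' U) := fun hU =>
    Φ.isPreconnected_preimage.2 hU.isPreconnected
  have hsY : ∀ e ∈ B, EqOn (s e) Y (Φ ⁻¹' (ball e δ ∩ B)) := by
    intro e he
    refine AnalyticOnNhd.eqOn_of_preconnected_of_eventuallyEq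
      ((ana isOpen_ball (hsd e he)).mono (preimage_mono inter_subset_left))
      ((ana hBo hY).mono (preimage_mono inter_subset_right)) (conn ((convex_ball e δ).inter hB))
      (z₀ := Φ.symm e) ?_ (hs e he)
    simp [he, hδ]
  have hss : ∀ e ∈ B, ∀ e' ∈ B, EqOn (s e) (s e') (Φ ⁻¹' (ball e δ ∩ ball e' δ)) := by
    intro e he e' he' x hx
    have hee : dist e e' < 2 * δ := by
      have h1 := mem_ball'.1 hx.1
      have h2 := mem_ball.1 hx.2
      have := dist_triangle e (Φ x) e'
      linarith
    let m := midpoint ℝ e e'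
    have hmB : m ∈ B := hB.midpoint_mem he he'
    have hme : m ∈ ball e δ := by
      rw [mem_ball, dist_midpoint_left]
      simp
      linarith
    have hme' : m ∈ ball e' δ := by
      rw [mem_ball, dist_midpoint_right]
      simp
      linarith
    refine AnalyticOnNhd.eqOn_of_preconnected_of_eventuallyEq
      ((ana isOpen_ball (hsd e he)).mono (preimage_mono inter_subset_left))
      ((ana isOpen_ball (hsd e' he')).mono (preimage_mono inter_subset_right))
      (conn ((convex_ball e δ).inter (convex_ball e' δ))) (z₀ := Φ.symm m) ?_ ?_ hx
    · simp [hme, hme']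
    · have h1 : Φ ⁻¹' (ball e δ ∩ ball e' δ ∩ B) ∈ 𝓝 (Φ.symm m) :=
        (((isOpen_ball.inter isOpen_ball).inter hBo).preimage Φ.continuous).mem_nhds
          (by simp [hme, hme', hmB])
      filter_upwards [h1] with w hw
      rw [hsY e he ⟨hw.1.1, hw.2⟩, hsY e' he' ⟨hw.1.2, hw.2⟩]
  let Z : ℂ → V := fun x =>
    if h : ∃ e ∈ B, Φ x ∈ ball e δ then s h.choose x else 0
  have hZ : ∀ e ∈ B, EqOn Z (s e) (Φ ⁻¹' ball e δ) := by
    intro e he x hx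
    have h : ∃ e ∈ B, Φ x ∈ ball e δ := ⟨e, he, hx⟩
    simp only [Z, dif_pos h]
    exact hss _ h.choose_spec.1 e he ⟨h.choose_spec.2, hx⟩
  refine ⟨Z, fun x hx => ?_, fun x hx => ?_⟩
  · obtain ⟨e, he, hxe⟩ := mem_thickening_iff.1 hx
    have hn : Φ ⁻¹' ball e δ ∈ 𝓝 x := (isOpen_ball.preimage Φ.continuous).mem_nhds hxe
    exact (((hsd e he).differentiableAt hn).congr_of_eventuallyEq
      (eventually_of_mem hn (hZ e he))).differentiableWithinAt
  · have hxx : Φ x ∈ ball (Φ x) δ := mem_ball_self hδ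
    rw [hZ (Φ x) hx hxx]
    exact hsY (Φ x) hx ⟨hxx, hx⟩

end

/-! ### Entire continuation and polynomial growth -/

section

variable {V : Type*} [NormedAddCommGroup V] [NormedSpace ℂ V]

/-- Continuation to the whole plane of a function holomorphic on the `Φ`-preimage of a disc, when
every continuation to the `Φ`-preimage of a larger concentric disc can be continued further across
a thickening of uniform width. -/
theorem exists_entire_extension [CompleteSpace V] (Φ : ℂ ≃ₜ ℂ) (c : ℂ) {r : ℝ} (hr : 0 < r)
    {y : ℂ → V} (hy : DifferentiableOn ℂ y (Φ ⁻¹' ball c r))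
    (hloc : ∀ R, ∃ δ > 0, ∀ ρ, r ≤ ρ → ρ ≤ R → ∀ Y : ℂ → V,
      DifferentiableOn ℂ Y (Φ ⁻¹' ball c ρ) → EqOn Y y (Φ ⁻¹' ball c r) →
      ∀ e ∈ ball c ρ, ∃ s : ℂ → V, DifferentiableOn ℂ s (Φ ⁻¹' ball e δ) ∧
        s =ᶠ[𝓝 (Φ.symm e)] Y) :
    ∃ Y : ℂ → V, Differentiable ℂ Y ∧ EqOn Y y (Φ ⁻¹' ball c r) := by
  -- Continuation to discs of radius `r + n`, in finitely many steps of width `δ`.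
  have large : ∀ n : ℕ, ∃ Y : ℂ → V, DifferentiableOn ℂ Y (Φ ⁻¹' ball c (r + n)) ∧
      EqOn Y y (Φ ⁻¹' ball c r) := by
    intro n
    obtain ⟨δ, hδ, h⟩ := hloc (r + n)
    have steps : ∀ k : ℕ, r + k * δ ≤ r + n + δ → ∃ Y : ℂ → V,
        DifferentiableOn ℂ Y (Φ ⁻¹' ball c (r + k * δ)) ∧ EqOn Y y (Φ ⁻¹' ball c r) := by
      intro k
      induction k with
      | zero => exact fun _ => ⟨y, by simpa using hy, fun _ _ => rfl⟩
      | succ k ih =>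
        intro hk
        push_cast at hk
        obtain ⟨Y, hY, hYy⟩ := ih (by linarith)
        have hkδ : r ≤ r + k * δ := by
          have : 0 ≤ k * δ := by positivity
          linarith
        obtain ⟨Z, hZ, hZY⟩ := exists_extend_thickening Φ (convex_ball c (r + k * δ)) isOpen_ball
          hY hδ (h (r + k * δ) hkδ (by linarith) Y hY hYy)
        refine ⟨Z, hZ.mono (preimage_mono ?_), fun x hx => ?_⟩
        · rw [_root_.thickening_ball hδ (by linarith)]
          refine ball_subset_ball ?_
          push_cast
          linarith
        · rw [hZY (ball_subset_ball hkδ hx), hYy hx]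
    have hceil := Nat.ceil_lt_add_one (div_nonneg (Nat.cast_nonneg n) hδ.le)
    have hceil' := Nat.le_ceil ((n : ℝ) / δ)
    rw [div_le_iff₀ hδ] at hceil'
    obtain ⟨Y, hY, hYy⟩ := steps ⌈(n : ℝ) / δ⌉₊ (by
      have : (⌈(n : ℝ) / δ⌉₊ : ℝ) * δ ≤ (n / δ + 1) * δ := by gcongr
      rw [add_mul, div_mul_cancel₀ _ hδ.ne'] at this
      linarith)
    exact ⟨Y, hY.mono (preimage_mono (ball_subset_ball (by linarith))), hYy⟩
  choose Y hY hYy using large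
  have agree : ∀ m n : ℕ, m ≤ n → EqOn (Y m) (Y n) (Φ ⁻¹' ball c (r + m)) := by
    intro m n hmn
    have hmn' : (m : ℝ) ≤ n := by exact_mod_cast hmn
    have hm0 : (0 : ℝ) ≤ m := Nat.cast_nonneg m
    refine AnalyticOnNhd.eqOn_of_preconnected_of_eventuallyEq
      ((hY m).analyticOnNhd (isOpen_ball.preimage Φ.continuous))
      (((hY n).analyticOnNhd (isOpen_ball.preimage Φ.continuous)).mono
        (preimage_mono (ball_subset_ball (by linarith))))
      (Φ.isPreconnected_preimage.2 (convex_ball c (r + m)).isPreconnected) (z₀ := Φ.symm c) ?_ ?_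
    · simp only [mem_preimage, Homeomorph.apply_symm_apply]
      exact mem_ball_self (by linarith)
    · have : Φ ⁻¹' ball c r ∈ 𝓝 (Φ.symm c) :=
        (isOpen_ball.preimage Φ.continuous).mem_nhds (by simpa using hr)
      filter_upwards [this] with w hw
      rw [hYy m hw, hYy n hw]
  let N : ℂ → ℕ := fun x => ⌈dist (Φ x) c⌉₊
  have hN : ∀ x, x ∈ Φ ⁻¹' ball c (r + N x) := fun x => by
    have := Nat.le_ceil (dist (Φ x) c)
    rw [mem_preimage, mem_ball]
    linarith
  have hE : ∀ n : ℕ, EqOn (fun x => Y (N x) x) (Y n) (Φ ⁻¹' ball c (r + n)) := by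
    intro n x hx
    rcases le_total n (N x) with h | h
    · exact (agree n (N x) h hx).symm
    · exact agree (N x) n h (hN x)
  refine ⟨fun x => Y (N x) x, fun x => ?_, fun x hx => hYy _ hx⟩
  have hn := (isOpen_ball.preimage Φ.continuous).mem_nhds (hN x)
  exact ((hY (N x)).differentiableAt hn).congr_of_eventuallyEq (eventually_of_mem hn (hE (N x)))

/-- An entire function of polynomial growth is a polynomial. -/
theorem isPolyLT_of_norm_le [CompleteSpace V] {y : ℂ → V} (hy : Differentiable ℂ y) {N : ℕ}
    {C r : ℝ} (h : ∀ x, r ≤ ‖x‖ → ‖y x‖ ≤ C * ‖x‖ ^ N) : IsPolyLT (N + 1) y := by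
  have hzero : ∀ n, N < n → iteratedDeriv n y 0 = 0 := by
    intro n hn
    have h1 : Tendsto (fun R : ℝ => (n.factorial : ℝ) * C * R⁻¹) atTop (𝓝 0) := by
      simpa using tendsto_inv_atTop_zero.const_mul ((n.factorial : ℝ) * C)
    refine norm_le_zero_iff.1 (ge_of_tendsto h1 ?_)
    filter_upwards [eventually_ge_atTop r, eventually_ge_atTop 1] with R hR hR1
    have hR0 : 0 < R := by linarith
    have h2 := Complex.norm_iteratedDeriv_le_of_forall_mem_sphere_norm_le (c := 0) (f := y)
      (C := C * R ^ N) n hR0 hy.diffContOnCl (fun z hz => by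
        have hz' : ‖z‖ = R := by simpa using hz
        have := h z (by rw [hz']; exact hR)
        rwa [hz'] at this)
    have hC : 0 ≤ C * R ^ N := by
      have := h (R : ℂ) (by simpa [abs_of_pos hR0] using hR)
      rw [Complex.norm_real, Real.norm_of_nonneg hR0.le] at this
      exact (norm_nonneg _).trans this
    refine h2.trans ?_
    obtain ⟨k, rfl⟩ := Nat.exists_eq_add_of_lt hn
    have hk : 1 ≤ R ^ k := one_le_pow₀ hR1
    have e : ((N + k + 1).factorial : ℝ) * (C * R ^ N) / R ^ (N + k + 1) =
        ((N + k + 1).factorial : ℝ) * (C * R ^ N) / (R ^ N * R) / R ^ k := by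
      rw [div_div]
      congr 1
      ring
    rw [e]
    refine (div_le_self (by positivity) hk).trans (le_of_eq ?_)
    field_simp
  refine ⟨fun n => (n.factorial : ℂ)⁻¹ • iteratedDeriv n y 0, fun x => ?_⟩
  rw [← Complex.taylorSeries_eq_of_entire hy 0 x, tsum_eq_sum (s := Finset.range (N + 1))]
  · refine Finset.sum_congr rfl fun n _ => ?_
    rw [sub_zero, smul_comm]
  · intro n hn
    rw [hzero n (by simpa using hn)]
    simp

/-- Grönwall's inequality along rays: a bound `|x| |y'| ≤ M |y| + C` near infinity makes `y` grow
at most polynomially. -/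
theorem norm_le_pow_of_norm_deriv_le {y : ℂ → V} (hy : Differentiable ℂ y) {r C : ℝ} (hr : 0 < r)
    (hC : 0 ≤ C) {N : ℕ} (hN : 0 < N)
    (h : ∀ x, r ≤ ‖x‖ → ‖x‖ * ‖deriv y x‖ ≤ N * ‖y x‖ + C) :
    ∃ K, ∀ x, r ≤ ‖x‖ → ‖y x‖ ≤ K * ‖x‖ ^ N := by
  let : NormedSpace ℝ V := NormedSpace.restrictScalars ℝ ℂ V
  obtain ⟨K, hK⟩ := ((isCompact_sphere (0 : ℂ) r).image hy.continuous).isBounded.exists_norm_le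
  have hK' : ∀ w : ℂ, ‖w‖ = r → ‖y w‖ ≤ K := fun w hw =>
    hK _ (mem_image_of_mem y (by simpa using hw))
  have hN0 : (0 : ℝ) < N := by exact_mod_cast hN
  refine ⟨(K + C / N) / r ^ N, fun x hx => ?_⟩
  have hx0 : 0 < ‖x‖ := hr.trans_le hx
  let w : ℂ := ((r / ‖x‖ : ℝ) : ℂ) * x
  have hw : ‖w‖ = r := by
    rw [norm_mul, Complex.norm_real, Real.norm_of_nonneg (by positivity)]
    field_simp
  let b : ℝ := Real.log (‖x‖ / r)
  have hb : 0 ≤ b := Real.log_nonneg (by rwa [one_le_div hr])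
  have hbe : Real.exp b = ‖x‖ / r := Real.exp_log (by positivity)
  let γ : ℝ → ℂ := fun t => (Real.exp t : ℂ) * w
  have hγ : ∀ t, HasDerivAt γ (γ t) t := fun t =>
    (Real.hasDerivAt_exp t).ofReal_comp.mul_const w
  have hγn : ∀ t, ‖γ t‖ = Real.exp t * r := fun t => by
    rw [norm_mul, Complex.norm_real, Real.norm_of_nonneg (Real.exp_pos t).le, hw]
  have hd : ∀ t, HasDerivAt (y ∘ γ) (γ t • deriv y (γ t)) t := fun t =>
    (hy (γ t)).hasDerivAt.scomp t (hγ t)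
  have hγ0 : γ 0 = w := by simp [γ]
  have hγb : γ b = x := by
    simp only [γ, hbe, w]
    have h1 : (‖x‖ : ℂ) ≠ 0 := by exact_mod_cast hx0.ne'
    have h2 : (r : ℂ) ≠ 0 := by exact_mod_cast hr.ne'
    push_cast
    field_simp
  have := norm_le_gronwallBound_of_norm_deriv_right_le (f := y ∘ γ) (δ := K) (K := N) (ε := C)
    (a := 0) (b := b) (fun t ht => (hd t).continuousAt.continuousWithinAt)
    (fun t ht => (hd t).hasDerivWithinAt) (by simpa [hγ0] using hK' w hw) (fun t ht => ?_)
    b (by simp [hb])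
  · rw [gronwallBound_of_K_ne_0 hN0.ne'] at this
    simp only [Function.comp_apply, hγb, sub_zero] at this
    rw [Real.exp_nat_mul, hbe] at this
    refine this.trans ?_
    have h1 : 0 ≤ C / N := by positivity
    have h2 : (K + C / N) / r ^ N * ‖x‖ ^ N = K * (‖x‖ / r) ^ N + C / N * (‖x‖ / r) ^ N := by
      rw [div_pow]
      field_simp
    rw [h2]
    nlinarith
  · rw [norm_smul]
    refine h _ ?_
    rw [hγn]
    have := Real.one_le_exp ht.1
    nlinarith

variable {S : ℕ}

/-- An entire solution of `fuchsOp p L y + φ = 0` with `φ` of degree at most `S` grows at most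
polynomially, since infinity is a regular singular point. -/
theorem isPolyLT_of_fuchsOp [CompleteSpace V] (p : Fin (S + 2) → ℂ) (L : Fin (S + 2) → V →L[ℂ] V)
    {y : ℂ → V} (hy : Differentiable ℂ y) (c : Fin (S + 1) → V)
    (h : ∀ x, fuchsOp p L y x + polyMap c x = 0) : ∃ n, IsPolyLT n y := by
  let r : ℝ := 1 + 2 * ∑ j, ‖p j‖
  have hs0 : 0 ≤ ∑ j, ‖p j‖ := Finset.sum_nonneg fun j _ => norm_nonneg _
  have hr : 1 ≤ r := by simp only [r]; linarith
  -- Outside the disc of radius `r` the distance to every pole is at least `‖x‖ / 2`.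
  have hpr : ∀ j x, r ≤ ‖x‖ → ‖x‖ / 2 ≤ ‖x - p j‖ ∧ 0 < ‖x - p j‖ := by
    intro j x hx
    have h1 : ‖p j‖ ≤ ∑ j, ‖p j‖ :=
      Finset.single_le_sum (f := fun j => ‖p j‖) (fun j _ => norm_nonneg _) (Finset.mem_univ j)
    have h2 := norm_sub_norm_le x (p j)
    have h3 : r = 1 + 2 * ∑ j, ‖p j‖ := rfl
    constructor <;> linarith
  obtain ⟨N, hN⟩ := exists_nat_gt (2 * ∑ j, ‖L j‖)
  let C : ℝ := 2 ^ (S + 2) * ∑ l, ‖c l‖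
  have hL0 : 0 ≤ ∑ j, ‖L j‖ := Finset.sum_nonneg fun j _ => norm_nonneg _
  have hN0 : 0 < N := by
    have : (0 : ℝ) < N := by linarith
    exact_mod_cast this
  have hder : ∀ x, r ≤ ‖x‖ → ‖x‖ * ‖deriv y x‖ ≤ N * ‖y x‖ + C := by
    intro x hx
    have hx1 : 1 ≤ ‖x‖ := hr.trans hx
    have hxp : x ∉ range p := by
      rintro ⟨j, rfl⟩
      simpa using (hpr j _ hx).2
    have h1 : deriv y x = -(∑ j, (x - p j)⁻¹ • L j (y x)) - (Q p x)⁻¹ • polyMap c x := by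
      have e1 := inv_Q_smul_fuchsOp p L y hxp
      have e2 : (Q p x)⁻¹ • fuchsOp p L y x + (Q p x)⁻¹ • polyMap c x = 0 := by
        rw [← smul_add, h, smul_zero]
      rw [e1] at e2
      rw [← sub_eq_zero, ← e2]
      abel
    have h2 : ‖x‖ * ‖∑ j, (x - p j)⁻¹ • L j (y x)‖ ≤ N * ‖y x‖ := by
      have h3 : ∀ j, ‖(x - p j)⁻¹ • L j (y x)‖ ≤ 2 / ‖x‖ * (‖L j‖ * ‖y x‖) := by
        intro j
        rw [norm_smul, norm_inv]
        refine mul_le_mul ?_ ((L j).le_opNorm _) (norm_nonneg _) (by positivity)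
        have h4 := hpr j x hx
        rw [inv_eq_one_div, div_le_div_iff₀ h4.2 (by linarith)]
        linarith [h4.1]
      calc ‖x‖ * ‖∑ j, (x - p j)⁻¹ • L j (y x)‖
          ≤ ‖x‖ * ∑ j, 2 / ‖x‖ * (‖L j‖ * ‖y x‖) := by
            gcongr
            exact norm_sum_le_of_le _ fun j _ => h3 j
        _ = 2 * (∑ j, ‖L j‖) * ‖y x‖ := by
            rw [← Finset.mul_sum, ← Finset.sum_mul]
            field_simp
        _ ≤ N * ‖y x‖ := by gcongr
    have h5 : ‖x‖ * ‖(Q p x)⁻¹ • polyMap c x‖ ≤ C := by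
      have h6 : (‖x‖ / 2) ^ (S + 2) ≤ ‖Q p x‖ := by
        rw [Q, norm_prod]
        calc (‖x‖ / 2) ^ (S + 2) = ∏ _j : Fin (S + 2), ‖x‖ / 2 := by
              rw [Finset.prod_const, Finset.card_univ, Fintype.card_fin]
          _ ≤ ∏ j, ‖x - p j‖ := Finset.prod_le_prod (fun _ _ => by positivity)
            fun j _ => (hpr j x hx).1
      have h7 : ‖polyMap c x‖ ≤ ‖x‖ ^ S * ∑ l, ‖c l‖ := by
        rw [polyMap, Finset.mul_sum]
        refine norm_sum_le_of_le _ fun l _ => ?_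
        rw [norm_smul, norm_pow]
        gcongr
        exact Nat.lt_succ_iff.1 l.2
      rw [norm_smul, norm_inv]
      calc ‖x‖ * (‖Q p x‖⁻¹ * ‖polyMap c x‖)
          ≤ ‖x‖ * (((‖x‖ / 2) ^ (S + 2))⁻¹ * (‖x‖ ^ S * ∑ l, ‖c l‖)) := by gcongr
        _ = C / ‖x‖ := by
          simp only [C]
          rw [div_pow]
          field_simp
          ring
        _ ≤ C := div_le_self (by positivity) hx1
    rw [h1]
    calc ‖x‖ * ‖-(∑ j, (x - p j)⁻¹ • L j (y x)) - (Q p x)⁻¹ • polyMap c x‖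
        ≤ ‖x‖ * (‖∑ j, (x - p j)⁻¹ • L j (y x)‖ + ‖(Q p x)⁻¹ • polyMap c x‖) := by
          gcongr
          exact (norm_sub_le _ _).trans_eq (by rw [norm_neg])
      _ ≤ N * ‖y x‖ + C := by rw [mul_add]; exact add_le_add h2 h5
  obtain ⟨K, hK⟩ := norm_le_pow_of_norm_deriv_le hy (by linarith) (by positivity) hN0 hder
  exact ⟨N + 1, isPolyLT_of_norm_le hy hK⟩

end

/-! ### Uniqueness for the linear problem -/

section

variable {V : Type*} [NormedAddCommGroup V] [NormedSpace ℂ V]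

variable {S : ℕ}

/-- The coefficient of the linear system `y' = -∑ j, (x - p j)⁻¹ L j y`. -/
noncomputable def connection (p : Fin (S + 2) → ℂ) (L : Fin (S + 2) → V →L[ℂ] V) (x : ℂ) : V →L[ℂ] V :=
  -∑ j, (x - p j)⁻¹ • L j

/-- Away from the poles the equation is a linear system in normal form. -/
theorem hasDerivAt_of_fuchsOp (p : Fin (S + 2) → ℂ) (L : Fin (S + 2) → V →L[ℂ] V) {y : ℂ → V}
    {x : ℂ} {c : Fin (S + 1) → V} {b : V} (hx : x ∉ range p) (hy : DifferentiableAt ℂ y x)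
    (h : fuchsOp p L y x + polyMap c x = b) :
    HasDerivAt y (connection p L x (y x) + (Q p x)⁻¹ • (b - polyMap c x)) x := by
  have h1 := inv_Q_smul_fuchsOp p L y hx
  rw [eq_sub_of_add_eq h] at h1
  have h2 : deriv y x = connection p L x (y x) + (Q p x)⁻¹ • (b - polyMap c x) := by
    rw [h1]
    simp [connection]
  exact h2 ▸ hy.hasDerivAt

theorem differentiableAt_connection (p : Fin (S + 2) → ℂ) (L : Fin (S + 2) → V →L[ℂ] V) {x : ℂ}
    (hx : x ∉ range p) : DifferentiableAt ℂ (connection p L) x := by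
  unfold connection
  have h : ∀ j, x - p j ≠ 0 := fun j => sub_ne_zero.2 fun h => hx ⟨j, h.symm⟩
  refine DifferentiableAt.neg (DifferentiableAt.fun_sum fun j _ => ?_)
  exact ((differentiableAt_id.sub_const (p j)).inv (h j)).smul_const (L j)

theorem isOpen_compl_range (p : Fin (S + 2) → ℂ) : IsOpen (range p)ᶜ :=
  (finite_range p).isClosed.isOpen_compl

/-- Away from the poles, germs of solutions extend to balls of a radius that is uniform near a
given point. -/
theorem exists_continuation_ball [CompleteSpace V] (p : Fin (S + 2) → ℂ)
    (L : Fin (S + 2) → V →L[ℂ] V) {g : ℂ → V} (hg : DifferentiableOn ℂ g (range p)ᶜ) {x₀ : ℂ}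
    (hx₀ : x₀ ∉ range p) :
    ∃ r > 0, ∀ a ∈ ball x₀ r, ∀ Y : ℂ → V,
      (∀ᶠ x in 𝓝 a, HasDerivAt Y (connection p L x (Y x) + g x) x) →
      ∃ s : ℂ → V, DifferentiableOn ℂ s (ball x₀ r) ∧ s =ᶠ[𝓝 a] Y := by
  have hO := (isOpen_compl_range p).mem_nhds hx₀
  have h1 : ∀ᶠ x in 𝓝 x₀, ‖connection p L x‖ < ‖connection p L x₀‖ + 1 :=
    (differentiableAt_connection p L hx₀).continuousAt.norm.eventually_lt_const (by linarith)
  have h2 : ∀ᶠ x in 𝓝 x₀, ‖g x‖ < ‖g x₀‖ + 1 :=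
    (hg.differentiableAt hO).continuousAt.norm.eventually_lt_const (by linarith)
  obtain ⟨ε, hε, hball⟩ := Metric.eventually_nhds_iff_ball.1 ((h1.and h2).and hO)
  let M : ℝ := ‖connection p L x₀‖ + 1
  have hM : 1 ≤ M := by
    have := norm_nonneg (connection p L x₀)
    simp only [M]
    linarith
  let r := min ε (1 / (4 * M))
  have hr : 0 < r := lt_min hε (by positivity)
  have hrε : ball x₀ r ⊆ ball x₀ ε := ball_subset_ball (min_le_left _ _)
  have hrM : 2 * r * M ≤ 1 / 2 := by
    have : r * (4 * M) ≤ 1 := by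
      rw [← le_div_iff₀ (by positivity)]
      exact min_le_right _ _
    linarith
  refine ⟨r, hr, fun a ha Y hY => ?_⟩
  obtain ⟨s, hsa, hs⟩ := exists_solution_ball (c := x₀) (r := r) (B := connection p L) (g := g)
    (M := M) (G := ‖g x₀‖ + 1)
    (fun x hx => (differentiableAt_connection p L (hball x (hrε hx)).2).differentiableWithinAt)
    (hg.mono fun x hx => (hball x (hrε hx)).2) (fun x hx => (hball x (hrε hx)).1.1.le)
    (fun x hx => (hball x (hrε hx)).1.2.le) hrM ha (Y a)
  refine ⟨s, fun x hx => (hs x hx).differentiableAt.differentiableWithinAt, ?_⟩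
  obtain ⟨η, hη, hYη⟩ := Metric.eventually_nhds_iff_ball.1
    (hY.and (isOpen_ball.mem_nhds ha : ∀ᶠ x in 𝓝 a, x ∈ ball x₀ r))
  have hη' : ball a (min η (1 / 2)) ⊆ ball a η := ball_subset_ball (min_le_left _ _)
  have hpos : 0 < min η (1 / 2) := lt_min hη (by norm_num)
  refine eventually_of_mem (ball_mem_nhds a hpos) (eqOn_ball_of_linear (min_le_right _ _)
    (B := connection p L) (g := g) (M := M) (fun x hx => (hball x (hrε (hYη x (hη' hx)).2)).1.1.le)
    (fun x hx => hs x (hYη x (hη' hx)).2) (fun x hx => (hYη x (hη' hx)).1) (mem_ball_self hpos) hsa)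

/-- A solution on a domain containing all poles, with a polynomial right-hand side, extends to an
entire solution: once the poles are gathered in a disc by a homeomorphism supported in the domain,
the solution, single-valued on this disc, continues to larger and larger concentric discs without
meeting a pole. -/
theorem exists_entire_solution [CompleteSpace V] {p : Fin (S + 2) → ℂ}
    (hp : Function.Injective p) (L : Fin (S + 2) → V →L[ℂ] V) {D : Set ℂ} (hD : IsPreconnected D)
    (hDo : IsOpen D) (hpD : ∀ j, p j ∈ D) {y : ℂ → V} (hy : DifferentiableOn ℂ y D)
    {c : Fin (S + 1) → V} (h : ∀ x ∈ D, fuchsOp p L y x + polyMap c x = 0) :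
    ∃ Y : ℂ → V, Differentiable ℂ Y ∧ (∀ x, fuchsOp p L Y x + polyMap c x = 0) ∧ EqOn Y y D := by
  have hpoly : Differentiable ℂ (polyMap c) := (isPolyLT_polyMap c).differentiable
  -- The equation propagates by the identity theorem.
  have propagate : ∀ {U : Set ℂ} {Y : ℂ → V} {z : ℂ}, IsPreconnected U → IsOpen U →
      DifferentiableOn ℂ Y U → z ∈ U → z ∈ D → Y =ᶠ[𝓝 z] y →
      ∀ x ∈ U, fuchsOp p L Y x + polyMap c x = 0 := by
    intro U Y z hU hUo hY hz hzD hYy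
    refine AnalyticOnNhd.eqOn_of_preconnected_of_eventuallyEq (g := fun _ => (0 : V))
      (((differentiableOn_fuchsOp p L hUo hY).add hpoly.differentiableOn).analyticOnNhd hUo)
      analyticOnNhd_const hU hz ?_
    filter_upwards [hYy.eventuallyEq_nhds, hDo.mem_nhds hzD] with x hx hxD
    show fuchsOp p L Y x + polyMap c x = 0
    rw [fuchsOp_congr p L hx, h x hxD]
  obtain ⟨r₀, hr₀, hball⟩ := Metric.isOpen_iff.1 hDo (p 0) (hpD 0)
  set c₀ := p 0
  let r₁ := r₀ / 2
  have hr₁ : 0 < r₁ := half_pos hr₀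
  have hr₁₀ : r₁ < r₀ := half_lt_self hr₀
  obtain ⟨Φ, hΦ, hΦp⟩ := exists_homeomorph_gather hD hDo p hp hpD (B := ball c₀ r₁) isOpen_ball
    ⟨c₀, mem_ball_self hr₁⟩ ((ball_subset_ball hr₁₀.le).trans hball)
  have hpre : Φ ⁻¹' ball c₀ r₀ ⊆ D := by
    intro x hx
    by_contra hxD
    rw [mem_preimage, hΦ x hxD] at hx
    exact hxD (hball hx)
  have hc₀ : ∀ {ρ}, 0 < ρ → Φ.symm c₀ ∈ Φ ⁻¹' ball c₀ ρ := fun hρ => by simpa using hρ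
  have hnear : ∀ {Y : ℂ → V}, EqOn Y y (Φ ⁻¹' ball c₀ r₀) → Y =ᶠ[𝓝 (Φ.symm c₀)] y := fun hY =>
    eventually_of_mem ((isOpen_ball.preimage Φ.continuous).mem_nhds (hc₀ hr₀)) hY
  obtain ⟨Y, hY, hYy⟩ := exists_entire_extension Φ c₀ hr₀ (hy.mono hpre) (fun R => by
    let g : ℂ → V := fun x => (Q p x)⁻¹ • (0 - polyMap c x)
    have hg : DifferentiableOn ℂ g (range p)ᶜ := by
      intro x hx
      have hQ : Differentiable ℂ (Q p) := by
        unfold Q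
        fun_prop
      exact (((hQ x).inv (Q_ne_zero hx)).smul
        ((hpoly x).const_sub 0)).differentiableWithinAt
    have hcont := fun i : {x : ℂ // x ∉ range p} => exists_continuation_ball p L hg i.2
    choose r hr hcont using hcont
    -- The part of the disc of radius `R` that stays away from the gathered poles.
    have hK : IsCompact (closedBall c₀ R \ ball c₀ r₁) :=
      (isCompact_closedBall c₀ R).diff isOpen_ball
    obtain ⟨δ, hδ, hδK⟩ := lebesgue_number_lemma_of_metric hK
      (c := fun i : {x : ℂ // x ∉ range p} => Φ.symm ⁻¹' ball i.1 (r i))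
      (fun i => isOpen_ball.preimage Φ.symm.continuous) (fun e he => by
        have hex : Φ.symm e ∉ range p := by
          rintro ⟨j, hj⟩
          have := hΦp j
          rw [hj, Φ.apply_symm_apply] at this
          exact he.2 this
        exact mem_iUnion.2 ⟨⟨_, hex⟩, mem_ball_self (hr _)⟩)
    refine ⟨min δ (r₀ - r₁), lt_min hδ (by linarith), fun ρ hρ hρR Y hY hYy e he => ?_⟩
    -- Near the poles the solution is `y` itself; elsewhere the continuation crosses no pole.
    by_cases he₁ : e ∈ ball c₀ r₁
    · have he₀ : Φ.symm e ∈ Φ ⁻¹' ball c₀ r₀ := by simpa using ball_subset_ball hr₁₀.le he₁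
      have hev : Y =ᶠ[𝓝 (Φ.symm e)] y :=
        eventually_of_mem ((isOpen_ball.preimage Φ.continuous).mem_nhds he₀) hYy
      refine ⟨y, hy.mono ((preimage_mono ?_).trans hpre), hev.symm⟩
      refine ball_subset_ball' ?_
      have h1 := mem_ball.1 he₁
      have h2 := min_le_right δ (r₀ - r₁)
      linarith
    · obtain ⟨i, hi⟩ := hδK e ⟨ball_subset_closedBall (ball_subset_ball hρR he), he₁⟩
      have hUo : IsOpen (Φ ⁻¹' ball c₀ ρ) := isOpen_ball.preimage Φ.continuous
      have heU : Φ.symm e ∈ Φ ⁻¹' ball c₀ ρ := by simpa using he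
      obtain ⟨s, hs, hsY⟩ := hcont i (Φ.symm e) (hi (mem_ball_self hδ)) Y (by
        have hp' : Φ.symm e ∉ range p := by
          rintro ⟨j, hj⟩
          have := hΦp j
          rw [hj, Φ.apply_symm_apply] at this
          exact he₁ this
        filter_upwards [hUo.mem_nhds heU, (isOpen_compl_range p).mem_nhds hp'] with x hx hxp
        exact hasDerivAt_of_fuchsOp p L hxp (hY.differentiableAt (hUo.mem_nhds hx))
          (propagate (Φ.isPreconnected_preimage.2 (convex_ball c₀ ρ).isPreconnected) hUo hY
            (hc₀ (hr₀.trans_le hρ)) (hpre (hc₀ hr₀)) (hnear hYy) x hx))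
      refine ⟨s, hs.mono fun x hx => ?_, hsY⟩
      have := hi (ball_subset_ball (min_le_left _ _) hx)
      simpa using this)
  refine ⟨Y, hY, fun x => propagate isPreconnected_univ isOpen_univ hY.differentiableOn
    (mem_univ (Φ.symm c₀)) (hpre (hc₀ hr₀)) (hnear hYy) x (mem_univ x), ?_⟩
  exact AnalyticOnNhd.eqOn_of_preconnected_of_eventuallyEq (hY.differentiableOn.analyticOnNhd hDo)
    (hy.analyticOnNhd hDo) hD (hpre (hc₀ hr₀)) (hnear hYy)

/-- The homogeneous linear problem has only the trivial solution. -/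
theorem eq_zero_of_fuchsOp_add_polyMap [CompleteSpace V] {p : Fin (S + 2) → ℂ}
    (hp : Function.Injective p) (L : Fin (S + 2) → V →L[ℂ] V)
    (hL : ∀ (k : ℕ) (v : V), (k : ℂ) • v + ∑ j, L j v = 0 → v = 0) {D : Set ℂ}
    (hD : IsPreconnected D) (hDo : IsOpen D) (hpD : ∀ j, p j ∈ D) {y : ℂ → V}
    (hy : DifferentiableOn ℂ y D) {c : Fin (S + 1) → V}
    (h : ∀ x ∈ D, fuchsOp p L y x + polyMap c x = 0) : (∀ x ∈ D, y x = 0) ∧ c = 0 := by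
  obtain ⟨Y, hY, hYc, hYy⟩ := exists_entire_solution hp L hD hDo hpD hy h
  obtain ⟨n, hn⟩ := isPolyLT_of_fuchsOp p L hY c hYc
  have h0 : Y = 0 := hn.eq_zero_of_fuchsOp p L hL (isPolyLT_polyMap c) hYc
  refine ⟨fun x hx => by rw [← hYy hx, h0]; rfl, polyMap_injective fun x => ?_⟩
  have := hYc x
  rw [h0] at this
  simpa [fuchsOp] using this

end

/-! ### Existence for the linear problem -/

section

variable {V : Type*} [NormedAddCommGroup V] [NormedSpace ℂ V]

variable {S : ℕ}

theorem norm_polyMap_le (c : Fin (S + 1) → V) (x : ℂ) :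
    ‖polyMap c x‖ ≤ (∑ l : Fin (S + 1), ‖x‖ ^ (l : ℕ)) * ‖c‖ := by
  rw [polyMap, Finset.sum_mul]
  refine norm_sum_le_of_le _ fun l _ => ?_
  rw [norm_smul, norm_pow]
  gcongr
  exact norm_le_pi_norm c l

/-- Away from the poles, a family of solutions whose data tend to zero tends to zero uniformly near
a point as soon as it does so at a single nearby point. -/
theorem exists_tendstoUniformlyOn_zero (p : Fin (S + 2) → ℂ) (L : Fin (S + 2) → V →L[ℂ] V)
    {D : Set ℂ} (hDo : IsOpen D) {ι : Type*} {l : Filter ι} {y R : ι → ℂ → V}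
    {c : ι → Fin (S + 1) → V} (hy : ∀ i, DifferentiableOn ℂ (y i) D)
    (h : ∀ i, ∀ x ∈ D, fuchsOp p L (y i) x + polyMap (c i) x = R i x)
    (hR : TendstoLocallyUniformlyOn R 0 l D) (hc : Tendsto c l (𝓝 0)) {x₀ : ℂ} (hx₀ : x₀ ∈ D)
    (hx₀p : x₀ ∉ range p) :
    ∃ t ∈ 𝓝 x₀, ∀ a ∈ t, Tendsto (fun i => y i a) l (𝓝 0) → TendstoUniformlyOn y 0 l t := by
  let β : ℂ → ℝ := fun x => ‖(Q p x)⁻¹‖ * (1 + ∑ l : Fin (S + 1), ‖x‖ ^ (l : ℕ))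
  have hβ : ContinuousAt β x₀ := by
    have hQ : Continuous (Q p) := by
      unfold Q
      fun_prop
    exact (hQ.continuousAt.inv₀ (Q_ne_zero hx₀p)).norm.mul (by fun_prop)
  have h1 : ∀ᶠ x in 𝓝 x₀, ‖connection p L x‖ < ‖connection p L x₀‖ + 1 :=
    (differentiableAt_connection p L hx₀p).continuousAt.norm.eventually_lt_const (by linarith)
  have h2 : ∀ᶠ x in 𝓝 x₀, β x < β x₀ + 1 := hβ.eventually_lt_const (by linarith)
  obtain ⟨ε, hε, hball⟩ := Metric.eventually_nhds_iff_ball.1 (((h1.and h2).and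
    ((isOpen_compl_range p).mem_nhds hx₀p)).and (hDo.mem_nhds hx₀))
  let r := min (ε / 2) (1 / 2)
  have hr : 0 < r := lt_min (by linarith) (by norm_num)
  have hr1 : r ≤ 1 / 2 := min_le_right _ _
  have hrε : closedBall x₀ r ⊆ ball x₀ ε :=
    closedBall_subset_ball ((min_le_left _ _).trans_lt (by linarith))
  have hUn : TendstoUniformlyOn R 0 l (closedBall x₀ r) :=
    (tendstoLocallyUniformlyOn_iff_forall_isCompact hDo).1 hR _
      (fun x hx => (hball x (hrε hx)).2) (isCompact_closedBall _ _)
  let M := ‖connection p L x₀‖ + 1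
  have hM : 0 < M := by positivity
  have hβ0 : 0 < β x₀ + 1 := by positivity
  refine ⟨ball x₀ r, ball_mem_nhds _ hr, fun a ha hya => ?_⟩
  rw [Metric.tendstoUniformlyOn_iff] at hUn ⊢
  intro η hη
  let C := Real.exp M + Real.exp M / M * ((β x₀ + 1) * 2)
  have hC : 0 < C := by positivity
  let κ := η / (2 * C)
  have hκ : 0 < κ := by positivity
  have hya' : ∀ᶠ i in l, ‖y i a‖ < κ := by simpa using hya.norm.eventually_lt_const (by simpa)
  have hc' : ∀ᶠ i in l, ‖c i‖ < κ := by simpa using hc.norm.eventually_lt_const (by simpa)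
  filter_upwards [hUn κ hκ, hya', hc'] with i hRi hyi hci b hb
  rw [Pi.zero_apply, dist_zero_left]
  have hd : ∀ x ∈ ball x₀ r, HasDerivAt (y i)
      (connection p L x (y i x) + (Q p x)⁻¹ • (R i x - polyMap (c i) x)) x := fun x hx =>
    hasDerivAt_of_fuchsOp p L (hball x (hrε (ball_subset_closedBall hx))).1.2
      ((hy i).differentiableAt
        (hDo.mem_nhds (hball x (hrε (ball_subset_closedBall hx))).2))
      (h i x (hball x (hrε (ball_subset_closedBall hx))).2)
  have hG := norm_le_of_norm_deriv_le (convex_ball x₀ r) hd (M := M)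
    (ε := (β x₀ + 1) * (κ + κ)) hM (by positivity) (fun x hx => ?_) ha hb ?_
  · calc ‖y i b‖ ≤ Real.exp M * ‖y i a‖ + Real.exp M / M * ((β x₀ + 1) * (κ + κ)) := hG
      _ ≤ Real.exp M * κ + Real.exp M / M * ((β x₀ + 1) * (κ + κ)) := by gcongr
      _ = κ * C := by simp only [C]; ring
      _ = η / 2 := by simp only [κ]; field_simp
      _ < η := by linarith
  · have hx' := ball_subset_closedBall hx
    obtain ⟨⟨⟨b1, b2⟩, -⟩, -⟩ := hball x (hrε hx')
    refine (norm_add_le _ _).trans (add_le_add (ContinuousLinearMap.le_of_opNorm_le _ b1.le _) ?_)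
    have hRx : ‖R i x‖ ≤ κ := by
      have := hRi x hx'
      rw [Pi.zero_apply, dist_zero_left] at this
      exact this.le
    have hs : 0 ≤ ∑ l : Fin (S + 1), ‖x‖ ^ (l : ℕ) := by positivity
    calc ‖(Q p x)⁻¹ • (R i x - polyMap (c i) x)‖
        ≤ ‖(Q p x)⁻¹‖ * (‖R i x‖ + ‖polyMap (c i) x‖) := by
          rw [norm_smul]
          gcongr
          exact norm_sub_le _ _
      _ ≤ ‖(Q p x)⁻¹‖ * (κ + (∑ l : Fin (S + 1), ‖x‖ ^ (l : ℕ)) * κ) := by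
          gcongr
          exact (norm_polyMap_le _ _).trans (by gcongr)
      _ = β x * κ := by simp only [β]; ring
      _ ≤ (β x₀ + 1) * κ := by gcongr
      _ ≤ (β x₀ + 1) * (κ + κ) := by gcongr; linarith
  · rw [← dist_eq_norm]
    have h1 := mem_ball.1 ha
    have h2 := mem_ball.1 hb
    have := dist_triangle_right b a x₀
    linarith

/-- A family of solutions tends to zero, locally uniformly on the whole domain, if its data and its
values at one point do. Near a pole this follows from the maximum principle. -/
theorem tendstoLocallyUniformlyOn_zero [CompleteSpace V] {p : Fin (S + 2) → ℂ}
    (L : Fin (S + 2) → V →L[ℂ] V) {D : Set ℂ} (hD : IsPreconnected D) (hDo : IsOpen D) {ι : Type*}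
    {l : Filter ι} {y R : ι → ℂ → V} {c : ι → Fin (S + 1) → V}
    (hy : ∀ i, DifferentiableOn ℂ (y i) D)
    (h : ∀ i, ∀ x ∈ D, fuchsOp p L (y i) x + polyMap (c i) x = R i x)
    (hR : TendstoLocallyUniformlyOn R 0 l D) (hc : Tendsto c l (𝓝 0)) {x₀ : ℂ} (hx₀ : x₀ ∈ D)
    (hx₀p : x₀ ∉ range p) (hyx₀ : Tendsto (fun i => y i x₀) l (𝓝 0)) :
    TendstoLocallyUniformlyOn y 0 l D := by
  have hloc := fun x (hx : x ∈ D \ range p) =>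
    exists_tendstoUniformlyOn_zero p L hDo hy h hR hc hx.1 hx.2
  have hpt : ∀ x ∈ D \ range p, Tendsto (fun i => y i x) l (𝓝 0) := by
    intro x hx
    refine (isPreconnected_diff_finite hD hDo (finite_range p)).induction₂'
      (fun a b => Tendsto (fun i => y i a) l (𝓝 0) → Tendsto (fun i => y i b) l (𝓝 0))
      (fun a ha => ?_) (fun _ _ _ _ _ _ hab hbc h => hbc (hab h)) (x := x₀) ⟨hx₀, hx₀p⟩ hx hyx₀
    obtain ⟨t, ht, htu⟩ := hloc a ha
    refine mem_nhdsWithin_of_mem_nhds ?_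
    filter_upwards [ht] with b hb
    exact ⟨fun h => (htu a (mem_of_mem_nhds ht) h).tendsto_at hb,
      fun h => (htu b hb h).tendsto_at (mem_of_mem_nhds ht)⟩
  have hreg : TendstoLocallyUniformlyOn y 0 l (D \ range p) := by
    intro u hu x hx
    obtain ⟨t, ht, htu⟩ := hloc x hx
    exact ⟨t, mem_nhdsWithin_of_mem_nhds ht, htu x (mem_of_mem_nhds ht) (hpt x hx) u hu⟩
  have hOreg : IsOpen (D \ range p) := hDo.sdiff (finite_range p).isClosed
  have key : ∀ x ∈ D, ∃ t ∈ 𝓝 x, TendstoUniformlyOn y 0 l t := by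
    intro x hx
    have h1 : D ∩ (range p \ {x})ᶜ ∈ 𝓝 x :=
      (hDo.inter ((finite_range p).sdiff).isClosed.isOpen_compl).mem_nhds ⟨hx, by simp⟩
    obtain ⟨r, hr, hrU⟩ := nhds_basis_closedBall.mem_iff.1 h1
    refine ⟨closedBall x r, closedBall_mem_nhds x hr, ?_⟩
    have h2 : TendstoUniformlyOn y 0 l (sphere x r) := by
      refine (tendstoLocallyUniformlyOn_iff_forall_isCompact hOreg).1 hreg _ (fun z hz => ?_)
        (isCompact_sphere x r)
      have hz' := hrU (sphere_subset_closedBall hz)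
      refine ⟨hz'.1, fun hzp => hz'.2 ⟨hzp, ?_⟩⟩
      rintro rfl
      simp only [mem_sphere, dist_self] at hz
      exact hr.ne hz
    rw [Metric.tendstoUniformlyOn_iff] at h2 ⊢
    intro ε hε
    filter_upwards [h2 (ε / 2) (half_pos hε)] with i hi z hz
    rw [Pi.zero_apply, dist_zero_left]
    have hd : DiffContOnCl ℂ (y i) (ball x r) := by
      refine DifferentiableOn.diffContOnCl ?_
      rw [closure_ball x hr.ne']
      exact (hy i).mono fun w hw => (hrU hw).1
    refine lt_of_le_of_lt (Complex.norm_le_of_forall_mem_frontier_norm_le isBounded_ball hd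
      (C := ε / 2) (fun w hw => ?_) (by rwa [closure_ball x hr.ne'])) (half_lt_self hε)
    rw [frontier_ball x hr.ne'] at hw
    have := hi w hw
    rw [Pi.zero_apply, dist_zero_left] at this
    exact this.le
  intro u hu x hx
  obtain ⟨t, ht, htu⟩ := key x hx
  exact ⟨t, mem_nhdsWithin_of_mem_nhds ht, htu u hu⟩

/-- Solutions converge, locally uniformly, to a solution if their data and their values at one point
converge. -/
theorem exists_limit_solution [CompleteSpace V] {p : Fin (S + 2) → ℂ}
    (L : Fin (S + 2) → V →L[ℂ] V) {D : Set ℂ} (hD : IsPreconnected D) (hDo : IsOpen D)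
    {y R : ℕ → ℂ → V} {R₀ : ℂ → V} {c : ℕ → Fin (S + 1) → V} {c₀ : Fin (S + 1) → V}
    (hy : ∀ i, DifferentiableOn ℂ (y i) D)
    (h : ∀ i, ∀ x ∈ D, fuchsOp p L (y i) x + polyMap (c i) x = R i x)
    (hR : TendstoLocallyUniformlyOn R R₀ atTop D) (hc : Tendsto c atTop (𝓝 c₀)) {x₀ : ℂ}
    (hx₀ : x₀ ∈ D) (hx₀p : x₀ ∉ range p) {v : V} (hyx₀ : Tendsto (fun i => y i x₀) atTop (𝓝 v)) :
    ∃ Y : ℂ → V, DifferentiableOn ℂ Y D ∧ Y x₀ = v ∧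
      ∀ x ∈ D, fuchsOp p L Y x + polyMap c₀ x = R₀ x := by
  have hfst : Tendsto (Prod.fst : ℕ × ℕ → ℕ) (atTop ×ˢ atTop) atTop := tendsto_fst
  have hsnd : Tendsto (Prod.snd : ℕ × ℕ → ℕ) (atTop ×ˢ atTop) atTop := tendsto_snd
  have hdiff : TendstoLocallyUniformlyOn (fun (q : ℕ × ℕ) x => y q.1 x + (-1 : ℂ) • y q.2 x) 0
      (atTop ×ˢ atTop) D := by
    refine tendstoLocallyUniformlyOn_zero L hD hDo (p := p) (x₀ := x₀)
      (R := fun q x => R q.1 x - R q.2 x) (c := fun q => c q.1 + (-1 : ℂ) • c q.2)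
      (fun q => (hy q.1).add ((hy q.2).const_smul _)) (fun q x hx => ?_) ?_ ?_ hx₀ hx₀p ?_
    · have d : ∀ i, DifferentiableAt ℂ (y i) x := fun i => (hy i).differentiableAt (hDo.mem_nhds hx)
      rw [fuchsOp_add p L (z := fun x => (-1 : ℂ) • y q.2 x) (d q.1) ((d q.2).const_smul (-1 : ℂ)),
        fuchsOp_smul, polyMap_add, polyMap_smul,
        ← h q.1 x hx, ← h q.2 x hx, neg_one_smul, neg_one_smul]
      abel
    · rw [tendstoLocallyUniformlyOn_iff_forall_isCompact hDo] at hR ⊢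
      intro K hK hKc
      have := (hR K hK hKc).uniformCauchySeqOn
      rw [Metric.tendstoUniformlyOn_iff]
      intro ε hε
      filter_upwards [this _ (dist_mem_uniformity hε)] with q hq x hx
      have := hq x hx
      rwa [Pi.zero_apply, dist_zero_left, ← dist_eq_norm]
    · simpa using (hc.comp hfst).add ((hc.comp hsnd).const_smul (-1 : ℂ))
    · simpa using (hyx₀.comp hfst).add ((hyx₀.comp hsnd).const_smul (-1 : ℂ))
  rw [tendstoLocallyUniformlyOn_iff_forall_isCompact hDo] at hdiff
  have hcauchy : ∀ K ⊆ D, IsCompact K → UniformCauchySeqOn y atTop K := by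
    intro K hK hKc u hu
    obtain ⟨ε, hε, hεu⟩ := Metric.mem_uniformity_dist.1 hu
    filter_upwards [Metric.tendstoUniformlyOn_iff.1 (hdiff K hK hKc) ε hε] with q hq x hx
    refine hεu ?_
    have := hq x hx
    rw [Pi.zero_apply, dist_zero_left, neg_one_smul, ← sub_eq_add_neg] at this
    rwa [dist_eq_norm]
  have hlim : ∀ x, ∃ s : V, x ∈ D → Tendsto (fun n => y n x) atTop (𝓝 s) := by
    intro x
    by_cases hx : x ∈ D
    · have h1 := hcauchy {x} (singleton_subset_iff.2 hx) isCompact_singleton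
      obtain ⟨s, hs⟩ := cauchySeq_tendsto_of_complete
        (h1.cauchySeq (mem_singleton x))
      exact ⟨s, fun _ => hs⟩
    · exact ⟨0, fun h => absurd h hx⟩
  choose Y hY using hlim
  have hloc : TendstoLocallyUniformlyOn y Y atTop D :=
    (tendstoLocallyUniformlyOn_iff_forall_isCompact hDo).2 fun K hK hKc =>
      (hcauchy K hK hKc).tendstoUniformlyOn_of_tendsto fun x hx => hY x (hK hx)
  have hYd : DifferentiableOn ℂ Y D := hloc.differentiableOn (Eventually.of_forall hy) hDo
  refine ⟨Y, hYd, tendsto_nhds_unique (hY x₀ hx₀) hyx₀, fun x hx => ?_⟩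
  have h1 : Tendsto (fun n => deriv (y n) x) atTop (𝓝 (deriv Y x)) :=
    (hloc.deriv (Eventually.of_forall hy) hDo).tendsto_at hx
  have h2 : Tendsto (fun n => fuchsOp p L (y n) x) atTop (𝓝 (fuchsOp p L Y x)) := by
    unfold fuchsOp
    exact (h1.const_smul _).add (tendsto_finsetSum _ fun j _ =>
      (((L j).continuous.tendsto _).comp (hY x hx)).const_smul _)
  have h3 : Tendsto (fun n => polyMap (c n) x) atTop (𝓝 (polyMap c₀ x)) := by
    unfold polyMap
    exact tendsto_finsetSum _ fun j _ => (tendsto_pi_nhds.1 hc j).const_smul _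
  refine tendsto_nhds_unique ((h2.add h3).congr fun n => h n x hx) (hR.tendsto_at hx)

/-- Runge's theorem for functions with values in a finite-dimensional space. -/
theorem exists_isPolyLT_tendsto [FiniteDimensional ℂ V] {D : Set ℂ} (hDo : IsOpen D)
    (hD : IsSimplyConnected D) {R : ℂ → V} (hR : DifferentiableOn ℂ R D) :
    ∃ P : ℕ → ℂ → V, (∀ n, ∃ k, IsPolyLT k (P n)) ∧ TendstoLocallyUniformlyOn P R atTop D := by
  -- Approximation on a single compact set, coordinate by coordinate.
  have near : ∀ {K : Set ℂ} {ε : ℝ}, IsCompact K → K ⊆ D → 0 < ε →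
      ∃ P : ℂ → V, (∃ k, IsPolyLT k P) ∧ ∀ x ∈ K, ‖R x - P x‖ < ε := by
    intro K ε hK hKD hε
    let b := Module.finBasis ℂ V
    let C : ℝ := 1 + ∑ i, ‖b i‖
    have hC : 0 < C := by positivity
    have hcoord : ∀ i, DifferentiableOn ℂ (fun x => b.repr (R x) i) D := fun i =>
      ((b.coord i).toContinuousLinearMap.differentiable.comp_differentiableOn hR)
    choose q hq using fun i => exists_polynomial_near hDo hD (hcoord i) hK hKD (div_pos hε hC)
    refine ⟨fun x => ∑ i, (q i).eval x • b i, ⟨∑ i, ((q i).natDegree + 1), ?_⟩, fun x hx => ?_⟩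
    · refine IsPolyLT.sum _ fun i _ => isPolyLT_eval_smul ?_ _
      refine Polynomial.degree_le_natDegree.trans_lt ?_
      have h1 := Finset.single_le_sum (f := fun i => (q i).natDegree + 1)
        (fun _ _ => Nat.zero_le _) (Finset.mem_univ i)
      exact_mod_cast (Nat.lt_succ_self _).trans_le h1
    · have h1 : R x - ∑ i, (q i).eval x • b i =
          ∑ i, -((q i).eval x - b.repr (R x) i) • b i := by
        conv_lhs => rw [← b.sum_repr (R x)]
        rw [← Finset.sum_sub_distrib]
        refine Finset.sum_congr rfl fun i _ => ?_
        rw [← sub_smul, neg_sub]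
      rw [h1]
      calc ‖∑ i, -((q i).eval x - b.repr (R x) i) • b i‖ ≤ ∑ i, ε / C * ‖b i‖ := by
            refine norm_sum_le_of_le _ fun i _ => ?_
            rw [norm_smul, norm_neg]
            gcongr
            exact (hq i x hx).le
        _ = ε * ((C - 1) / C) := by
            rw [← Finset.mul_sum]
            simp only [C]
            ring
        _ < ε * 1 := by
            gcongr
            rw [div_lt_one hC]
            linarith
        _ = ε := mul_one ε
  have := hDo.locallyCompactSpace
  let K : CompactExhaustion D := CompactExhaustion.choice D
  choose P hP hPR using fun n : ℕ => near (K := Subtype.val '' K n) (ε := 1 / (n + 1 : ℝ))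
    ((K.isCompact n).image continuous_subtype_val) (by rintro _ ⟨x, -, rfl⟩; exact x.2)
    (by positivity)
  refine ⟨P, hP, (tendstoLocallyUniformlyOn_iff_forall_isCompact hDo).2 fun T hT hTc => ?_⟩
  obtain ⟨N, hN⟩ := K.exists_superset_of_isCompact (s := Subtype.val ⁻¹' T)
    (Topology.IsInducing.subtypeVal.isCompact_preimage_iff (by simpa using hT) |>.2 hTc)
  rw [Metric.tendstoUniformlyOn_iff]
  intro ε hε
  have h0 := (tendsto_one_div_add_atTop_nhds_zero_nat (𝕜 := ℝ)).eventually_lt_const hε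
  filter_upwards [h0, eventually_ge_atTop N] with n hn hNn x hx
  rw [dist_eq_norm]
  exact (hPR n x ⟨⟨x, hT hx⟩, K.subset hNn (hN hx), rfl⟩).trans hn

theorem exists_mem_notMem_range (p : Fin (S + 2) → ℂ) {D : Set ℂ} (hDo : IsOpen D)
    (hD : D.Nonempty) : ∃ x₀ ∈ D, x₀ ∉ range p :=
  ((finite_range p).countable.dense_compl ℂ).inter_open_nonempty D hDo hD

/-- Solvability of the inhomogeneous linear problem: polynomial right-hand sides approximate the
given one, and the solutions stay bounded, as otherwise a normalized limit would be a nontrivial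
solution of the homogeneous problem. -/
theorem exists_fuchsOp_add_polyMap [FiniteDimensional ℂ V] {p : Fin (S + 2) → ℂ}
    (hp : Function.Injective p) (L : Fin (S + 2) → V →L[ℂ] V)
    (hL : ∀ (k : ℕ) (v : V), (k : ℂ) • v + ∑ j, L j v = 0 → v = 0) {D : Set ℂ}
    (hD : IsSimplyConnected D) (hDo : IsOpen D) (hpD : ∀ j, p j ∈ D) {R : ℂ → V}
    (hR : DifferentiableOn ℂ R D) :
    ∃ (y : ℂ → V) (c : Fin (S + 1) → V), DifferentiableOn ℂ y D ∧
      ∀ x ∈ D, fuchsOp p L y x + polyMap c x = R x := by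
  have : ProperSpace V := FiniteDimensional.proper ℂ V
  have : CompleteSpace V := FiniteDimensional.complete ℂ V
  have hDc : IsPreconnected D := hD.isPathConnected.isConnected.isPreconnected
  obtain ⟨P, hP, hPR⟩ := exists_isPolyLT_tendsto hDo hD hR
  have hsol : ∀ n, ∃ (y : ℂ → V) (c : Fin (S + 1) → V), Differentiable ℂ y ∧
      ∀ x, fuchsOp p L y x + polyMap c x = P n x := fun n => by
    obtain ⟨k, hk⟩ := hP n
    exact hk.exists_fuchsOp_add p L hL
  choose y c hy hyc using hsol
  obtain ⟨x₀, hx₀, hx₀p⟩ := exists_mem_notMem_range p hDo ⟨p 0, hpD 0⟩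
  let a : ℕ → V × (Fin (S + 1) → V) := fun n => (y n x₀, c n)
  by_cases ha : Tendsto (fun n => ‖a n‖) atTop atTop
  · -- If the data tend to infinity, normalize them to norm one and pass to the limit.
    exfalso
    let b : ℕ → V × (Fin (S + 1) → V) := fun n => ((‖a n‖⁻¹ : ℝ) : ℂ) • a n
    have hb : ∀ᶠ n in atTop, ‖b n‖ = 1 := by
      filter_upwards [ha.eventually_gt_atTop 0] with n hn
      simp only [b]
      rw [norm_smul, Complex.norm_real, norm_inv, norm_norm, inv_mul_cancel₀ hn.ne']
    obtain ⟨β, -, φ, hφ, hlim⟩ := tendsto_subseq_of_frequently_bounded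
      (isBounded_closedBall (x := (0 : V × (Fin (S + 1) → V))) (r := 1)) (x := b)
      (hb.mono fun n hn => by simp [hn]).frequently
    have hβ : ‖β‖ = 1 := tendsto_nhds_unique hlim.norm
      (tendsto_const_nhds.congr' ((hφ.tendsto_atTop.eventually hb).mono fun n hn => hn.symm))
    have hinv : Tendsto (fun n => ((‖a (φ n)‖⁻¹ : ℝ) : ℂ)) atTop (𝓝 0) := by
      have := (Complex.continuous_ofReal.tendsto 0).comp
        (tendsto_inv_atTop_zero.comp (ha.comp hφ.tendsto_atTop))
      rwa [Complex.ofReal_zero] at this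
    have hPφ : TendstoLocallyUniformlyOn (fun n => P (φ n)) R atTop D := fun u hu x hx => by
      obtain ⟨t, ht, htu⟩ := hPR u hu x hx
      exact ⟨t, ht, hφ.tendsto_atTop.eventually htu⟩
    have hsc : TendstoLocallyUniformlyOn (fun n x => ((‖a (φ n)‖⁻¹ : ℝ) : ℂ) • P (φ n) x)
        (fun _ => 0) atTop D := by
      have h1 : TendstoLocallyUniformlyOn (fun n (_ : ℂ) => ((‖a (φ n)‖⁻¹ : ℝ) : ℂ))
          (fun _ => 0) atTop D := hinv.tendstoUniformlyOn_const D |>.tendstoLocallyUniformlyOn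
      have := h1.smul₀ hPφ continuousOn_const hR.continuousOn
      refine this.congr_right fun x _ => ?_
      simp
    obtain ⟨Y, hYd, hYx, hY⟩ := exists_limit_solution L hDc hDo (p := p)
      (y := fun n x => ((‖a (φ n)‖⁻¹ : ℝ) : ℂ) • y (φ n) x)
      (c := fun n => ((‖a (φ n)‖⁻¹ : ℝ) : ℂ) • c (φ n))
      (fun n => ((hy (φ n)).const_smul _).differentiableOn) (fun n x _ => by
        rw [fuchsOp_smul, polyMap_smul, ← smul_add, hyc]) hsc
      (((continuous_snd.tendsto β).comp hlim)) hx₀ hx₀p ((continuous_fst.tendsto β).comp hlim)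
    obtain ⟨h1, h2⟩ := eq_zero_of_fuchsOp_add_polyMap hp L hL hDc hDo hpD hYd hY
    have h3 : β = 0 := Prod.ext (hYx ▸ h1 x₀ hx₀) h2
    rw [h3, norm_zero] at hβ
    exact zero_ne_one hβ
  · -- Otherwise a subsequence of the data converges, and with it the solutions.
    obtain ⟨M, hM⟩ : ∃ M, ∃ᶠ n in atTop, ‖a n‖ < M := by
      rw [Filter.tendsto_atTop] at ha
      push Not at ha
      exact ha
    obtain ⟨β, -, φ, hφ, hlim⟩ := tendsto_subseq_of_frequently_bounded
      (isBounded_ball (x := (0 : V × (Fin (S + 1) → V))) (r := M)) (x := a)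
      (hM.mono fun n hn => by simpa using hn)
    have hPφ : TendstoLocallyUniformlyOn (fun n => P (φ n)) R atTop D := fun u hu x hx => by
      obtain ⟨t, ht, htu⟩ := hPR u hu x hx
      exact ⟨t, ht, hφ.tendsto_atTop.eventually htu⟩
    obtain ⟨Y, hYd, -, hY⟩ := exists_limit_solution L hDc hDo (p := p) (y := fun n => y (φ n))
      (c := fun n => c (φ n)) (fun n => (hy (φ n)).differentiableOn) (fun n x _ => hyc (φ n) x)
      hPφ ((continuous_snd.tendsto β).comp hlim) hx₀ hx₀p ((continuous_fst.tendsto β).comp hlim)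
    exact ⟨Y, β.2, hYd, hY⟩

end

/-! ### Linear vector fields on homogeneous series -/

section

theorem pow_apply_tuple {d : ℕ} {H : Type*} [AddCommGroup H] [Module ℂ H] (E : Module.End ℂ H)
    (N : Matrix (Fin d) (Fin d) ℂ) {h : Fin d → H} (hE : ∀ i, E (h i) = ∑ l, N i l • h l)
    (n : ℕ) (i : Fin d) : (E ^ n) (h i) = ∑ l, (N ^ n) i l • h l := by
  induction n generalizing i with
  | zero => simp [Matrix.one_apply]
  | succ n ih =>
    rw [pow_succ, pow_succ', Module.End.mul_apply, hE, map_sum]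
    simp only [map_smul, ih, Finset.smul_sum, Matrix.mul_apply, Finset.sum_smul, mul_smul]
    exact Finset.sum_comm

/-- Polynomials in the endomorphism act on the tuple as polynomials in the matrix. -/
theorem aeval_apply_tuple {d : ℕ} {H : Type*} [AddCommGroup H] [Module ℂ H] (E : Module.End ℂ H)
    (N : Matrix (Fin d) (Fin d) ℂ) {h : Fin d → H} (hE : ∀ i, E (h i) = ∑ l, N i l • h l)
    (q : ℂ[X]) (i : Fin d) :
    Polynomial.aeval E q (h i) = ∑ l, Polynomial.aeval N q i l • h l := by
  induction q using Polynomial.induction_on' with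
  | add p q hp hq => simp [hp, hq, add_smul, Finset.sum_add_distrib]
  | monomial n a =>
    rw [Polynomial.aeval_monomial, Polynomial.aeval_monomial, ← Algebra.smul_def,
      ← Algebra.smul_def, LinearMap.smul_apply, pow_apply_tuple E N hE, Finset.smul_sum]
    simp [mul_smul]

theorem eq_zero_of_aeval_prod {H : Type*} [AddCommGroup H] [Module ℂ H] (E : Module.End ℂ H)
    {ι : Type*} (s : Finset ι) (q : ι → ℂ[X])
    (hq : ∀ j g, Polynomial.aeval E (q j) g = 0 → g = 0) (g : H)
    (hg : Polynomial.aeval E (∏ j ∈ s, q j) g = 0) : g = 0 := by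
  classical
  induction s using Finset.induction_on with
  | empty => simpa using hg
  | insert j s hj ih =>
    rw [Finset.prod_insert hj, map_mul, Module.End.mul_apply] at hg
    exact ih (hq j _ hg)

/-- If a tuple of vectors is transformed by an endomorphism `E` as by a matrix `N`, and `N` is a
root of a product of polynomials `q j` for which `q j (E)` is injective, then the tuple vanishes. -/
theorem tuple_eq_zero {d : ℕ} {H : Type*} [AddCommGroup H] [Module ℂ H] (E : Module.End ℂ H)
    (N : Matrix (Fin d) (Fin d) ℂ) {h : Fin d → H} (hE : ∀ i, E (h i) = ∑ l, N i l • h l)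
    {ι : Type*} (s : Finset ι) (q : ι → ℂ[X]) (hN : Polynomial.aeval N (∏ j ∈ s, q j) = 0)
    (hq : ∀ j g, Polynomial.aeval E (q j) g = 0 → g = 0) (i : Fin d) : h i = 0 := by
  refine eq_zero_of_aeval_prod E s q hq _ ?_
  rw [aeval_apply_tuple E N hE, hN]
  simp

variable {d : ℕ}

/-- The linear vector field `w ↦ M w`, as a tuple of formal series. -/
noncomputable def linField (M : Matrix (Fin d) (Fin d) ℂ) (k : Fin d) : MvPowerSeries (Fin d) ℂ :=
  ∑ l, MvPowerSeries.C (M k l) * MvPowerSeries.X l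

/-- The derivation `g ↦ ∑ k, ∂ₖ g * (M w)ₖ` along the vector field `w ↦ M w`. -/
noncomputable def lieDeriv (M : Matrix (Fin d) (Fin d) ℂ) : Module.End ℂ (MvPowerSeries (Fin d) ℂ) :=
  ∑ k, (LinearMap.mulRight ℂ (linField M k)) ∘ₗ
    (MvPowerSeries.pderiv ℂ k : MvPowerSeries (Fin d) ℂ →ₗ[ℂ] MvPowerSeries (Fin d) ℂ)

theorem lieDeriv_apply (M : Matrix (Fin d) (Fin d) ℂ) (g : MvPowerSeries (Fin d) ℂ) :
    lieDeriv M g = ∑ k, MvPowerSeries.pderiv ℂ k g * linField M k := by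
  simp [lieDeriv]

theorem coeff_lieDeriv (M : Matrix (Fin d) (Fin d) ℂ) (g : MvPowerSeries (Fin d) ℂ)
    (m : Fin d →₀ ℕ) : MvPowerSeries.coeff m (lieDeriv M g) =
      ∑ k, ∑ l, M k l * MvPowerSeries.coeff m (MvPowerSeries.pderiv ℂ k g * MvPowerSeries.X l) := by
  simp only [lieDeriv_apply, linField, Finset.mul_sum, map_sum]
  refine Finset.sum_congr rfl fun k _ => Finset.sum_congr rfl fun l _ => ?_
  rw [mul_left_comm, MvPowerSeries.coeff_C_mul]

theorem coeff_mul_X_congr {f g : MvPowerSeries (Fin d) ℂ} {m : Fin d →₀ ℕ} {l : Fin d}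
    (h : ∀ m', m = m' + Finsupp.single l 1 → MvPowerSeries.coeff m' f = MvPowerSeries.coeff m' g) :
    MvPowerSeries.coeff m (f * MvPowerSeries.X l) =
      MvPowerSeries.coeff m (g * MvPowerSeries.X l) := by
  classical
  rw [MvPowerSeries.X, MvPowerSeries.coeff_mul_monomial, MvPowerSeries.coeff_mul_monomial]
  split_ifs with hl
  · rw [h _ (tsub_add_cancel_of_le hl).symm]
  · rfl

/-- The derivation along a linear vector field respects degrees. -/
theorem coeff_lieDeriv_congr (M : Matrix (Fin d) (Fin d) ℂ) {f g : MvPowerSeries (Fin d) ℂ}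
    {m : Fin d →₀ ℕ}
    (h : ∀ m', m'.degree = m.degree → MvPowerSeries.coeff m' f = MvPowerSeries.coeff m' g) :
    MvPowerSeries.coeff m (lieDeriv M f) = MvPowerSeries.coeff m (lieDeriv M g) := by
  rw [coeff_lieDeriv, coeff_lieDeriv]
  refine Finset.sum_congr rfl fun k _ => Finset.sum_congr rfl fun l _ => ?_
  congr 1
  refine coeff_mul_X_congr fun m' hm' => ?_
  rw [MvPowerSeries.coeff_pderiv, MvPowerSeries.coeff_pderiv, h]
  simp [hm']

theorem pderiv_linField (M : Matrix (Fin d) (Fin d) ℂ) (k l : Fin d) :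
    MvPowerSeries.pderiv ℂ k (linField M l) = MvPowerSeries.C (M l k) := by
  simp [linField, MvPowerSeries.pderiv_X, Pi.single_apply]

theorem pderiv_comm (k l : Fin d) (g : MvPowerSeries (Fin d) ℂ) :
    MvPowerSeries.pderiv ℂ k (MvPowerSeries.pderiv ℂ l g) =
      MvPowerSeries.pderiv ℂ l (MvPowerSeries.pderiv ℂ k g) := by
  ext m
  rcases eq_or_ne k l with rfl | hkl
  · rfl
  · simp only [MvPowerSeries.coeff_pderiv, Finsupp.add_apply, Finsupp.single_apply, if_neg hkl,
      if_neg hkl.symm, add_zero]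
    rw [add_right_comm]
    ring

/-- The commutator of a partial derivative with the derivation along `w ↦ M w`. -/
theorem pderiv_lieDeriv (M : Matrix (Fin d) (Fin d) ℂ) (k : Fin d) (g : MvPowerSeries (Fin d) ℂ) :
    MvPowerSeries.pderiv ℂ k (lieDeriv M g) = lieDeriv M (MvPowerSeries.pderiv ℂ k g) +
      ∑ l, M l k • MvPowerSeries.pderiv ℂ l g := by
  simp only [lieDeriv_apply, map_sum, Derivation.leibniz, pderiv_linField, smul_eq_mul,
    Finset.sum_add_distrib, pderiv_comm k, MvPowerSeries.smul_eq_C_mul]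
  rw [add_comm]
  congr 1
  · exact Finset.sum_congr rfl fun l _ => mul_comm _ _
  · exact Finset.sum_congr rfl fun l _ => mul_comm _ _

/-- The formal series that are homogeneous of degree `n`. -/
def homogeneous (d n : ℕ) : Submodule ℂ (MvPowerSeries (Fin d) ℂ) where
  carrier := {g | ∀ m, m.degree ≠ n → MvPowerSeries.coeff m g = 0}
  add_mem' hf hg m hm := by rw [map_add, hf m hm, hg m hm, add_zero]
  zero_mem' m _ := by simp
  smul_mem' a g hg m hm := by rw [MvPowerSeries.coeff_smul, hg m hm, mul_zero]

theorem lieDeriv_mem {n : ℕ} (M : Matrix (Fin d) (Fin d) ℂ) (g : MvPowerSeries (Fin d) ℂ)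
    (hg : g ∈ homogeneous d n) : lieDeriv M g ∈ homogeneous d n := by
  intro m hm
  rw [coeff_lieDeriv_congr M (g := 0), map_zero, map_zero]
  intro m' hm'
  rw [hg m' (hm' ▸ hm), map_zero]

theorem pderiv_mem {n : ℕ} (k : Fin d) {g : MvPowerSeries (Fin d) ℂ}
    (hg : g ∈ homogeneous d (n + 1)) : MvPowerSeries.pderiv ℂ k g ∈ homogeneous d n := by
  intro m hm
  rw [MvPowerSeries.coeff_pderiv, hg, zero_mul]
  simpa using hm

/-- The action of a linear vector field on homogeneous series of degree `n`. -/
noncomputable def lieDerivHomogeneous (n : ℕ) (M : Matrix (Fin d) (Fin d) ℂ) :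
    Module.End ℂ (homogeneous d n) :=
  (lieDeriv M).restrict (lieDeriv_mem M)

theorem coe_lieDerivHomogeneous {n : ℕ} (M : Matrix (Fin d) (Fin d) ℂ) (g : homogeneous d n) :
    (lieDerivHomogeneous n M g : MvPowerSeries (Fin d) ℂ) = lieDeriv M g := rfl

/-- The eigenvalues of a linear vector field on homogeneous series of degree `n` are the sums of
`n` eigenvalues of its matrix. -/
theorem eq_zero_of_lieDeriv_eq_smul {M : Matrix (Fin d) (Fin d) ℂ} {μ : Fin d → ℂ}
    (hμ : M.charpoly = ∏ i, (Polynomial.X - Polynomial.C (μ i))) {n : ℕ} {α : ℂ}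
    (hα : ∀ m : Fin d →₀ ℕ, m.degree = n → ∑ l, (m l : ℂ) * μ l ≠ α)
    {g : MvPowerSeries (Fin d) ℂ} (hg : g ∈ homogeneous d n) (h : lieDeriv M g = α • g) :
    g = 0 := by
  induction n generalizing α g with
  | zero =>
    have h0 : α ≠ 0 := fun h => hα 0 (by simp) (by simp [h])
    have h1 : lieDeriv M g = 0 := by
      rw [lieDeriv_apply]
      refine Finset.sum_eq_zero fun k _ => ?_
      have : MvPowerSeries.pderiv ℂ k g = 0 := by
        ext m
        rw [MvPowerSeries.coeff_pderiv, hg _ (by simp)]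
        simp
      rw [this, zero_mul]
    rw [h1] at h
    exact (smul_eq_zero.1 h.symm).resolve_left h0
  | succ n ih =>
    have hpd : ∀ k, MvPowerSeries.pderiv ℂ k g = 0 := by
      intro k
      -- The gradient satisfies a system of the same kind in one degree less.
      let N : Matrix (Fin d) (Fin d) ℂ := α • 1 - M.transpose
      let G : Fin d → homogeneous d n := fun k => ⟨MvPowerSeries.pderiv ℂ k g, pderiv_mem k hg⟩
      have hG : ∀ i, lieDerivHomogeneous n M (G i) = ∑ l, N i l • G l := by
        intro i
        refine Subtype.ext ?_
        have h1 := pderiv_lieDeriv M i g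
        rw [h, Derivation.map_smul] at h1
        rw [coe_lieDerivHomogeneous, Submodule.coe_sum]
        simp only [N, G, Submodule.coe_smul, Matrix.sub_apply, Matrix.smul_apply, Matrix.one_apply,
          Matrix.transpose_apply, sub_smul, Finset.sum_sub_distrib]
        rw [← sub_eq_of_eq_add h1]
        simp
      have hN : Polynomial.aeval N
          (∏ j, (Polynomial.C α - Polynomial.X - Polynomial.C (μ j))) = 0 := by
        have e : ∏ j, (Polynomial.C α - Polynomial.X - Polynomial.C (μ j)) =
            M.charpoly.comp (Polynomial.C α - Polynomial.X) := by
          simp [hμ, Polynomial.prod_comp]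
        rw [e, Polynomial.aeval_comp, ← Matrix.charpoly_transpose]
        have e2 : Polynomial.aeval N (Polynomial.C α - Polynomial.X) = M.transpose := by
          simp [N, Algebra.algebraMap_eq_smul_one]
        rw [e2, Matrix.aeval_self_charpoly]
      refine congrArg Subtype.val (tuple_eq_zero _ N hG Finset.univ _ hN (fun j u hu => ?_) k)
      refine Subtype.ext (ih (α := α - μ j) (fun m hm hs => ?_) u.2 ?_)
      · refine hα (m + Finsupp.single j 1) (by simp [hm]) ?_
        simp only [Finsupp.add_apply, Nat.cast_add, add_mul, Finset.sum_add_distrib, hs,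
          Finsupp.single_apply]
        simp
      · have h2 := congrArg Subtype.val hu
        simp only [map_sub, Polynomial.aeval_X, Polynomial.aeval_C, LinearMap.sub_apply,
          Module.algebraMap_end_apply, Submodule.coe_sub, Submodule.coe_smul,
          coe_lieDerivHomogeneous, Submodule.coe_zero] at h2
        rw [sub_smul, ← sub_eq_zero, ← neg_eq_zero, ← h2]
        abel
    refine MvPowerSeries.pderiv.ext (fun k => by rw [hpd, map_zero]) ?_
    rw [← MvPowerSeries.coeff_zero_eq_constantCoeff_apply, hg _ (by simp), map_zero]

/-- The Lie bracket of `h` with the linear vector field `w ↦ M w`. -/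
noncomputable def bracket (M : Matrix (Fin d) (Fin d) ℂ) (h : Fin d → MvPowerSeries (Fin d) ℂ)
    (i : Fin d) : MvPowerSeries (Fin d) ℂ :=
  lieDeriv M (h i) - ∑ l, M i l • h l

/-- The homological operator of a nonresonant matrix has no eigenvalue in `{0, -1, -2, …}`. -/
theorem NonlinearlyNonresonant.eq_zero_of_bracket {M : Matrix (Fin d) (Fin d) ℂ}
    (hM : NonlinearlyNonresonant M) {n : ℕ} (hn : 2 ≤ n) (k : ℕ)
    {h : Fin d → MvPowerSeries (Fin d) ℂ} (hh : ∀ i, h i ∈ homogeneous d n)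
    (hk : ∀ i, (k : ℂ) • h i + bracket M h i = 0) (i : Fin d) : h i = 0 := by
  obtain ⟨μ, hμ, hres⟩ := hM
  let N : Matrix (Fin d) (Fin d) ℂ := M - (k : ℂ) • 1
  let G : Fin d → homogeneous d n := fun i => ⟨h i, hh i⟩
  have hG : ∀ i, lieDerivHomogeneous n M (G i) = ∑ l, N i l • G l := by
    intro i
    refine Subtype.ext ?_
    have h1 := hk i
    rw [coe_lieDerivHomogeneous, Submodule.coe_sum]
    simp only [N, G, Submodule.coe_smul, Matrix.sub_apply, Matrix.smul_apply, Matrix.one_apply,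
      sub_smul, Finset.sum_sub_distrib]
    rw [bracket, ← add_sub_assoc, sub_eq_zero] at h1
    rw [← h1]
    simp
  have hN : Polynomial.aeval N
      (∏ j, (Polynomial.X + Polynomial.C (k : ℂ) - Polynomial.C (μ j))) = 0 := by
    have e : ∏ j, (Polynomial.X + Polynomial.C (k : ℂ) - Polynomial.C (μ j)) =
        M.charpoly.comp (Polynomial.X + Polynomial.C (k : ℂ)) := by
      simp [hμ, Polynomial.prod_comp]
    rw [e, Polynomial.aeval_comp]
    have e2 : Polynomial.aeval N (Polynomial.X + Polynomial.C (k : ℂ)) = M := by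
      simp only [map_add, Polynomial.aeval_X, Polynomial.aeval_C, Algebra.algebraMap_eq_smul_one, N]
      abel
    rw [e2, Matrix.aeval_self_charpoly]
  refine congrArg Subtype.val (tuple_eq_zero _ N hG Finset.univ _ hN (fun j u hu => ?_) i)
  refine Subtype.ext (eq_zero_of_lieDeriv_eq_smul hμ (α := μ j - k) (fun m hm hs => ?_) u.2 ?_)
  · refine hres k m j (by omega) ?_
    rw [hs]
    ring
  · have h2 := congrArg Subtype.val hu
    simp only [map_sub, map_add, Polynomial.aeval_X, Polynomial.aeval_C, LinearMap.sub_apply,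
      LinearMap.add_apply, Module.algebraMap_end_apply, Submodule.coe_sub, Submodule.coe_add,
      Submodule.coe_smul, coe_lieDerivHomogeneous, Submodule.coe_zero] at h2
    rw [sub_smul, ← sub_eq_zero, ← h2]
    abel

end

/-! ### Composition of formal series, and Taylor coefficients -/

section

variable {d : ℕ}

/-- The coefficients of `f` in degrees below `n` vanish. -/
def VanishesBelow (n : ℕ) (f : MvPowerSeries (Fin d) ℂ) : Prop :=
  ∀ m, m.degree < n → MvPowerSeries.coeff m f = 0

theorem VanishesBelow.mono {n n' : ℕ} (h : n ≤ n') {f : MvPowerSeries (Fin d) ℂ}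
    (hf : VanishesBelow n' f) : VanishesBelow n f := fun m hm => hf m (hm.trans_le h)

theorem VanishesBelow.add {n : ℕ} {f g : MvPowerSeries (Fin d) ℂ}
    (hf : VanishesBelow n f) (hg : VanishesBelow n g) : VanishesBelow n (f + g) := fun m hm => by
  rw [map_add, hf m hm, hg m hm, add_zero]

theorem VanishesBelow.mul {a b : ℕ} {f g : MvPowerSeries (Fin d) ℂ}
    (hf : VanishesBelow a f) (hg : VanishesBelow b g) : VanishesBelow (a + b) (f * g) := by
  intro m hm
  refine MvPowerSeries.coeff_of_lt_order (lt_of_lt_of_le ?_ MvPowerSeries.le_order_mul)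
  refine lt_of_lt_of_le ?_
    (add_le_add (MvPowerSeries.nat_le_order hf) (MvPowerSeries.nat_le_order hg))
  exact_mod_cast hm

theorem vanishesBelow_X (i : Fin d) : VanishesBelow 1 (MvPowerSeries.X i) := fun m hm => by
  rw [Nat.lt_one_iff, Finsupp.degree_eq_zero_iff] at hm
  rw [hm, MvPowerSeries.coeff_zero_X]

theorem VanishesBelow.hasSubst {U : Fin d → MvPowerSeries (Fin d) ℂ}
    (hU : ∀ i, VanishesBelow 1 (U i)) : MvPowerSeries.HasSubst U :=
  MvPowerSeries.hasSubst_of_constantCoeff_zero fun i => by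
    rw [← MvPowerSeries.coeff_zero_eq_constantCoeff_apply, hU i 0 (by simp)]

/-- Monomials of degree `|e|` in series of positive order have order at least `|e|`, and depend on
these series only up to an error whose order is larger by `|e| - 1`. -/
theorem vanishesBelow_prod_sub_prod {U U' : Fin d → MvPowerSeries (Fin d) ℂ}
    (hU : ∀ i, VanishesBelow 1 (U i)) (hU' : ∀ i, VanishesBelow 1 (U' i)) {N : ℕ}
    (hUU' : ∀ i, VanishesBelow (N + 1) (U i - U' i)) (e : Fin d →₀ ℕ) :
    VanishesBelow e.degree (e.prod fun i k => U i ^ k) ∧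
      VanishesBelow e.degree (e.prod fun i k => U' i ^ k) ∧
      VanishesBelow (N + e.degree) ((e.prod fun i k => U i ^ k) - e.prod fun i k => U' i ^ k) := by
  have zero : ∀ f : MvPowerSeries (Fin d) ℂ, VanishesBelow 0 f := fun f m hm =>
    absurd hm (Nat.not_lt_zero _)
  have mul : ∀ {n n' : ℕ} {a b a' b' : MvPowerSeries (Fin d) ℂ},
      VanishesBelow n a ∧ VanishesBelow n b ∧ VanishesBelow (N + n) (a - b) →
      VanishesBelow n' a' ∧ VanishesBelow n' b' ∧ VanishesBelow (N + n') (a' - b') →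
      VanishesBelow (n + n') (a * a') ∧ VanishesBelow (n + n') (b * b') ∧
        VanishesBelow (N + (n + n')) (a * a' - b * b') := by
    rintro n n' a b a' b' ⟨h1, h2, h3⟩ ⟨h1', h2', h3'⟩
    refine ⟨h1.mul h1', h2.mul h2', ?_⟩
    have e : a * a' - b * b' = (a - b) * a' + b * (a' - b') := by ring
    rw [e]
    exact ((h3.mul h1').mono (by omega)).add ((h2.mul h3').mono (by omega))
  have one : VanishesBelow 0 (1 : MvPowerSeries (Fin d) ℂ) ∧
      VanishesBelow 0 (1 : MvPowerSeries (Fin d) ℂ) ∧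
      VanishesBelow (N + 0) (1 - 1 : MvPowerSeries (Fin d) ℂ) :=
    ⟨zero _, zero _, fun m _ => by rw [sub_self, map_zero]⟩
  induction e using Finsupp.induction_linear with
  | zero => simpa using one
  | add e e' h h' =>
    rw [Finsupp.prod_add_index' (fun _ => pow_zero _) (fun _ _ _ => pow_add _ _ _),
      Finsupp.prod_add_index' (fun _ => pow_zero _) (fun _ _ _ => pow_add _ _ _), map_add]
    exact mul h h'
  | single i k =>
    rw [Finsupp.prod_single_index (h := fun i k => U i ^ k) (pow_zero _),
      Finsupp.prod_single_index (h := fun i k => U' i ^ k) (pow_zero _), Finsupp.degree_single]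
    induction k with
    | zero => simpa using one
    | succ k ih =>
      rw [pow_succ, pow_succ]
      exact mul ih ⟨hU i, hU' i, hUU' i⟩

/-- The coefficients of a composition in low degrees depend only on the coefficients of the inner
series in low degrees. -/
theorem coeff_subst_congr {U U' : Fin d → MvPowerSeries (Fin d) ℂ}
    (hU : ∀ i, VanishesBelow 1 (U i)) (hU' : ∀ i, VanishesBelow 1 (U' i)) {N n : ℕ}
    (hUU' : ∀ i, VanishesBelow (N + 1) (U i - U' i)) {f : MvPowerSeries (Fin d) ℂ}
    (hf : VanishesBelow n f) {m : Fin d →₀ ℕ} (hm : m.degree < N + n) :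
    MvPowerSeries.coeff m (MvPowerSeries.subst U f) =
      MvPowerSeries.coeff m (MvPowerSeries.subst U' f) := by
  rw [MvPowerSeries.coeff_subst (VanishesBelow.hasSubst hU),
    MvPowerSeries.coeff_subst (VanishesBelow.hasSubst hU')]
  refine finsum_congr fun e => ?_
  by_cases he : e.degree < n
  · rw [hf e he, zero_smul, zero_smul]
  · congr 1
    rw [← sub_eq_zero, ← map_sub]
    exact (vanishesBelow_prod_sub_prod hU hU' hUU' e).2.2 m (by omega)

/-- A change of variables tangent to the identity does not affect terms of lowest degree. -/
theorem coeff_subst_lowest {U : Fin d → MvPowerSeries (Fin d) ℂ}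
    (hU : ∀ i, VanishesBelow 2 (U i - MvPowerSeries.X i)) {f : MvPowerSeries (Fin d) ℂ}
    {m : Fin d →₀ ℕ} (hf : VanishesBelow m.degree f) :
    MvPowerSeries.coeff m (MvPowerSeries.subst U f) = MvPowerSeries.coeff m f := by
  have hU1 : ∀ i, VanishesBelow 1 (U i) := fun i => by
    rw [← sub_add_cancel (U i) (MvPowerSeries.X i)]
    exact ((hU i).mono (by omega)).add (vanishesBelow_X i)
  rw [coeff_subst_congr hU1 vanishesBelow_X (N := 1) hU hf (by omega), MvPowerSeries.subst_self]
  rfl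

theorem coeff_subst_eq_sum {U : Fin d → MvPowerSeries (Fin d) ℂ}
    (hU : ∀ i, VanishesBelow 1 (U i)) (f : MvPowerSeries (Fin d) ℂ) (m : Fin d →₀ ℕ) :
    MvPowerSeries.coeff m (MvPowerSeries.subst U f) =
      ∑ e ∈ (Finsupp.finite_of_degree_le (σ := Fin d) m.degree).toFinset,
        MvPowerSeries.coeff e f * MvPowerSeries.coeff m (e.prod fun i k => U i ^ k) := by
  rw [MvPowerSeries.coeff_subst (VanishesBelow.hasSubst hU)]
  refine finsum_eq_sum_of_support_subset _ fun e he => ?_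
  simp only [Set.Finite.coe_toFinset, mem_ofPred_eq]
  by_contra hlt
  refine he ?_
  have := (vanishesBelow_prod_sub_prod hU hU (N := 0) (fun i m _ => by simp) e).1 m (by omega)
  simp only [this, smul_zero]

/-- The coefficients of the series `f x` depend holomorphically on `x ∈ D`. -/
def CoeffDifferentiableOn (D : Set ℂ) (f : ℂ → MvPowerSeries (Fin d) ℂ) : Prop :=
  ∀ m, DifferentiableOn ℂ (fun x => MvPowerSeries.coeff m (f x)) D

theorem CoeffDifferentiableOn.mul {D : Set ℂ} {f g : ℂ → MvPowerSeries (Fin d) ℂ}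
    (hf : CoeffDifferentiableOn D f) (hg : CoeffDifferentiableOn D g) :
    CoeffDifferentiableOn D fun x => f x * g x := by
  classical
  intro m
  simp only [MvPowerSeries.coeff_mul]
  exact DifferentiableOn.fun_sum fun q _ => (hf q.1).mul (hg q.2)

theorem coeffDifferentiableOn_const {D : Set ℂ} (f : MvPowerSeries (Fin d) ℂ) :
    CoeffDifferentiableOn D fun _ => f := fun _ => differentiableOn_const _

theorem CoeffDifferentiableOn.add {D : Set ℂ} {f g : ℂ → MvPowerSeries (Fin d) ℂ}
    (hf : CoeffDifferentiableOn D f) (hg : CoeffDifferentiableOn D g) :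
    CoeffDifferentiableOn D fun x => f x + g x := fun m => by
  simp only [map_add]
  exact (hf m).add (hg m)

theorem CoeffDifferentiableOn.pow {D : Set ℂ} {f : ℂ → MvPowerSeries (Fin d) ℂ}
    (hf : CoeffDifferentiableOn D f) (k : ℕ) : CoeffDifferentiableOn D fun x => f x ^ k := by
  induction k with
  | zero =>
    simp only [pow_zero]
    exact coeffDifferentiableOn_const 1
  | succ k ih =>
    simp only [pow_succ]
    exact ih.mul hf

theorem CoeffDifferentiableOn.finset_prod {D : Set ℂ} {ι : Type*} (s : Finset ι)
    {f : ι → ℂ → MvPowerSeries (Fin d) ℂ} (hf : ∀ i, CoeffDifferentiableOn D (f i)) :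
    CoeffDifferentiableOn D fun x => ∏ i ∈ s, f i x := by
  classical
  induction s using Finset.induction_on with
  | empty =>
    simp only [Finset.prod_empty]
    exact coeffDifferentiableOn_const 1
  | insert i s hi ih =>
    simp only [Finset.prod_insert hi]
    exact (hf i).mul ih

theorem CoeffDifferentiableOn.subst {D : Set ℂ} {U : ℂ → Fin d → MvPowerSeries (Fin d) ℂ}
    (hU : ∀ x i, VanishesBelow 1 (U x i)) (hUd : ∀ i, CoeffDifferentiableOn D fun x => U x i)
    {f : ℂ → MvPowerSeries (Fin d) ℂ} (hf : CoeffDifferentiableOn D f) :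
    CoeffDifferentiableOn D fun x => MvPowerSeries.subst (U x) (f x) := by
  intro m
  simp only [coeff_subst_eq_sum (hU _)]
  exact DifferentiableOn.fun_sum fun e _ => (hf e).mul
    (CoeffDifferentiableOn.finset_prod e.support (fun i => (hUd i).pow (e i)) m)

/-- Partial derivatives in `u` preserve joint analyticity in `(x, u)`. -/
theorem analyticAt_partialDeriv {G : ℂ × (Fin d → ℂ) → ℂ} {x : ℂ} {u : Fin d → ℂ}
    (hG : AnalyticAt ℂ G (x, u)) (k : Fin d) :
    AnalyticAt ℂ (fun q : ℂ × (Fin d → ℂ) => partialDeriv k (fun u => G (q.1, u)) q.2) (x, u) := by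
  have h1 : AnalyticAt ℂ (fun q => fderiv ℂ G q ((0 : ℂ), Pi.single k (1 : ℂ))) (x, u) :=
    ((ContinuousLinearMap.apply ℂ ℂ ((0 : ℂ), (Pi.single k 1 : Fin d → ℂ))).analyticAt
      (fderiv ℂ G (x, u))).comp hG.fderiv
  refine h1.congr ?_
  filter_upwards [hG.eventually_analyticAt] with q hq
  have h2 : HasFDerivAt (fun u => G (q.1, u))
      ((fderiv ℂ G q).comp (ContinuousLinearMap.inr ℂ ℂ (Fin d → ℂ))) q.2 :=
    HasFDerivAt.comp q.2 (g := G) (f := fun u => (q.1, u)) hq.differentiableAt.hasFDerivAt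
      (hasFDerivAt_prodMk_right q.1 q.2)
  simp [partialDeriv, h2.fderiv]

theorem analyticAt_iterate_partialDeriv {G : ℂ → (Fin d → ℂ) → ℂ} {x : ℂ} {u : Fin d → ℂ}
    (hG : AnalyticAt ℂ (fun q : ℂ × (Fin d → ℂ) => G q.1 q.2) (x, u)) (k : Fin d) (n : ℕ) :
    AnalyticAt ℂ (fun q : ℂ × (Fin d → ℂ) => (partialDeriv k)^[n] (G q.1) q.2) (x, u) := by
  induction n with
  | zero => exact hG
  | succ n ih =>
    simp only [Function.iterate_succ_apply']
    exact analyticAt_partialDeriv ih k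

theorem analyticAt_iteratedPartialDeriv {G : ℂ → (Fin d → ℂ) → ℂ} {x : ℂ} {u : Fin d → ℂ}
    (hG : AnalyticAt ℂ (fun q : ℂ × (Fin d → ℂ) => G q.1 q.2) (x, u)) (m : Fin d →₀ ℕ) :
    AnalyticAt ℂ (fun q : ℂ × (Fin d → ℂ) => iteratedPartialDeriv m (G q.1) q.2) (x, u) := by
  unfold iteratedPartialDeriv
  induction List.finRange d with
  | nil => exact hG
  | cons k l ih =>
    simp only [List.foldr_cons]
    exact analyticAt_iterate_partialDeriv (G := fun x => List.foldr
      (fun k G => (partialDeriv k)^[m k] G) (G x) l) ih k (m k)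

theorem coeff_taylorSeries (g : (Fin d → ℂ) → ℂ) (m : Fin d →₀ ℕ) :
    MvPowerSeries.coeff m (taylorSeries g) =
      iteratedPartialDeriv m g 0 / ∏ k, ((m k).factorial : ℂ) := rfl

theorem coeffDifferentiableOn_taylorSeries {D : Set ℂ} {G : ℂ → (Fin d → ℂ) → ℂ}
    (hG : ∀ x ∈ D, AnalyticAt ℂ (fun q : ℂ × (Fin d → ℂ) => G q.1 q.2) (x, 0)) :
    CoeffDifferentiableOn D fun x => taylorSeries (G x) := by
  intro m x hx
  simp only [coeff_taylorSeries]
  have h1 : AnalyticAt ℂ (fun x => iteratedPartialDeriv m (G x) 0) x :=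
    AnalyticAt.comp (g := fun q : ℂ × (Fin d → ℂ) => iteratedPartialDeriv m (G q.1) q.2)
      (f := fun x => (x, 0)) (analyticAt_iteratedPartialDeriv (hG x hx) m)
      (analyticAt_id.prod analyticAt_const)
  exact (h1.differentiableAt.div_const _).differentiableWithinAt

theorem iteratedPartialDeriv_zero (g : (Fin d → ℂ) → ℂ) : iteratedPartialDeriv 0 g = g := by
  simp [iteratedPartialDeriv]

theorem iteratedPartialDeriv_single (g : (Fin d → ℂ) → ℂ) (k : Fin d) :
    iteratedPartialDeriv (Finsupp.single k 1) g = partialDeriv k g := by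
  have key : ∀ l : List (Fin d), l.Nodup → l.foldr
      (fun j G => (partialDeriv j)^[Finsupp.single k 1 j] G) g =
        if k ∈ l then partialDeriv k g else g := by
    intro l
    induction l with
    | nil => simp
    | cons j l ih =>
      intro hl
      rw [List.nodup_cons] at hl
      rw [List.foldr_cons, ih hl.2]
      rcases eq_or_ne k j with rfl | hkj
      · simp [hl.1]
      · simp [hkj]
  unfold iteratedPartialDeriv
  rw [key _ (List.nodup_finRange d), if_pos (List.mem_finRange k)]

/-- A function with a zero of order two has a Taylor series of order two. -/
theorem vanishesBelow_taylorSeries {F : (Fin d → ℂ) → Fin d → ℂ} (hF : DifferentiableAt ℂ F 0)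
    (h0 : F 0 = 0) (h1 : fderiv ℂ F 0 = 0) (i : Fin d) :
    VanishesBelow 2 (taylorSeries fun u => F u i) := by
  intro m hm
  have h : iteratedPartialDeriv m (fun u => F u i) 0 = 0 := by
    rcases Nat.lt_succ_iff_lt_or_eq.1 hm with hm | hm
    · rw [Nat.lt_one_iff, Finsupp.degree_eq_zero_iff] at hm
      rw [hm, iteratedPartialDeriv_zero, h0, Pi.zero_apply]
    · obtain ⟨k, rfl⟩ : ∃ k, Finsupp.single k 1 = m := by
        have : m ∈ Set.range fun k : Fin d => Finsupp.single k 1 := by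
          rw [Finsupp.range_single_one]
          exact hm
        exact this
      rw [iteratedPartialDeriv_single, partialDeriv, fderiv_apply hF, h1]
      rfl
  rw [coeff_taylorSeries, h, zero_div]

end

/-! ### The conjugacy equation degree by degree -/

section

variable {d : ℕ}

/-- The multi-indices of degree `n`. -/
abbrev MultiIndex (d n : ℕ) : Type := {m : Fin d →₀ ℕ // m.degree = n}

noncomputable instance (d n : ℕ) : Fintype (MultiIndex d n) :=
  (Finsupp.finite_of_degree_eq (σ := Fin d) n).fintype

/-- Coordinates for tuples of homogeneous polynomials of degree `n`. -/
abbrev HomogeneousTuple (d n : ℕ) : Type := Fin d → MultiIndex d n → ℂ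

/-- The coefficients of degree `n` of a tuple of formal series. -/
noncomputable def degreePart (n : ℕ) (h : Fin d → MvPowerSeries (Fin d) ℂ) :
    HomogeneousTuple d n := fun i m => MvPowerSeries.coeff m.1 (h i)

/-- The tuple of formal series whose coefficients of degree `n` are those of `w`, the others being
those of `h`. -/
noncomputable def setDegreePart {n : ℕ} {R : Type*} [Semiring R] (w : Fin d → MultiIndex d n → R)
    (h : Fin d → MvPowerSeries (Fin d) R) : Fin d → MvPowerSeries (Fin d) R :=
  fun i m => if hm : m.degree = n then w i ⟨m, hm⟩ else MvPowerSeries.coeff m (h i)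

theorem coeff_setDegreePart {n : ℕ} {R : Type*} [Semiring R] (w : Fin d → MultiIndex d n → R)
    (h : Fin d → MvPowerSeries (Fin d) R) (i : Fin d) (m : Fin d →₀ ℕ) (hm : m.degree = n) :
    MvPowerSeries.coeff m (setDegreePart w h i) = w i ⟨m, hm⟩ := by
  rw [MvPowerSeries.coeff_apply, setDegreePart, dif_pos hm]

theorem coeff_setDegreePart_of_ne {n : ℕ} {R : Type*} [Semiring R]
    (w : Fin d → MultiIndex d n → R) (h : Fin d → MvPowerSeries (Fin d) R) (i : Fin d)
    (m : Fin d →₀ ℕ) (hm : m.degree ≠ n) :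
    MvPowerSeries.coeff m (setDegreePart w h i) = MvPowerSeries.coeff m (h i) := by
  rw [MvPowerSeries.coeff_apply, setDegreePart, dif_neg hm]

theorem degreePart_setDegreePart {n : ℕ} (w : HomogeneousTuple d n)
    (h : Fin d → MvPowerSeries (Fin d) ℂ) : degreePart n (setDegreePart w h) = w := by
  ext i m
  exact coeff_setDegreePart w h i m.1 m.2

theorem linField_sum {N : ℕ} (a : Fin N → ℂ) (A : Fin N → Matrix (Fin d) (Fin d) ℂ) (k : Fin d) :
    linField (∑ j, a j • A j) k = ∑ j, a j • linField (A j) k := by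
  simp only [linField, Matrix.sum_apply, Matrix.smul_apply, map_sum, Finset.sum_mul,
    Finset.smul_sum, MvPowerSeries.smul_eq_C_mul, smul_eq_mul, map_mul, mul_assoc]
  exact Finset.sum_comm

theorem bracket_sum {N : ℕ} (a : Fin N → ℂ) (A : Fin N → Matrix (Fin d) (Fin d) ℂ)
    (h : Fin d → MvPowerSeries (Fin d) ℂ) (i : Fin d) :
    bracket (∑ j, a j • A j) h i = ∑ j, a j • bracket (A j) h i := by
  simp only [bracket, lieDeriv_apply, linField_sum, Matrix.sum_apply, Matrix.smul_apply, smul_sub,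
    Finset.sum_sub_distrib, Finset.mul_sum, Finset.smul_sum, mul_smul_comm, Finset.sum_smul,
    smul_assoc]
  congr 1 <;> exact Finset.sum_comm

/-- The bracket with a linear vector field respects degrees. -/
theorem coeff_bracket_congr (M : Matrix (Fin d) (Fin d) ℂ)
    {h h' : Fin d → MvPowerSeries (Fin d) ℂ} {m : Fin d →₀ ℕ}
    (hh : ∀ i m', m'.degree = m.degree →
      MvPowerSeries.coeff m' (h i) = MvPowerSeries.coeff m' (h' i)) (i : Fin d) :
    MvPowerSeries.coeff m (bracket M h i) = MvPowerSeries.coeff m (bracket M h' i) := by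
  simp only [bracket, map_sub, map_sum, MvPowerSeries.coeff_smul]
  rw [coeff_lieDeriv_congr M (hh i)]
  congr 1
  exact Finset.sum_congr rfl fun l _ => by rw [hh l m rfl]

theorem bracket_add (M : Matrix (Fin d) (Fin d) ℂ) (h h' : Fin d → MvPowerSeries (Fin d) ℂ)
    (i : Fin d) : bracket M (h + h') i = bracket M h i + bracket M h' i := by
  simp only [bracket, Pi.add_apply, map_add, smul_add, Finset.sum_add_distrib]
  abel

theorem bracket_smul (M : Matrix (Fin d) (Fin d) ℂ) (a : ℂ) (h : Fin d → MvPowerSeries (Fin d) ℂ)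
    (i : Fin d) : bracket M (a • h) i = a • bracket M h i := by
  simp only [bracket, Pi.smul_apply, map_smul, smul_sub, Finset.smul_sum]
  congr 1
  exact Finset.sum_congr rfl fun l _ => smul_comm _ _ _

/-- The homological operator in degree `n`: the bracket with `w ↦ M w` in coordinates. -/
noncomputable def homological (n : ℕ) (M : Matrix (Fin d) (Fin d) ℂ) :
    HomogeneousTuple d n →L[ℂ] HomogeneousTuple d n :=
  LinearMap.toContinuousLinearMap
    { toFun := fun w => degreePart n (bracket M (setDegreePart w 0))
      map_add' := fun w w' => by
        ext i m
        simp only [degreePart, Pi.add_apply, ← map_add, ← bracket_add]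
        refine coeff_bracket_congr M (fun i m' hm' => ?_) i
        rw [m.2] at hm'
        simp [coeff_setDegreePart _ _ _ _ hm']
      map_smul' := fun a w => by
        ext i m
        simp only [degreePart, Pi.smul_apply, smul_eq_mul, RingHom.id_apply,
          ← MvPowerSeries.coeff_smul, ← bracket_smul]
        refine coeff_bracket_congr M (fun i m' hm' => ?_) i
        rw [m.2] at hm'
        simp [coeff_setDegreePart _ _ _ _ hm'] }

theorem homological_degreePart (n : ℕ) (M : Matrix (Fin d) (Fin d) ℂ)
    (h : Fin d → MvPowerSeries (Fin d) ℂ) :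
    homological n M (degreePart n h) = degreePart n (bracket M h) := by
  ext i m
  refine coeff_bracket_congr M (fun i m' hm' => ?_) i
  rw [m.2] at hm'
  rw [coeff_setDegreePart _ _ _ _ hm']
  rfl

theorem homological_sum (n : ℕ) {N : ℕ} (a : Fin N → ℂ) (A : Fin N → Matrix (Fin d) (Fin d) ℂ)
    (w : HomogeneousTuple d n) :
    homological n (∑ j, a j • A j) w = ∑ j, a j • homological n (A j) w := by
  rw [← degreePart_setDegreePart w 0]
  simp only [homological_degreePart]
  ext i m
  simp [degreePart, bracket_sum, Finset.sum_apply]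

theorem setDegreePart_zero_mem {n : ℕ} (w : HomogeneousTuple d n) (i : Fin d) :
    setDegreePart w 0 i ∈ homogeneous d n := fun m hm => by
  rw [coeff_setDegreePart_of_ne _ _ _ _ hm]
  simp

theorem NonlinearlyNonresonant.eq_zero_of_homological {N : ℕ}
    {A : Fin N → Matrix (Fin d) (Fin d) ℂ} (hA : NonlinearlyNonresonant (∑ j, A j)) {n : ℕ}
    (hn : 2 ≤ n) (k : ℕ) (w : HomogeneousTuple d n)
    (h : (k : ℂ) • w + ∑ j, homological n (A j) w = 0) : w = 0 := by
  have h1 : ∑ j, homological n (A j) w = homological n (∑ j, A j) w := by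
    have := homological_sum n (fun _ => 1) A w
    simpa using this.symm
  rw [h1] at h
  have h2 := hA.eq_zero_of_bracket hn k (setDegreePart_zero_mem w) (fun i => by
    ext m
    rw [map_add, MvPowerSeries.coeff_smul, map_zero]
    by_cases hm : m.degree = n
    · rw [coeff_setDegreePart _ _ _ _ hm]
      have := congrFun (congrFun h i) ⟨m, hm⟩
      exact this
    · rw [setDegreePart_zero_mem w i m hm, bracket, map_sub,
        lieDeriv_mem _ _ (setDegreePart_zero_mem w i) m hm, map_sum]
      simp [setDegreePart_zero_mem w _ m hm])
  ext i m
  have h3 := coeff_setDegreePart w 0 i m.1 m.2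
  rw [h2 i, map_zero] at h3
  exact h3.symm

theorem vanishesBelow_nearIdentity_sub {h : FormalMap d} {x : ℂ}
    (hh : ∀ i, VanishesBelow 2 (h x i)) (i : Fin d) :
    VanishesBelow 2 (nearIdentity h x i - MvPowerSeries.X i) := by
  simpa [nearIdentity] using hh i

theorem vanishesBelow_nearIdentity {h : FormalMap d} {x : ℂ}
    (hh : ∀ i, VanishesBelow 2 (h x i)) (i : Fin d) : VanishesBelow 1 (nearIdentity h x i) :=
  (vanishesBelow_X i).add ((hh i).mono (by omega))

/-- The value of a correction at `x`. -/
noncomputable def evalAt (φ : Fin d → MvPowerSeries (Fin d) ℂ[X]) : FormalMap d :=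
  fun x i => MvPowerSeries.map (Polynomial.evalRingHom x) (φ i)

theorem coeff_evalAt (φ : Fin d → MvPowerSeries (Fin d) ℂ[X]) (x : ℂ) (i : Fin d)
    (m : Fin d →₀ ℕ) :
    MvPowerSeries.coeff m (evalAt φ x i) = (MvPowerSeries.coeff m (φ i)).eval x := by
  simp [evalAt]

theorem IsCorrection.vanishesBelow {S : ℕ} {φ : Fin d → MvPowerSeries (Fin d) ℂ[X]}
    (hφ : IsCorrection S φ) (x : ℂ) (i : Fin d) : VanishesBelow 2 (evalAt φ x i) := fun m hm => by
  rw [coeff_evalAt, hφ.1 i m hm, Polynomial.eval_zero]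

/-- The part of degree `n` of `t(x, U) - φ(x, U) + φ(x, w)`, where `U = w + h`. It involves `h` and
`φ` only in degrees below `n`. -/
noncomputable def residual (n : ℕ) (t h : FormalMap d)
    (φ : Fin d → MvPowerSeries (Fin d) ℂ[X]) (x : ℂ) : HomogeneousTuple d n :=
  degreePart n fun i => MvPowerSeries.subst (nearIdentity h x) (t x i) -
    MvPowerSeries.subst (nearIdentity h x) (evalAt φ x i) + evalAt φ x i

theorem residual_congr {S n : ℕ} (hn : 2 ≤ n) {t h h' : FormalMap d}
    {φ φ' : Fin d → MvPowerSeries (Fin d) ℂ[X]} {x : ℂ} (ht : ∀ i, VanishesBelow 2 (t x i))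
    (hh : ∀ i, VanishesBelow 2 (h x i)) (hh' : ∀ i, VanishesBelow 2 (h' x i))
    (hφ : IsCorrection S φ)
    (hhh' : ∀ i m, m.degree < n →
      MvPowerSeries.coeff m (h x i) = MvPowerSeries.coeff m (h' x i))
    (hφφ' : ∀ i m, m.degree < n → MvPowerSeries.coeff m (φ i) = MvPowerSeries.coeff m (φ' i)) :
    residual n t h φ x = residual n t h' φ' x := by
  obtain ⟨N, rfl⟩ : ∃ N, n = N + 1 := ⟨n - 1, by omega⟩
  have hU := vanishesBelow_nearIdentity hh
  have hU' := vanishesBelow_nearIdentity hh'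
  have hUU' : ∀ i, VanishesBelow (N + 1) (nearIdentity h x i - nearIdentity h' x i) :=
    fun i m hm => by simp [nearIdentity, hhh' i m hm]
  ext i ⟨m, hm⟩
  have hsub := coeff_subst_lowest (vanishesBelow_nearIdentity_sub hh')
    (f := evalAt φ x i - evalAt φ' x i) (m := m) (fun m' hm' => by
      rw [map_sub, coeff_evalAt, coeff_evalAt, hφφ' i m' (by omega), sub_self])
  rw [MvPowerSeries.subst_sub (VanishesBelow.hasSubst hU'), map_sub, map_sub] at hsub
  simp only [residual, degreePart, map_add, map_sub]
  rw [coeff_subst_congr hU hU' hUU' (ht i) (by omega),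
    coeff_subst_congr hU hU' hUU' (hφ.vanishesBelow x i) (by omega)]
  linear_combination -hsub

theorem differentiableOn_residual {n : ℕ} {D : Set ℂ} {t h : FormalMap d}
    {φ : Fin d → MvPowerSeries (Fin d) ℂ[X]} (ht : ∀ i, CoeffDifferentiableOn D fun x => t x i)
    (hh : ∀ x i, VanishesBelow 2 (h x i)) (hhd : ∀ i, CoeffDifferentiableOn D fun x => h x i) :
    DifferentiableOn ℂ (residual n t h φ) D := by
  refine differentiableOn_pi.2 fun i => differentiableOn_pi.2 fun m => ?_
  simp only [residual, degreePart, map_add, map_sub]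
  have hU : ∀ i, CoeffDifferentiableOn D fun x => nearIdentity h x i := fun i =>
    (coeffDifferentiableOn_const _).add (hhd i)
  have hφ : ∀ i, CoeffDifferentiableOn D fun x => evalAt φ x i := fun i m => by
    simp only [coeff_evalAt]
    exact (Polynomial.differentiable _).differentiableOn
  exact ((CoeffDifferentiableOn.subst (fun x => vanishesBelow_nearIdentity (hh x)) hU (ht i)
    m.1).sub (CoeffDifferentiableOn.subst (fun x => vanishesBelow_nearIdentity (hh x)) hU (hφ i)
    m.1)).add (hφ i m.1)

/-- The conjugacy equation in degree `n` at the point `x`. -/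
def DegreeEquation {S : ℕ} (n : ℕ) (p : Fin (S + 2) → ℂ)
    (A : Fin (S + 2) → Matrix (Fin d) (Fin d) ℂ) (t h : FormalMap d)
    (φ : Fin d → MvPowerSeries (Fin d) ℂ[X]) (x : ℂ) : Prop :=
  fuchsOp p (fun j => homological n (A j)) (fun t => degreePart n (h t)) x +
    degreePart n (evalAt φ x) = residual n t h φ x

theorem differentiableOn_degreePart {n : ℕ} {D : Set ℂ} {h : FormalMap d}
    (hh : ∀ i, CoeffDifferentiableOn D fun x => h x i) :
    DifferentiableOn ℂ (fun x => degreePart n (h x)) D :=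
  differentiableOn_pi.2 fun i => differentiableOn_pi.2 fun m => hh i m.1

/-- The terms `w` and `A(x) w` cancel from the conjugacy equation for `w + h(x, w)`. -/
theorem transforms_at_iff {N : ℕ} (p : Fin N → ℂ) (A : Fin N → Matrix (Fin d) (Fin d) ℂ)
    (f : ℂ → (Fin d → ℂ) → Fin d → ℂ) {h : FormalMap d} (φ : Fin d → MvPowerSeries (Fin d) ℂ[X])
    {x : ℂ} (hh : ∀ i, VanishesBelow 2 (h x i)) (i : Fin d) :
    derivX (nearIdentity h) x i + ∑ k, MvPowerSeries.pderiv ℂ k (nearIdentity h x i) *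
        linearField (fuchsianMatrix p A) x k =
      MvPowerSeries.subst (nearIdentity h x) (correctedField p A f φ x i) ↔
    derivX h x i + bracket (fuchsianMatrix p A x) (h x) i = (Q p x)⁻¹ •
      (MvPowerSeries.subst (nearIdentity h x) (taylorSeries fun u => f x u i) -
        MvPowerSeries.subst (nearIdentity h x) (evalAt φ x i)) := by
  have hs := VanishesBelow.hasSubst (vanishesBelow_nearIdentity hh)
  have h1 : derivX (nearIdentity h) x i = derivX h x i := by
    ext m
    simp only [derivX, nearIdentity, MvPowerSeries.coeff_apply]
    exact deriv_const_add _
  have h2 : ∑ k, MvPowerSeries.pderiv ℂ k (nearIdentity h x i) *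
      linearField (fuchsianMatrix p A) x k =
      linField (fuchsianMatrix p A x) i + lieDeriv (fuchsianMatrix p A x) (h x i) := by
    rw [lieDeriv_apply]
    simp only [nearIdentity, map_add, add_mul, Finset.sum_add_distrib, MvPowerSeries.pderiv_X,
      Pi.single_apply, ite_mul, one_mul, zero_mul]
    simp [linearField, linField]
  have h3 : MvPowerSeries.subst (nearIdentity h x) (linearField (fuchsianMatrix p A) x i) =
      linField (fuchsianMatrix p A x) i + ∑ k, fuchsianMatrix p A x i k • h x k := by
    simp only [linearField, linField]
    rw [← MvPowerSeries.coe_substAlgHom hs, map_sum]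
    simp only [MvPowerSeries.coe_substAlgHom hs, MvPowerSeries.subst_mul hs, MvPowerSeries.subst_C,
      MvPowerSeries.subst_X hs, nearIdentity, mul_add, Finset.sum_add_distrib,
      MvPowerSeries.smul_eq_C_mul]
  have h4 : MvPowerSeries.subst (nearIdentity h x) (correctedField p A f φ x i) =
      linField (fuchsianMatrix p A x) i + ∑ k, fuchsianMatrix p A x i k • h x k + (Q p x)⁻¹ •
      (MvPowerSeries.subst (nearIdentity h x) (taylorSeries fun u => f x u i) -
        MvPowerSeries.subst (nearIdentity h x) (evalAt φ x i)) := by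
    rw [correctedField, MvPowerSeries.subst_add hs, h3, MvPowerSeries.subst_mul hs,
      MvPowerSeries.subst_sub hs, MvPowerSeries.subst_C, MvPowerSeries.smul_eq_C_mul]
    rfl
  rw [h1, h2, h4, bracket]
  constructor
  · intro h
    linear_combination h
  · intro h
    linear_combination h

/-- The conjugacy equation holds if and only if it holds in every degree. -/
theorem transforms_iff {S : ℕ} {p : Fin (S + 2) → ℂ} {A : Fin (S + 2) → Matrix (Fin d) (Fin d) ℂ}
    {f : ℂ → (Fin d → ℂ) → Fin d → ℂ} {D : Set ℂ} (hDo : IsOpen D) {h : FormalMap d}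
    {φ : Fin d → MvPowerSeries (Fin d) ℂ[X]} (hh : ∀ x i, VanishesBelow 2 (h x i))
    (hhd : ∀ i, CoeffDifferentiableOn D fun x => h x i) :
    Transforms (D \ range p) (nearIdentity h) (linearField (fuchsianMatrix p A))
        (correctedField p A f φ) ↔
      ∀ n, ∀ x ∈ D \ range p,
        DegreeEquation n p A (fun x i => taylorSeries fun u => f x u i) h φ x := by
  have key : ∀ n, ∀ x ∈ D \ range p,
      DegreeEquation n p A (fun x i => taylorSeries fun u => f x u i) h φ x ↔
      ∀ i (m : Fin d →₀ ℕ), m.degree = n →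
        MvPowerSeries.coeff m (derivX h x i + bracket (fuchsianMatrix p A x) (h x) i) =
        MvPowerSeries.coeff m ((Q p x)⁻¹ •
          (MvPowerSeries.subst (nearIdentity h x) (taylorSeries fun u => f x u i) -
            MvPowerSeries.subst (nearIdentity h x) (evalAt φ x i))) := by
    intro n x hx
    have hQ := Q_ne_zero hx.2
    have hd : deriv (fun t => degreePart n (h t)) x = degreePart n (derivX h x) := by
      have hat : ∀ i m, DifferentiableAt ℂ (fun t => MvPowerSeries.coeff m (h t i)) x := fun i m =>
        (hhd i m).differentiableAt (hDo.mem_nhds hx.1)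
      refine HasDerivAt.deriv (hasDerivAt_pi.2 fun i => hasDerivAt_pi.2 fun m => ?_)
      exact (hat i m.1).hasDerivAt
    have h1 := inv_Q_smul_fuchsOp p (fun j => homological n (A j)) (fun t => degreePart n (h t)) hx.2
    rw [hd, ← homological_sum, homological_degreePart] at h1
    rw [DegreeEquation, ← eq_sub_iff_add_eq, ← (IsUnit.mk0 _ (inv_ne_zero hQ)).smul_left_cancel, h1]
    constructor
    · rintro h2 i m hm
      have h3 := congrFun (congrFun h2 i) ⟨m, hm⟩
      simp only [degreePart, residual, Pi.add_apply, Pi.smul_apply, Pi.sub_apply, map_add,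
        map_sub, smul_eq_mul, add_sub_cancel_right] at h3
      rw [map_add, MvPowerSeries.coeff_smul, map_sub]
      exact h3
    · intro h2
      ext i ⟨m, hm⟩
      have h3 := h2 i m hm
      rw [map_add, MvPowerSeries.coeff_smul, map_sub] at h3
      simp only [degreePart, residual, Pi.add_apply, Pi.smul_apply, Pi.sub_apply, map_add,
        map_sub, smul_eq_mul, add_sub_cancel_right]
      exact h3
  constructor
  · intro hT n x hx
    refine (key n x hx).2 fun i m _ => ?_
    rw [(transforms_at_iff p A f φ (hh x) i).1 (hT x hx i)]
  · intro hE x hx i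
    refine (transforms_at_iff p A f φ (hh x) i).2 ?_
    ext m
    exact (key m.degree x hx).1 (hE _ x hx) i m rfl

end

/-! ### Formal solutions -/

section

variable {d S : ℕ}

theorem degreeEquation_congr {n : ℕ} (hn : 2 ≤ n) {p : Fin (S + 2) → ℂ}
    {A : Fin (S + 2) → Matrix (Fin d) (Fin d) ℂ} {t h h' : FormalMap d}
    {φ φ' : Fin d → MvPowerSeries (Fin d) ℂ[X]} {x : ℂ} (ht : ∀ i, VanishesBelow 2 (t x i))
    (hh : ∀ x i, VanishesBelow 2 (h x i)) (hh' : ∀ x i, VanishesBelow 2 (h' x i))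
    (hφ : IsCorrection S φ)
    (hhh' : ∀ x i m, m.degree ≤ n →
      MvPowerSeries.coeff m (h x i) = MvPowerSeries.coeff m (h' x i))
    (hφφ' : ∀ i m, m.degree ≤ n → MvPowerSeries.coeff m (φ i) = MvPowerSeries.coeff m (φ' i)) :
    DegreeEquation n p A t h φ x ↔ DegreeEquation n p A t h' φ' x := by
  have h1 : ∀ x, degreePart n (h x) = degreePart n (h' x) := fun x => by
    ext i m
    exact hhh' x i m.1 m.2.le
  have h2 : degreePart n (evalAt φ x) = degreePart n (evalAt φ' x) := by
    ext i m
    simp only [degreePart, coeff_evalAt, hφφ' i m.1 m.2.le]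
  rw [DegreeEquation, DegreeEquation, residual_congr hn ht (hh x) (hh' x) hφ
    (fun i m hm => hhh' x i m hm.le) (fun i m hm => hφφ' i m hm.le), h2]
  simp only [h1]

/-- In degrees below two both sides of the conjugacy equation vanish. -/
theorem degreeEquation_of_lt_two {n : ℕ} (hn : n < 2) {p : Fin (S + 2) → ℂ}
    {A : Fin (S + 2) → Matrix (Fin d) (Fin d) ℂ} {t h : FormalMap d}
    {φ : Fin d → MvPowerSeries (Fin d) ℂ[X]} {x : ℂ} (ht : ∀ i, VanishesBelow 2 (t x i))
    (hh : ∀ x i, VanishesBelow 2 (h x i)) (hφ : IsCorrection S φ) :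
    DegreeEquation n p A t h φ x := by
  have h1 : (fun x => degreePart n (h x)) = fun _ => 0 := by
    ext x i m
    exact hh x i m.1 (m.2.trans_lt hn)
  have h2 : degreePart n (evalAt φ x) = 0 := by
    ext i m
    exact hφ.vanishesBelow x i m.1 (m.2.trans_lt hn)
  have h3 : residual n t h φ x = 0 := by
    ext i ⟨m, hm⟩
    have hU := vanishesBelow_nearIdentity_sub (hh x)
    simp only [residual, degreePart, map_add, map_sub, Pi.zero_apply]
    rw [coeff_subst_lowest hU ((ht i).mono (by omega)),
      coeff_subst_lowest hU ((hφ.vanishesBelow x i).mono (by omega)), ht i m (by omega)]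
    ring
  rw [DegreeEquation, h1, h2, h3]
  simp [fuchsOp]

/-- The coefficients of degree `n` of a correction. -/
noncomputable def correctionCoeff (S n : ℕ) (φ : Fin d → MvPowerSeries (Fin d) ℂ[X]) :
    Fin (S + 1) → HomogeneousTuple d n := fun l i m => (MvPowerSeries.coeff m.1 (φ i)).coeff l

theorem IsCorrection.degreePart_evalAt {φ : Fin d → MvPowerSeries (Fin d) ℂ[X]}
    (hφ : IsCorrection S φ) (n : ℕ) (x : ℂ) :
    degreePart n (evalAt φ x) = polyMap (correctionCoeff S n φ) x := by
  ext i m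
  rw [degreePart, coeff_evalAt,
    Polynomial.eval_eq_sum_range' (Nat.lt_succ_of_le (hφ.2 i m.1)), Finset.sum_range]
  simp [polyMap, correctionCoeff, mul_comm]

/-- The polynomials in `x` with given coefficients, as coefficients of degree `n` of a correction. -/
noncomputable def toPolynomial {n : ℕ} (c : Fin (S + 1) → HomogeneousTuple d n) (i : Fin d)
    (m : MultiIndex d n) : ℂ[X] :=
  ∑ l : Fin (S + 1), Polynomial.monomial (l : ℕ) (c l i m)

theorem isCorrection_setDegreePart {φ : Fin d → MvPowerSeries (Fin d) ℂ[X]}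
    (hφ : IsCorrection S φ) {n : ℕ} (hn : 2 ≤ n) (c : Fin (S + 1) → HomogeneousTuple d n) :
    IsCorrection S (setDegreePart (toPolynomial c) φ) := by
  refine ⟨fun i m hm => ?_, fun i m => ?_⟩
  · rw [coeff_setDegreePart_of_ne _ _ _ _ (by omega), hφ.1 i m hm]
  · by_cases hm : m.degree = n
    · rw [coeff_setDegreePart _ _ _ _ hm]
      refine Polynomial.natDegree_sum_le_of_forall_le _ _ fun l _ => ?_
      exact (Polynomial.natDegree_monomial_le _).trans (Nat.lt_succ_iff.1 l.2)
    · rw [coeff_setDegreePart_of_ne _ _ _ _ hm]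
      exact hφ.2 i m

theorem degreePart_evalAt_setDegreePart (φ : Fin d → MvPowerSeries (Fin d) ℂ[X]) {n : ℕ}
    (c : Fin (S + 1) → HomogeneousTuple d n) (x : ℂ) :
    degreePart n (evalAt (setDegreePart (toPolynomial c) φ) x) = polyMap c x := by
  ext i m
  rw [degreePart, coeff_evalAt, coeff_setDegreePart _ _ _ _ m.2]
  simp [toPolynomial, polyMap, Polynomial.eval_finsetSum, mul_comm]

/-- The pair `(h, φ)` solves the conjugacy equation in all degrees below `n`. -/
structure SolvesBelow (n : ℕ) (p : Fin (S + 2) → ℂ) (A : Fin (S + 2) → Matrix (Fin d) (Fin d) ℂ)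
    (D : Set ℂ) (t h : FormalMap d) (φ : Fin d → MvPowerSeries (Fin d) ℂ[X]) : Prop where
  vanishesBelow : ∀ x i, VanishesBelow 2 (h x i)
  coeffDifferentiableOn : ∀ i, CoeffDifferentiableOn D fun x => h x i
  isCorrection : IsCorrection S φ
  degreeEquation : ∀ k < n, ∀ x ∈ D, DegreeEquation k p A t h φ x

/-- A solution in degrees below `n` can be extended by one degree. -/
theorem SolvesBelow.exists_succ {n : ℕ} (hn : 2 ≤ n) {p : Fin (S + 2) → ℂ}
    (hp : Function.Injective p) {A : Fin (S + 2) → Matrix (Fin d) (Fin d) ℂ}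
    (hA : NonlinearlyNonresonant (∑ j, A j)) {D : Set ℂ} (hDo : IsOpen D)
    (hD : IsSimplyConnected D) (hpD : ∀ j, p j ∈ D) {t h : FormalMap d}
    {φ : Fin d → MvPowerSeries (Fin d) ℂ[X]} (ht : ∀ x ∈ D, ∀ i, VanishesBelow 2 (t x i))
    (htd : ∀ i, CoeffDifferentiableOn D fun x => t x i) (hs : SolvesBelow n p A D t h φ) :
    ∃ (h' : FormalMap d) (φ' : Fin d → MvPowerSeries (Fin d) ℂ[X]),
      SolvesBelow (n + 1) p A D t h' φ' ∧
      (∀ x i m, m.degree < n →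
        MvPowerSeries.coeff m (h x i) = MvPowerSeries.coeff m (h' x i)) ∧
      ∀ i m, m.degree < n → MvPowerSeries.coeff m (φ i) = MvPowerSeries.coeff m (φ' i) := by
  obtain ⟨hh, hhd, hφ, heq⟩ := hs
  obtain ⟨y, c, hy, hyc⟩ := exists_fuchsOp_add_polyMap hp (fun j => homological n (A j))
    (fun k v hv => hA.eq_zero_of_homological hn k v hv) hD hDo hpD
    (differentiableOn_residual (n := n) (φ := φ) htd hh hhd)
  let h' : FormalMap d := fun x => setDegreePart (y x) (h x)
  let φ' := setDegreePart (toPolynomial c) φ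
  have hh' : ∀ x i, VanishesBelow 2 (h' x i) := fun x i m hm => by
    rw [coeff_setDegreePart_of_ne _ _ _ _ (by omega), hh x i m hm]
  have hφ' : IsCorrection S φ' := isCorrection_setDegreePart hφ hn c
  have e1 : ∀ x i m, m.degree < n →
      MvPowerSeries.coeff m (h x i) = MvPowerSeries.coeff m (h' x i) := fun x i m hm =>
    (coeff_setDegreePart_of_ne _ _ _ _ hm.ne).symm
  have e2 : ∀ i m, m.degree < n → MvPowerSeries.coeff m (φ i) = MvPowerSeries.coeff m (φ' i) :=
    fun i m hm => (coeff_setDegreePart_of_ne _ _ _ _ hm.ne).symm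
  refine ⟨h', φ', ⟨hh', fun i m => ?_, hφ', fun k hk x hx => ?_⟩, e1, e2⟩
  · by_cases hm : m.degree = n
    · simp only [h', coeff_setDegreePart _ _ _ _ hm]
      exact differentiableOn_pi.1 (differentiableOn_pi.1 hy i) ⟨m, hm⟩
    · simp only [h', coeff_setDegreePart_of_ne _ _ _ _ hm]
      exact hhd i m
  · rcases Nat.lt_or_ge k 2 with hk2 | hk2
    · exact degreeEquation_of_lt_two hk2 (ht x hx) hh' hφ'
    rcases Nat.lt_succ_iff_lt_or_eq.1 hk with hk | rfl
    · exact (degreeEquation_congr hk2 (ht x hx) hh hh' hφ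
        (fun x i m hm => e1 x i m (hm.trans_lt hk)) (fun i m hm => e2 i m (hm.trans_lt hk))).1
        (heq k hk x hx)
    · rw [DegreeEquation, ← residual_congr hn (ht x hx) (hh x) (hh' x) hφ (e1 x) e2]
      simp only [h', φ', degreePart_setDegreePart, degreePart_evalAt_setDegreePart]
      exact hyc x hx

/-- Solutions in all degrees. -/
theorem exists_solvesBelow {p : Fin (S + 2) → ℂ} (hp : Function.Injective p)
    {A : Fin (S + 2) → Matrix (Fin d) (Fin d) ℂ} (hA : NonlinearlyNonresonant (∑ j, A j))
    {D : Set ℂ} (hDo : IsOpen D) (hD : IsSimplyConnected D) (hpD : ∀ j, p j ∈ D)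
    {t : FormalMap d} (ht : ∀ x ∈ D, ∀ i, VanishesBelow 2 (t x i))
    (htd : ∀ i, CoeffDifferentiableOn D fun x => t x i) :
    ∃ (h : FormalMap d) (φ : Fin d → MvPowerSeries (Fin d) ℂ[X]),
      ∀ n, SolvesBelow n p A D t h φ := by
  -- The approximations, each extending the previous one by one degree.
  let State : ℕ → Type := fun n => {q : FormalMap d × (Fin d → MvPowerSeries (Fin d) ℂ[X]) //
    SolvesBelow (n + 2) p A D t q.1 q.2}
  have hstep : ∀ n (q : State n), ∃ q' : State (n + 1),
      (∀ x i m, m.degree < n + 2 →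
        MvPowerSeries.coeff m (q.1.1 x i) = MvPowerSeries.coeff m (q'.1.1 x i)) ∧
      ∀ i m, m.degree < n + 2 →
        MvPowerSeries.coeff m (q.1.2 i) = MvPowerSeries.coeff m (q'.1.2 i) := by
    intro n q
    obtain ⟨h', φ', hs, e1, e2⟩ := q.2.exists_succ (by omega) hp hA hDo hD hpD ht htd
    exact ⟨⟨(h', φ'), hs⟩, e1, e2⟩
  choose next hnext using hstep
  have init : SolvesBelow 2 p A D t (fun _ _ => 0) (fun _ => 0) := by
    have h0 : ∀ (x : ℂ) (i : Fin d), VanishesBelow 2 ((fun _ _ => 0 : FormalMap d) x i) :=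
      fun _ _ m _ => by simp
    have h1 : IsCorrection S (fun _ => 0 : Fin d → MvPowerSeries (Fin d) ℂ[X]) :=
      ⟨fun i m _ => by simp, fun i m => by simp⟩
    exact ⟨h0, fun i => coeffDifferentiableOn_const 0, h1, fun k hk x hx =>
      degreeEquation_of_lt_two hk (ht x hx) h0 h1⟩
  let st : ∀ n, State n := fun n => Nat.rec ⟨(_, _), init⟩ (fun n q => next n q) n
  have agree : ∀ n k, (∀ x i m, m.degree < n + 2 →
        MvPowerSeries.coeff m ((st n).1.1 x i) = MvPowerSeries.coeff m ((st (n + k)).1.1 x i)) ∧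
      ∀ i m, m.degree < n + 2 →
        MvPowerSeries.coeff m ((st n).1.2 i) = MvPowerSeries.coeff m ((st (n + k)).1.2 i) := by
    intro n k
    induction k with
    | zero => exact ⟨fun _ _ _ _ => rfl, fun _ _ _ => rfl⟩
    | succ k ih =>
      have h1 := hnext (n + k) (st (n + k))
      exact ⟨fun x i m hm => (ih.1 x i m hm).trans (h1.1 x i m (by omega)),
        fun i m hm => (ih.2 i m hm).trans (h1.2 i m (by omega))⟩
  -- The coefficients of degree `n` are those of the `n`-th approximation.
  let h : FormalMap d := fun x i m => MvPowerSeries.coeff m ((st m.degree).1.1 x i)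
  let φ : Fin d → MvPowerSeries (Fin d) ℂ[X] := fun i m =>
    MvPowerSeries.coeff m ((st m.degree).1.2 i)
  have hst : ∀ n x i m, m.degree ≤ n →
      MvPowerSeries.coeff m ((st n).1.1 x i) = MvPowerSeries.coeff m (h x i) := by
    intro n x i m hm
    obtain ⟨k, rfl⟩ := Nat.exists_eq_add_of_le hm
    exact ((agree m.degree k).1 x i m (by omega)).symm
  have hst' : ∀ n i m, m.degree ≤ n →
      MvPowerSeries.coeff m ((st n).1.2 i) = MvPowerSeries.coeff m (φ i) := by
    intro n i m hm
    obtain ⟨k, rfl⟩ := Nat.exists_eq_add_of_le hm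
    exact ((agree m.degree k).2 i m (by omega)).symm
  have hh : ∀ x i, VanishesBelow 2 (h x i) := fun x i m hm =>
    (st m.degree).2.vanishesBelow x i m hm
  have hφ : IsCorrection S φ :=
    ⟨fun i m hm => (st m.degree).2.isCorrection.1 i m hm,
      fun i m => (st m.degree).2.isCorrection.2 i m⟩
  refine ⟨h, φ, fun n => ⟨hh, fun i m => (st m.degree).2.coeffDifferentiableOn i m, hφ,
    fun k _ x hx => ?_⟩⟩
  rcases Nat.lt_or_ge k 2 with hk2 | hk2
  · exact degreeEquation_of_lt_two hk2 (ht x hx) hh hφ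
  · exact (degreeEquation_congr hk2 (ht x hx) (st k).2.vanishesBelow hh (st k).2.isCorrection
      (hst k) (hst' k)).1 ((st k).2.degreeEquation k (by omega) x hx)

/-- The homogeneous linear problem, posed away from the poles. -/
theorem eq_zero_of_fuchsOp_add_polyMap_off_range {V : Type*} [NormedAddCommGroup V]
    [NormedSpace ℂ V] [CompleteSpace V] {p : Fin (S + 2) → ℂ} (hp : Function.Injective p)
    (L : Fin (S + 2) → V →L[ℂ] V)
    (hL : ∀ (k : ℕ) (v : V), (k : ℂ) • v + ∑ j, L j v = 0 → v = 0) {D : Set ℂ}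
    (hD : IsPreconnected D) (hDo : IsOpen D) (hpD : ∀ j, p j ∈ D) {y : ℂ → V}
    (hy : DifferentiableOn ℂ y D) {c : Fin (S + 1) → V}
    (h : ∀ x ∈ D \ range p, fuchsOp p L y x + polyMap c x = 0) : (∀ x ∈ D, y x = 0) ∧ c = 0 := by
  refine eq_zero_of_fuchsOp_add_polyMap hp L hL hD hDo hpD hy ?_
  obtain ⟨x₀, hx₀, hx₀p⟩ := exists_mem_notMem_range p hDo ⟨p 0, hpD 0⟩
  refine AnalyticOnNhd.eqOn_of_preconnected_of_eventuallyEq (g := fun _ => (0 : V))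
    (((differentiableOn_fuchsOp p L hDo hy).add
      (isPolyLT_polyMap c).differentiable.differentiableOn).analyticOnNhd hDo)
    analyticOnNhd_const hD hx₀ ?_
  exact eventually_of_mem ((hDo.sdiff (finite_range p).isClosed).mem_nhds ⟨hx₀, hx₀p⟩) h

/-- Two solutions of the conjugacy equation agree in each degree. -/
theorem eq_of_degreeEquation {p : Fin (S + 2) → ℂ} (hp : Function.Injective p)
    {A : Fin (S + 2) → Matrix (Fin d) (Fin d) ℂ} (hA : NonlinearlyNonresonant (∑ j, A j))
    {D : Set ℂ} (hD : IsPreconnected D) (hDo : IsOpen D) (hpD : ∀ j, p j ∈ D)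
    {t h h' : FormalMap d} {φ φ' : Fin d → MvPowerSeries (Fin d) ℂ[X]}
    (ht : ∀ x ∈ D, ∀ i, VanishesBelow 2 (t x i)) (hh : ∀ x i, VanishesBelow 2 (h x i))
    (hh' : ∀ x i, VanishesBelow 2 (h' x i)) (hhd : ∀ i, CoeffDifferentiableOn D fun x => h x i)
    (hhd' : ∀ i, CoeffDifferentiableOn D fun x => h' x i) (hφ : IsCorrection S φ)
    (hφ' : IsCorrection S φ') (heq : ∀ n, ∀ x ∈ D \ range p, DegreeEquation n p A t h φ x)
    (heq' : ∀ n, ∀ x ∈ D \ range p, DegreeEquation n p A t h' φ' x) : φ = φ' := by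
  have key : ∀ n (m : Fin d →₀ ℕ), m.degree = n → ∀ i,
      (∀ x ∈ D, MvPowerSeries.coeff m (h x i) = MvPowerSeries.coeff m (h' x i)) ∧
      MvPowerSeries.coeff m (φ i) = MvPowerSeries.coeff m (φ' i) := by
    intro n
    induction n using Nat.strong_induction_on with
    | _ n ih =>
      rcases Nat.lt_or_ge n 2 with hn | hn
      · rintro m rfl i
        exact ⟨fun x _ => by rw [hh x i m hn, hh' x i m hn], by rw [hφ.1 i m hn, hφ'.1 i m hn]⟩
      obtain ⟨h1, h2⟩ := eq_zero_of_fuchsOp_add_polyMap_off_range hp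
        (fun j => homological n (A j)) (fun k v hv => hA.eq_zero_of_homological hn k v hv) hD hDo hpD
        (y := fun x => degreePart n (h x) + (-1 : ℂ) • degreePart n (h' x))
        (c := correctionCoeff S n φ + (-1 : ℂ) • correctionCoeff S n φ')
        ((differentiableOn_degreePart hhd).add ((differentiableOn_degreePart hhd').fun_const_smul _))
        (fun x hx => by
          have hx' := hDo.mem_nhds hx.1
          have e := heq n x hx
          have e' := heq' n x hx
          rw [DegreeEquation, hφ.degreePart_evalAt] at e
          rw [DegreeEquation, hφ'.degreePart_evalAt,
            ← residual_congr hn (ht x hx.1) (hh x) (hh' x) hφ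
              (fun i m hm => (ih _ hm m rfl i).1 x hx.1) (fun i m hm => (ih _ hm m rfl i).2)] at e'
          rw [fuchsOp_add p _ (z := fun x => (-1 : ℂ) • degreePart n (h' x))
            ((differentiableOn_degreePart hhd).differentiableAt hx')
            (((differentiableOn_degreePart hhd').differentiableAt hx').const_smul (-1 : ℂ)),
            fuchsOp_smul, polyMap_add, polyMap_smul, add_add_add_comm, ← smul_add, e, e',
            neg_one_smul, add_neg_cancel])
      rintro m hm i
      refine ⟨fun x hx => ?_, ?_⟩
      · have h3 := congrFun (congrFun (h1 x hx) i) ⟨m, hm⟩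
        rw [neg_one_smul, ← sub_eq_add_neg] at h3
        exact sub_eq_zero.1 h3
      · ext l
        by_cases hl : l ≤ S
        · have h3 := congrFun (congrFun (congrFun h2 ⟨l, Nat.lt_succ_of_le hl⟩) i) ⟨m, hm⟩
          rw [neg_one_smul, ← sub_eq_add_neg] at h3
          exact sub_eq_zero.1 h3
        · rw [Polynomial.coeff_eq_zero_of_natDegree_lt, Polynomial.coeff_eq_zero_of_natDegree_lt]
          · exact (hφ'.2 i m).trans_lt (by omega)
          · exact (hφ.2 i m).trans_lt (by omega)
  ext1 i
  ext1 m
  exact (key _ m rfl i).2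

end

end Fuchs

theorem theorem1 {S d : ℕ} (p : Fin (S + 2) → ℂ) (hp : Function.Injective p)
    (A : Fin (S + 2) → Matrix (Fin d) (Fin d) ℂ)
    (hA : ∀ j, Fuchs.NonlinearlyNonresonant (A j))
    (hAinf : Fuchs.NonlinearlyNonresonant (∑ j, A j))
    (D : Set ℂ) (hDopen : IsOpen D) (hDsc : IsSimplyConnected D) (hpD : ∀ j, p j ∈ D)
    (f : ℂ → (Fin d → ℂ) → Fin d → ℂ)
    (hf : ∀ x ∈ D, AnalyticAt ℂ (fun q : ℂ × (Fin d → ℂ) => f q.1 q.2) (x, 0))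
    (hf0 : ∀ x ∈ D, f x 0 = 0) (hf1 : ∀ x ∈ D, fderiv ℂ (f x) 0 = 0) :
    ∃! φ : Fin d → MvPowerSeries (Fin d) (Polynomial ℂ),
      Fuchs.IsCorrection S φ ∧
      ∃ h : Fuchs.FormalMap d, Fuchs.IsAnalyticHigherOrder D h ∧
        Fuchs.Transforms (D \ Set.range p) (Fuchs.nearIdentity h)
          (Fuchs.linearField (Fuchs.fuchsianMatrix p A)) (Fuchs.correctedField p A f φ) := by
  have hDc : IsPreconnected D := hDsc.isPathConnected.isConnected.isPreconnected
  have ht : ∀ x ∈ D, ∀ i, Fuchs.VanishesBelow 2 (Fuchs.taylorSeries fun u => f x u i) :=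
    fun x hx i => Fuchs.vanishesBelow_taylorSeries
      (DifferentiableAt.comp (𝕜 := ℂ) (g := fun q : ℂ × (Fin d → ℂ) => f q.1 q.2)
        (f := fun u => (x, u)) 0 (hf x hx).differentiableAt (by fun_prop)) (hf0 x hx) (hf1 x hx) i
  have htd : ∀ i, Fuchs.CoeffDifferentiableOn D fun x => Fuchs.taylorSeries fun u => f x u i :=
    fun i => Fuchs.coeffDifferentiableOn_taylorSeries (G := fun x u => f x u i) fun x hx =>
      ((ContinuousLinearMap.proj (R := ℂ) (φ := fun _ : Fin d => ℂ) i).analyticAt _).comp (hf x hx)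
  obtain ⟨h, φ, hs⟩ := Fuchs.exists_solvesBelow hp hAinf hDopen hDsc hpD
    (t := fun x i => Fuchs.taylorSeries fun u => f x u i) ht htd
  have hh := (hs 0).vanishesBelow
  have hhd := (hs 0).coeffDifferentiableOn
  refine ⟨φ, ⟨(hs 0).isCorrection, h, ⟨fun i m hm x => hh x i m hm,
    fun i m => (hhd i m).analyticOnNhd hDopen⟩, (Fuchs.transforms_iff hDopen hh hhd).2
      fun n x hx => (hs (n + 1)).degreeEquation n n.lt_succ_self x hx.1⟩, ?_⟩
  rintro φ' ⟨hφ', h', ⟨hh', hhd'⟩, hT⟩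
  have hh'' : ∀ x i, Fuchs.VanishesBelow 2 (h' x i) := fun x i m hm => hh' i m hm x
  have hhd'' : ∀ i, Fuchs.CoeffDifferentiableOn D fun x => h' x i :=
    fun i m => (hhd' i m).differentiableOn
  exact Fuchs.eq_of_degreeEquation hp hAinf hDc hDopen hpD ht hh'' hh hhd'' hhd hφ'
    (hs 0).isCorrection ((Fuchs.transforms_iff hDopen hh'' hhd'').1 hT)
    fun n x hx => (hs (n + 1)).degreeEquation n n.lt_succ_self x hx.1
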